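/- Let $M$ be a closed (compact, without boundary) connected smooth manifold of dimension $n\ge 2$, and let $\pi:T^*M\to M$ be its cotangent bundle. Let $\Sigma\subseteq T^*M$ be a closed convex hypersurface, that is, a compact smooth embedded codimension-one submanifold of $T^*M$ without boundary such that, for every $q\in M$, the intersection $\Sigma\cap T_q^*M$ is a smooth closed (compact, boundaryless, connected, non-empty) hypersurface of the vector space $T_q^*M$ whose second fundamental form, with respect to a suitable choice of unit normal, is positive definite at every point. (This does not depend on the Euclidean structure chosen on $T_q^*M$.) Let $\psi:T^*M\to T^*M$ be any diffeomorphism that is smoothly isotopic to the identity, i.e. there are diffeomorphisms $\psi_t$ of $T^*M$, $t\in[0,1]$, with $(t,x)\mapsto\psi_t(x)$ smooth on $[0,1]\times T^*M$, $\psi_0=\mathrm{id}$ and $\psi_1=\psi$. Then $$\psi(\Sigma)\cap T_q^*M\neq\emptyset\qquad\text{for every } q\in M.$$ -/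

import Mathlib

open Set Bundle Manifold
open scoped ContDiff Topology

noncomputable section

/-- The cotangent space `T*_q M` of an `n`-dimensional manifold at `q`. -/
abbrev CotangentSpace (n : ℕ) {M : Type*} [TopologicalSpace M]
    [ChartedSpace (EuclideanSpace ℝ (Fin n)) M] (q : M) : Type :=
  TangentSpace (𝓡 n) q →L[ℝ] Bundle.Trivial M ℝ q

/-- The model fibre of the cotangent bundle. -/
abbrev ModelCovector (n : ℕ) : Type := EuclideanSpace ℝ (Fin n) →L[ℝ] ℝ

/-- The cotangent bundle `T*M`; its topology and smooth structure are those of the bundle of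
continuous linear maps from `TM` to the trivial line bundle. -/
abbrev CotangentBundle (n : ℕ) (M : Type*) [TopologicalSpace M]
    [ChartedSpace (EuclideanSpace ℝ (Fin n)) M] [IsManifold (𝓡 n) ∞ M] : Type _ :=
  TotalSpace (ModelCovector n) (fun q : M => CotangentSpace n q)

/-- The model with corners (without boundary) of `T*M`. -/
abbrev cotangentModel (n : ℕ) :
    ModelWithCorners ℝ (EuclideanSpace ℝ (Fin n) × ModelCovector n)
      (ModelProd (EuclideanSpace ℝ (Fin n)) (ModelCovector n)) :=
  (𝓡 n).prod 𝓘(ℝ, ModelCovector n)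

/-- The fibre `T*_q M`, as a subset of `T*M`. -/
def cotangentFibre (n : ℕ) {M : Type*} [TopologicalSpace M]
    [ChartedSpace (EuclideanSpace ℝ (Fin n)) M] [IsManifold (𝓡 n) ∞ M] (q : M) :
    Set (CotangentBundle n M) :=
  {x | x.proj = q}

/-- `S` is a smooth (embedded, codimension one, boundaryless) hypersurface of the manifold `X`:
near each of its points it is the zero set of a smooth function with non-zero differential. -/
def IsSmoothHypersurface {E H : Type*} [NormedAddCommGroup E] [NormedSpace ℝ E]
    [TopologicalSpace H] (J : ModelWithCorners ℝ E H) {X : Type*} [TopologicalSpace X]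
    [ChartedSpace H X] (S : Set X) : Prop :=
  ∀ x ∈ S, ∃ (U : Set X) (F : X → ℝ), IsOpen U ∧ x ∈ U ∧ ContMDiffOn J 𝓘(ℝ, ℝ) ∞ F U ∧
    S ∩ U = {y ∈ U | F y = 0} ∧ mfderiv J 𝓘(ℝ, ℝ) F x ≠ 0

/-- The second fundamental form at `p` of the level set of `F` through `p`, with respect to the
unit normal `-∇F / |∇F|`: on vectors `v`, `w` tangent to the level set it equals
`D²F_p(v, w) / |dF_p|`. -/
def secondFundamentalForm {V : Type*} [NormedAddCommGroup V] [NormedSpace ℝ V]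
    (F : V → ℝ) (p v w : V) : ℝ :=
  fderiv ℝ (fderiv ℝ F) p v w / ‖fderiv ℝ F p‖

/-- `S` is a smooth closed (compact, boundaryless, connected, non-empty) hypersurface of the
vector space `V`, with positive definite second fundamental form. Near each of its points `S` is
the regular zero set of a smooth function `F`; the sign of `F` is the choice of the unit normal,
and `{v | dF_p v = 0}` is the tangent space of `S` at `p`. -/
structure IsClosedConvexHypersurface {V : Type*} [NormedAddCommGroup V] [NormedSpace ℝ V]
    (S : Set V) : Prop where
  isCompact : IsCompact S
  isConnected : IsConnected S
  posDef : ∀ p ∈ S, ∃ (U : Set V) (F : V → ℝ), IsOpen U ∧ p ∈ U ∧ ContDiffOn ℝ ∞ F U ∧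
    S ∩ U = {y ∈ U | F y = 0} ∧ fderiv ℝ F p ≠ 0 ∧
    ∀ v : V, fderiv ℝ F p v = 0 → v ≠ 0 → 0 < secondFundamentalForm F p v v

/-- The part of `S ⊆ T*M` in the fibre over `q`, as a subset of the vector space `T*_q M` (in
Mathlib `T_q M` is the model space `ℝⁿ`, through the preferred chart at `q`). -/
def fibreSlice {n : ℕ} {M : Type*} [TopologicalSpace M]
    [ChartedSpace (EuclideanSpace ℝ (Fin n)) M] [IsManifold (𝓡 n) ∞ M]
    (S : Set (CotangentBundle n M)) (q : M) : Set (ModelCovector n) :=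
  {p | (⟨q, p⟩ : CotangentBundle n M) ∈ S}

/-- A closed hypersurface `S` of `T*M` is convex if each `S ∩ T*_q M` is a smooth closed
hypersurface of `T*_q M` with positive definite second fundamental form. -/
structure IsConvexHypersurface {n : ℕ} {M : Type*} [TopologicalSpace M]
    [ChartedSpace (EuclideanSpace ℝ (Fin n)) M] [IsManifold (𝓡 n) ∞ M]
    (S : Set (CotangentBundle n M)) : Prop where
  isCompact : IsCompact S
  smooth : IsSmoothHypersurface (cotangentModel n) S
  convex : ∀ q : M, IsClosedConvexHypersurface (fibreSlice S q)

/-- The diffeomorphism `ψ` of `X` is (smoothly) isotopic to the identity: it is the end point of a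
family `φ t`, `t ∈ [0,1]`, of diffeomorphisms which starts at the identity and is smooth in
`(t, x)`. -/
def IsIsotopicToId {E H : Type*} [NormedAddCommGroup E] [NormedSpace ℝ E]
    [TopologicalSpace H] {J : ModelWithCorners ℝ E H} {X : Type*} [TopologicalSpace X]
    [ChartedSpace H X] (ψ : Diffeomorph J J X X ∞) : Prop :=
  ∃ φ : unitInterval → Diffeomorph J J X X ∞,
    ContMDiff ((𝓡∂ 1).prod J) J ∞ (fun z : unitInterval × X => φ z.1 z.2) ∧
    (∀ x, φ 0 x = x) ∧ ∀ x, φ 1 x = ψ x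

end

/-! By Hadamard's theorem each slice of Σ bounds a strictly convex body. Together these bodies form
a compact set `fibrewiseHull` in T*M. Its fibrewise interior is open and contains a section `s`, by
a partition of unity. Suppose ψ(Σ) misses the fibre over q, and let A be the preimage of that fibre
under ψ. A is closed, connected, non-compact and disjoint from Σ, so it lies entirely in the
interior or entirely outside the hull. The first is impossible by compactness, so A misses the
interior. But x ↦ π(ψ_t(s x)) is a homotopy from the identity of M to x ↦ π(ψ(s x)), and a self-map
of a closed manifold homotopic to the identity is onto. A point x sent to q gives s x in A and in
the interior, a contradiction.

Three facts carry the argument.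

Hadamard's theorem: positivity of the second fundamental form makes a slice locally the zero set of
a strictly convex function. A global function with these local signs is obtained by lifting a
circle-valued map. An open-closed argument on pairs of points then puts every chord in its closed
negative side (`IsSeparatingFunction.chord_le`), so all points are exposed.

Semicontinuity of the slices: Σ is not assumed transverse to the fibres. If its defining function
had constant sign on a fibre near a zero, moving the base point would split the slice into two
sheets, against strict convexity (`false_of_nonneg_on_fibre`). This gives lower semicontinuity;
upper semicontinuity is compactness of Σ.

Surjectivity, without degree theory: M is embedded in a Euclidean space, and the homotopy is
extended over a tube by transporting normal vectors. The result is a map equal to the identity far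
away, which is onto by the no-retraction theorem (`surjective_of_homotopic_id`). -/

/-! ### The no-retraction theorem, by change of variables and polynomial dependence on a parameter
-/

section NoRetraction

open MeasureTheory Metric

/-- Polynomials of degree `≤ N` are evaluated at `1` by a fixed interpolation formula. -/
theorem exists_interpolation_weights (N : ℕ) (v : Fin (N + 1) → ℝ) (hv : Function.Injective v) :
    ∃ c : Fin (N + 1) → ℝ, ∀ p : Polynomial ℝ, p.natDegree ≤ N →
      p.eval 1 = ∑ i, c i * p.eval (v i) := by
  refine ⟨fun i => (Lagrange.basis Finset.univ v i).eval 1, fun p hp => ?_⟩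
  have hdeg : p.degree < (Finset.univ : Finset (Fin (N + 1))).card := by
    rw [Finset.card_univ, Fintype.card_fin]
    refine lt_of_le_of_lt Polynomial.degree_le_natDegree ?_
    exact_mod_cast Nat.lt_succ_of_le hp
  have h := Lagrange.eq_interpolate (s := Finset.univ) (v := v) hv.injOn hdeg
  conv_lhs => rw [h]
  rw [Lagrange.interpolate_apply, Polynomial.eval_finsetSum]
  refine Finset.sum_congr rfl fun i _ => ?_
  simp [mul_comm]

/-- `det (1 + s A)` is a polynomial in `s` of degree at most the dimension. -/
theorem exists_polynomial_det_one_add_smul {V : Type*} [NormedAddCommGroup V] [NormedSpace ℝ V]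
    [FiniteDimensional ℝ V] (A : V →L[ℝ] V) :
    ∃ p : Polynomial ℝ, p.natDegree ≤ Module.finrank ℝ V ∧
      ∀ s : ℝ, (ContinuousLinearMap.id ℝ V + s • A).det = p.eval s := by
  classical
  let b := Module.finBasis ℝ V
  let M := LinearMap.toMatrix b b (A : V →ₗ[ℝ] V)
  refine ⟨Matrix.det ((Polynomial.X : Polynomial ℝ) • M.map Polynomial.C +
    (1 : Matrix _ _ ℝ).map Polynomial.C), ?_, fun s => ?_⟩
  · simpa using Polynomial.natDegree_det_X_add_C_le M 1
  · rw [← Polynomial.coe_evalRingHom, RingHom.map_det, ContinuousLinearMap.det,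
      ← LinearMap.det_toMatrix b]
    congr 1
    ext i j
    simp [M, Matrix.add_apply, LinearMap.toMatrix_apply, Matrix.one_apply, b.repr_self,
      Finsupp.single_apply, eq_comm (a := j)]
    split_ifs <;> simp <;> ring

/-- A function with bounded derivative on a ball, vanishing on the sphere, extended by zero is
Lipschitz. -/
theorem norm_indicator_ball_sub_le {V W : Type*} [NormedAddCommGroup V] [NormedSpace ℝ V]
    [NormedAddCommGroup W] [NormedSpace ℝ W] {R L : ℝ} (hL : 0 ≤ L)
    {h : V → W} (hd : Differentiable ℝ h)
    (hbd : ∀ z ∈ closedBall (0 : V) R, ‖fderiv ℝ h z‖ ≤ L) (h0 : ∀ z, ‖z‖ = R → h z = 0) (x y : V) :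
    ‖(ball (0 : V) R).indicator h x - (ball (0 : V) R).indicator h y‖ ≤ L * ‖x - y‖ := by
  have key : ∀ x ∈ closedBall (0 : V) R, ∀ y ∈ closedBall (0 : V) R, ‖h x - h y‖ ≤ L * ‖x - y‖ :=
    fun x hx y hy => (convex_closedBall (0 : V) R).norm_image_sub_le_of_norm_fderiv_le
      (fun z _ => hd z) hbd hy hx
  -- The segment from x to y crosses the sphere, where h vanishes, at a point no farther from x than
  -- y is.
  have mixed : ∀ x ∈ ball (0 : V) R, ∀ y ∉ ball (0 : V) R, ‖h x‖ ≤ L * ‖x - y‖ := by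
    intro x hx y hy
    have hc : ContinuousOn (fun t : ℝ => ‖AffineMap.lineMap x y t‖) (Icc 0 1) := by
      refine Continuous.continuousOn ?_
      exact (AffineMap.lineMap_continuous (R := ℝ)).norm
    have hmem : R ∈ Icc (‖AffineMap.lineMap x y (0 : ℝ)‖) (‖AffineMap.lineMap x y (1 : ℝ)‖) := by
      simp only [AffineMap.lineMap_apply_zero, AffineMap.lineMap_apply_one]
      simp only [mem_ball_zero_iff, not_lt] at hx hy
      exact ⟨hx.le, hy⟩
    obtain ⟨t, ht, htR⟩ := intermediate_value_Icc zero_le_one hc hmem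
    set z := AffineMap.lineMap x y t with hz
    have h1 := key x (ball_subset_closedBall hx) z (by simpa using htR.le)
    rw [h0 z htR, sub_zero] at h1
    refine h1.trans (mul_le_mul_of_nonneg_left ?_ hL)
    rw [← dist_eq_norm, ← dist_eq_norm, hz, dist_left_lineMap]
    refine mul_le_of_le_one_left dist_nonneg ?_
    rw [Real.norm_of_nonneg ht.1]
    exact ht.2
  by_cases hx : x ∈ ball (0 : V) R <;> by_cases hy : y ∈ ball (0 : V) R
  · simpa [indicator_of_mem, hx, hy] using
      key x (ball_subset_closedBall hx) y (ball_subset_closedBall hy)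
  · rw [indicator_of_mem hx, indicator_of_notMem hy, sub_zero]
    exact mixed x hx y hy
  · rw [indicator_of_notMem hx, indicator_of_mem hy, zero_sub, norm_neg, norm_sub_rev]
    exact mixed y hy x hx
  · rw [indicator_of_notMem hx, indicator_of_notMem hy, sub_zero, norm_zero]
    positivity

/-- A small Lipschitz perturbation of the identity supported in a set maps that set onto itself
injectively. -/
theorem injOn_and_image_eq_of_lipschitz_perturbation {V : Type*} [NormedAddCommGroup V]
    [NormedSpace ℝ V] [CompleteSpace V] [Nontrivial V] {B : Set V} {k : V → V} {c : NNReal}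
    (hc : c < 1) (hk : LipschitzWith c k) (h0 : ∀ z ∉ B, k z = 0) :
    InjOn (fun z => z + k z) B ∧ (fun z => z + k z) '' B = B := by
  set f : V → V := fun z => z + k z with hf
  have happ : ApproximatesLinearOn f ((ContinuousLinearEquiv.refl ℝ V : V ≃L[ℝ] V) : V →L[ℝ] V)
      univ c := by
    intro x _ y _
    have : f x - f y - ((ContinuousLinearEquiv.refl ℝ V : V ≃L[ℝ] V) : V →L[ℝ] V) (x - y)
        = k x - k y := by
      simp [hf]; abel
    rw [this]
    exact hk.norm_sub_le x y
  have hc' : Subsingleton V ∨ c < ‖((ContinuousLinearEquiv.refl ℝ V : V ≃L[ℝ] V).symm :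
      V →L[ℝ] V)‖₊⁻¹ := by
    right
    have : ‖((ContinuousLinearEquiv.refl ℝ V : V ≃L[ℝ] V).symm : V →L[ℝ] V)‖₊ = 1 := by
      ext
      exact ContinuousLinearMap.norm_id
    rw [this, inv_one]
    exact hc
  have hinj : Function.Injective f := injOn_univ.mp (happ.injOn hc')
  have hsurj : Function.Surjective f := happ.surjective hc'
  refine ⟨hinj.injOn, ?_⟩
  -- The map fixes every point off B, so injectivity forbids a point of B to land off B.
  have hout : ∀ z ∉ B, f z = z := fun z hz => by simp [hf, h0 z hz]
  ext y
  constructor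
  · rintro ⟨x, hx, rfl⟩
    by_contra hy
    have := hinj (hout _ hy)
    simp only [hf] at hy this
    rw [this] at hy
    exact hy hx
  · intro hy
    obtain ⟨x, rfl⟩ := hsurj y
    refine ⟨x, ?_, rfl⟩
    by_contra hx
    rw [hout x hx] at hy
    exact hx hy

/-- Differentiating ‖w‖² = R² shows that the image of the derivative is orthogonal to the nonzero
vector w x. -/
theorem det_fderiv_eq_zero_of_norm_eq_const {V : Type*} [NormedAddCommGroup V]
    [InnerProductSpace ℝ V] [FiniteDimensional ℝ V] {w : V → V} {R : ℝ} (hR : 0 < R)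
    (hw : Differentiable ℝ w) (hn : ∀ z, ‖w z‖ = R) (x : V) : (fderiv ℝ w x).det = 0 := by
  have hort : ∀ v, inner ℝ (w x) (fderiv ℝ w x v) = 0 := by
    intro v
    have h1 : HasFDerivAt (fun z => ‖w z‖ ^ 2) _ x := ((hw x).hasFDerivAt).norm_sq
    have h2 : HasFDerivAt (fun z => ‖w z‖ ^ 2) (0 : V →L[ℝ] ℝ) x := by
      simp only [hn]
      exact hasFDerivAt_const _ _
    have h3 := congrArg (fun l => l v) (h1.unique h2)
    simpa using h3
  by_contra hdet
  have hu : IsUnit (LinearMap.det (fderiv ℝ w x : V →ₗ[ℝ] V)) := isUnit_iff_ne_zero.mpr hdet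
  obtain ⟨v, hv⟩ := (LinearEquiv.ofIsUnitDet (f := (fderiv ℝ w x : V →ₗ[ℝ] V))
    (v := Module.finBasis ℝ V) (v' := Module.finBasis ℝ V)
    (by rwa [LinearMap.det_toMatrix])).surjective (w x)
  have h1 := hort v
  have h2 : fderiv ℝ w x v = w x := by simpa using hv
  rw [h2, real_inner_self_eq_norm_sq, hn] at h1
  exact hR.ne' (by simpa using h1)

/-- For small s the map z + s h(z) is a bijection of the ball onto itself with positive Jacobian, so
the integral is a change of variables. -/
theorem setIntegral_det_eq_of_perturbation {V : Type*} [NormedAddCommGroup V]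
    [InnerProductSpace ℝ V] [FiniteDimensional ℝ V] [Nontrivial V]
    [MeasurableSpace V] [BorelSpace V] {h : V → V} {R L : ℝ} (hL : 0 < L)
    (hd : ContDiff ℝ 1 h)
    (hbd : ∀ z ∈ closedBall (0 : V) R, ‖fderiv ℝ h z‖ ≤ L) (h0 : ∀ z, ‖z‖ = R → h z = 0) :
    ∃ s₀ : ℝ, 0 < s₀ ∧ ∀ s ∈ Ioo 0 s₀, ∫ x in ball (0 : V) R,
      (ContinuousLinearMap.id ℝ V + s • fderiv ℝ h x).det = (volume (ball (0 : V) R)).toReal := by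
  have hdetpos : ∀ᶠ A in 𝓝 (ContinuousLinearMap.id ℝ V), 0 < A.det := by
    refine (ContinuousLinearMap.continuous_det.tendsto _).eventually (lt_mem_nhds ?_)
    simp [ContinuousLinearMap.det]
  obtain ⟨δ, hδ, hδA⟩ := Metric.eventually_nhds_iff.mp hdetpos
  -- Below δ / L the determinant is positive, so its absolute value can be dropped; below 1 / L the
  -- perturbation is a contraction.
  refine ⟨min (δ / L) (1 / L), by positivity, fun s hs => ?_⟩
  have hs1 : s * L < δ := (lt_div_iff₀ hL).mp (hs.2.trans_le (min_le_left _ _))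
  have hs2 : s * L < 1 := (lt_div_iff₀ hL).mp (hs.2.trans_le (min_le_right _ _))
  have hs0 := hs.1
  set k : V → V := fun z => s • (ball (0 : V) R).indicator h z with hk
  have hlip : LipschitzWith (s * L).toNNReal k := by
    refine LipschitzWith.of_dist_le_mul fun x y => ?_
    rw [dist_eq_norm, dist_eq_norm, hk, ← smul_sub, norm_smul, Real.norm_of_nonneg hs0.le]
    have := norm_indicator_ball_sub_le hL.le (hd.differentiable one_ne_zero) hbd h0 x y
    calc s * _ ≤ s * (L * ‖x - y‖) := by gcongr
      _ = _ := by rw [← mul_assoc, Real.coe_toNNReal _ (by positivity)]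
  obtain ⟨hinj, himg⟩ := injOn_and_image_eq_of_lipschitz_perturbation (B := ball (0 : V) R)
    (c := (s * L).toNNReal) (by rwa [Real.toNNReal_lt_one]) hlip
    (fun z hz => by simp [hk, indicator_of_notMem hz])
  have hder : ∀ x ∈ ball (0 : V) R, HasFDerivWithinAt (fun z => z + k z)
      (ContinuousLinearMap.id ℝ V + s • fderiv ℝ h x) (ball (0 : V) R) x := by
    intro x hx
    have h1 : HasFDerivAt (fun z => z + s • h z)
        (ContinuousLinearMap.id ℝ V + s • fderiv ℝ h x) x :=
      (hasFDerivAt_id x).add (((hd.differentiable one_ne_zero) x).hasFDerivAt.const_smul s)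
    refine h1.hasFDerivWithinAt.congr (fun y hy => ?_) ?_
    · simp only [hk, indicator_of_mem hy]
    · simp only [hk, indicator_of_mem hx]
  have hcv := integral_image_eq_integral_abs_det_fderiv_smul volume measurableSet_ball hder hinj
    (fun _ => (1 : ℝ))
  rw [himg] at hcv
  simp only [smul_eq_mul, mul_one, integral_const, measureReal_def, Measure.restrict_apply_univ]
    at hcv
  rw [hcv]
  refine setIntegral_congr_fun measurableSet_ball fun x hx => ?_
  refine (abs_of_pos (hδA ?_)).symm
  rw [dist_eq_norm, add_sub_cancel_left, norm_smul, Real.norm_of_nonneg hs0.le]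
  exact (mul_le_mul_of_nonneg_left (hbd x (ball_subset_closedBall hx)) hs0.le).trans_lt hs1

/-- There is no `C¹` retraction of a ball onto its boundary sphere. -/
theorem not_exists_contDiff_retraction_sphere {V : Type*} [NormedAddCommGroup V]
    [InnerProductSpace ℝ V] [FiniteDimensional ℝ V] {w : V → V} {R : ℝ} (hR : 0 < R)
    (hw : ContDiff ℝ 1 w) (hn : ∀ z, ‖w z‖ = R) (hid : ∀ z, ‖z‖ = R → w z = z) : False := by
  borelize V
  have hnt : Nontrivial V := by
    by_contra hV
    rw [not_nontrivial_iff_subsingleton] at hV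
    have := hn 0
    rw [Subsingleton.elim (w 0) 0, norm_zero] at this
    exact hR.ne this
  set h : V → V := fun z => w z - z with hh
  have hd : ContDiff ℝ 1 h := hw.sub contDiff_id
  obtain ⟨L, hL⟩ := (isCompact_closedBall (0 : V) R).exists_bound_of_continuousOn
    (hd.continuous_fderiv one_ne_zero).continuousOn
  obtain ⟨s₀, hs₀, hs⟩ := setIntegral_det_eq_of_perturbation (h := h) (R := R) (L := max L 1)
    (by positivity) hd (fun z hz => (hL z hz).trans (le_max_left _ _))
    (fun z hz => by simp [hh, hid z hz])
  set N := Module.finrank ℝ V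
  -- Any N + 1 distinct nodes in (0, s₀) would do: they determine the determinant, a polynomial in
  -- s, at s = 1.
  set v : Fin (N + 1) → ℝ := fun i => s₀ / (i + 2) with hv
  have hvinj : Function.Injective v := by
    intro i j hij
    simp only [hv] at hij
    have h1 : (i : ℝ) + 2 = j + 2 := by
      field_simp at hij
      linarith
    exact Fin.ext (by exact_mod_cast add_right_cancel h1)
  have hvmem : ∀ i, v i ∈ Ioo 0 s₀ := fun i => by
    refine ⟨by simp only [hv]; positivity, ?_⟩
    simp only [hv]
    rw [div_lt_iff₀ (by positivity)]
    have : (0 : ℝ) ≤ (i : ℕ) := Nat.cast_nonneg _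
    nlinarith
  obtain ⟨c, hc⟩ := exists_interpolation_weights N v hvinj
  have hint : ∀ s : ℝ, IntegrableOn
      (fun x => (ContinuousLinearMap.id ℝ V + s • fderiv ℝ h x).det) (ball (0 : V) R) := by
    intro s
    have hcont : Continuous fun x => (ContinuousLinearMap.id ℝ V + s • fderiv ℝ h x).det :=
      ContinuousLinearMap.continuous_det.comp
        (continuous_const.add ((hd.continuous_fderiv one_ne_zero).const_smul s))
    exact (hcont.continuousOn.integrableOn_compact (isCompact_closedBall (0 : V) R)).mono_set
      ball_subset_closedBall
  have hdet : ∀ x, (ContinuousLinearMap.id ℝ V + (1 : ℝ) • fderiv ℝ h x).det =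
      ∑ i, c i * (ContinuousLinearMap.id ℝ V + v i • fderiv ℝ h x).det := by
    intro x
    obtain ⟨p, hp, hpe⟩ := exists_polynomial_det_one_add_smul (fderiv ℝ h x)
    simp only [hpe]
    exact hc p hp
  have hdet0 : ∀ x, (ContinuousLinearMap.id ℝ V + (1 : ℝ) • fderiv ℝ h x).det = 0 := by
    intro x
    rw [← det_fderiv_eq_zero_of_norm_eq_const hR (hw.differentiable one_ne_zero) hn x]
    congr 1
    rw [hh, fderiv_fun_sub ((hw.differentiable one_ne_zero) x) differentiableAt_fun_id, fderiv_fun_id, one_smul]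
    abel
  have hsum : (∑ i, c i) = 1 := by
    have := hc 1 (by simp)
    simpa using this.symm
  -- Interpolation carries the value of the integral from the small parameters to s = 1, where the
  -- integrand vanishes identically.
  have h1 : ∫ x in ball (0 : V) R, (ContinuousLinearMap.id ℝ V + (1 : ℝ) • fderiv ℝ h x).det
      = (volume (ball (0 : V) R)).toReal := by
    simp_rw [hdet]
    rw [integral_finsetSum _ fun i _ => (hint (v i)).const_mul (c i)]
    simp_rw [integral_const_mul, hs _ (hvmem _)]
    rw [← Finset.sum_mul, hsum, one_mul]
  simp only [hdet0, integral_zero] at h1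
  have hpos : 0 < (volume (ball (0 : V) R)).toReal :=
    ENNReal.toReal_pos (measure_ball_pos _ _ hR).ne' measure_ball_lt_top.ne
  exact hpos.ne h1

/-- A continuous self-map of Euclidean space which is the identity outside a ball is onto. -/
theorem surjective_of_continuous_of_eq_id_outside_ball {V : Type*} [NormedAddCommGroup V]
    [InnerProductSpace ℝ V] [FiniteDimensional ℝ V] {g : V → V} (hg : Continuous g) {R : ℝ}
    (hid : ∀ z, R ≤ ‖z‖ → g z = z) : Function.Surjective g := by
  intro q
  by_contra! hq
  set R' := |R| + ‖q‖ + 1 with hR'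
  have hR'pos : 0 < R' := by positivity
  -- The missed value is moved to the origin. A smooth approximation with error below ‖f z‖ still
  -- omits 0, and its radial projection is a retraction onto a sphere.
  set f : V → V := fun z => g (z + q) - q with hf
  have hfid : ∀ z, |R| + ‖q‖ ≤ ‖z‖ → f z = z := by
    intro z hz
    have h1 : ‖z‖ ≤ ‖z + q‖ + ‖q‖ := by
      have := norm_sub_le (z + q) q
      rwa [add_sub_cancel_right] at this
    have h2 : R ≤ ‖z + q‖ := (le_abs_self R).trans (by linarith)
    simp [hf, hid _ h2]
  have hf0 : ∀ z, f z ≠ 0 := fun z => sub_ne_zero.mpr (hq _)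
  have hfc : Continuous f := (hg.comp (continuous_id.add continuous_const)).sub continuous_const
  have hSc : IsClosed {z : V | R' ≤ ‖z‖} := isClosed_le continuous_const continuous_norm
  have hUo : IsOpen {z : V | |R| + ‖q‖ < ‖z‖} := isOpen_lt continuous_const continuous_norm
  obtain ⟨w, hw, hwf, hwS, -⟩ := hfc.exists_contDiff_approx_and_eqOn (n := 1)
    (ε := fun z => ‖f z‖) hfc.norm (fun z => norm_pos_iff.mpr (hf0 z)) hSc
    (U := {z : V | |R| + ‖q‖ < ‖z‖})
    (hUo.mem_nhdsSet.mpr fun z (hz : R' ≤ ‖z‖) => by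
      simp only [mem_ofPred_eq]; linarith)
    (contDiffOn_id.congr fun z hz => hfid z (le_of_lt hz))
  have hw0 : ∀ z, w z ≠ 0 := by
    intro z hz
    have := hwf z
    rw [hz, dist_zero_left] at this
    exact lt_irrefl _ this
  refine not_exists_contDiff_retraction_sphere (w := fun z => (R' / ‖w z‖) • w z) hR'pos ?_ ?_ ?_
  · exact (contDiff_const.div (hw.norm ℝ hw0) fun z => norm_ne_zero_iff.mpr (hw0 z)).smul hw
  · intro z
    rw [norm_smul, norm_div, norm_norm, Real.norm_of_nonneg hR'pos.le,
      div_mul_cancel₀ _ (norm_ne_zero_iff.mpr (hw0 z))]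
  · intro z hz
    have h1 : w z = z := by
      rw [hwS (show R' ≤ ‖z‖ from hz.ge), hfid z (by rw [hz, hR']; linarith)]
    simp only [h1, hz, div_self hR'pos.ne', one_smul]

end NoRetraction

/-! ### Local strictly convex defining functions -/

section StrictlyConvexDefiningFunctions

open Metric

variable {V : Type*} [NormedAddCommGroup V] [NormedSpace ℝ V]

theorem two_le_smoothness_infty : (2 : WithTop ℕ∞) ≤ ∞ := by
  exact WithTop.coe_le_coe.2 (le_top : (2 : ℕ∞) ≤ ⊤)

theorem eventually_norm_sub_lt_of_tendsto {X W : Type*} [NormedAddCommGroup W] {l : Filter X}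
    {f : X → W} {w : W} (hf : Filter.Tendsto f l (𝓝 w)) {c : ℝ} (hc : 0 < c) :
    ∀ᶠ x in l, ‖f x - w‖ < c := by
  simpa only [dist_eq_norm] using Metric.tendsto_nhds.mp hf c hc

theorem exists_pos_mul_sq_le_of_posDef [FiniteDimensional ℝ V] {B : V →L[ℝ] V →L[ℝ] ℝ}
    (hB : ∀ v, v ≠ 0 → 0 < B v v) : ∃ c : ℝ, 0 < c ∧ ∀ v, c * ‖v‖ ^ 2 ≤ B v v := by
  rcases (sphere (0 : V) 1).eq_empty_or_nonempty with he | hne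
  · refine ⟨1, one_pos, fun v => ?_⟩
    have hv : v = 0 := by
      by_contra hv
      have : ‖v‖⁻¹ • v ∈ sphere (0 : V) 1 := by
        simp [norm_smul, hv]
      rw [he] at this
      exact this
    simp [hv]
  · have hcont : ContinuousOn (fun v => B v v) (sphere (0 : V) 1) :=
      (B.continuous.clm_apply continuous_id).continuousOn
    obtain ⟨u, hu, hmin⟩ := (isCompact_sphere (0 : V) 1).exists_isMinOn hne hcont
    have hu0 : u ≠ 0 := by
      rintro rfl
      simp at hu
    refine ⟨B u u, hB u hu0, fun v => ?_⟩
    rcases eq_or_ne v 0 with rfl | hv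
    · simp
    have hv' : ‖v‖ ≠ 0 := norm_ne_zero_iff.mpr hv
    have h1 : B u u ≤ B (‖v‖⁻¹ • v) (‖v‖⁻¹ • v) := hmin (by simp [norm_smul, hv])
    simp only [map_smul, smul_apply, smul_eq_mul] at h1
    calc B u u * ‖v‖ ^ 2 ≤ (‖v‖⁻¹ * (‖v‖⁻¹ * B v v)) * ‖v‖ ^ 2 := by gcongr
      _ = B v v := by field_simp

/-- A quadratic form which is positive definite on the kernel of `l` becomes positive definite
after adding a large multiple of `l²`. -/
theorem exists_posDef_add_mul_sq [FiniteDimensional ℝ V] {B : V →L[ℝ] V →L[ℝ] ℝ} {l : V →L[ℝ] ℝ}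
    (hB : ∀ v, l v = 0 → v ≠ 0 → 0 < B v v) :
    ∃ K : ℝ, ∀ v, v ≠ 0 → 0 < B v v + K * (l v) ^ 2 := by
  suffices h : ∃ K : ℝ, ∀ v ∈ sphere (0 : V) 1, 0 < B v v + K * (l v) ^ 2 by
    obtain ⟨K, hK⟩ := h
    refine ⟨K, fun v hv => ?_⟩
    have hv' : 0 < ‖v‖ := norm_pos_iff.mpr hv
    have h1 := hK (‖v‖⁻¹ • v) (by simp [norm_smul, hv])
    simp only [map_smul, smul_apply, smul_eq_mul] at h1
    have h2 : ‖v‖⁻¹ * (‖v‖⁻¹ * B v v) + K * (‖v‖⁻¹ * l v) ^ 2 =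
      (‖v‖⁻¹) ^ 2 * (B v v + K * (l v) ^ 2) := by ring
    rw [h2] at h1
    exact (pos_iff_pos_of_mul_pos h1).mp (by positivity)
  have hcont : Continuous (fun v => B v v) := B.continuous.clm_apply continuous_id
  set A := sphere (0 : V) 1 ∩ {v | B v v ≤ 0} with hA
  have hAc : IsCompact A :=
    (isCompact_sphere (0 : V) 1).inter_right (isClosed_le hcont continuous_const)
  rcases A.eq_empty_or_nonempty with he | hne
  · refine ⟨0, fun v hv => ?_⟩
    by_contra hneg
    have : v ∈ A := ⟨hv, by simpa using hneg⟩
    rw [he] at this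
    exact this
  · obtain ⟨u, hu, hmin⟩ := hAc.exists_isMinOn hne
      (f := fun v => (l v) ^ 2) (by fun_prop)
    have hu0 : u ≠ 0 := by
      rintro rfl
      simp [hA] at hu
    have hlu : l u ≠ 0 := fun h => (hB u h hu0).not_ge hu.2
    -- u minimises l² among unit vectors with B v v ≤ 0, so on those vectors K (l v)² ≥ ‖B‖ + 1 > |B
    -- v v|.
    refine ⟨(‖B‖ + 1) / (l u) ^ 2, fun v hv => ?_⟩
    have hpos : 0 < (l u) ^ 2 := by positivity
    by_cases hvA : B v v ≤ 0
    · have h1 : (l u) ^ 2 ≤ (l v) ^ 2 := hmin ⟨hv, hvA⟩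
      have h2 : ‖B v v‖ ≤ ‖B‖ * ‖v‖ * ‖v‖ := B.le_opNorm₂ v v
      rw [mem_sphere_zero_iff_norm.mp hv, mul_one, mul_one, Real.norm_eq_abs] at h2
      have h3 := neg_le_of_abs_le h2
      have h4 : ‖B‖ + 1 ≤ (‖B‖ + 1) / (l u) ^ 2 * (l v) ^ 2 := by
        rw [div_mul_eq_mul_div, le_div_iff₀ hpos]
        gcongr
      linarith
    · have : 0 ≤ (‖B‖ + 1) / (l u) ^ 2 * (l v) ^ 2 := by positivity
      linarith [not_le.mp hvA]

theorem strictConvexOn_of_fderiv_fderiv_pos {G : V → ℝ} {s : Set V} (hs : IsOpen s)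
    (hconv : Convex ℝ s) (hG : ContDiffOn ℝ 2 G s)
    (hpos : ∀ x ∈ s, ∀ v, v ≠ 0 → 0 < fderiv ℝ (fderiv ℝ G) x v v) : StrictConvexOn ℝ s G := by
  refine ⟨hconv, fun x hx y hy hxy a b ha hb hab => ?_⟩
  set γ : ℝ → V := fun t => x + t • (y - x) with hγ
  have hγd : ∀ t, HasDerivAt γ (y - x) t := fun t => by
    have h := ((hasDerivAt_id t).smul_const (y - x)).const_add x
    rw [one_smul] at h
    exact h
  have hγc : Continuous γ := by fun_prop
  have hmem : ∀ t ∈ Icc (0 : ℝ) 1, γ t ∈ s := fun t ht => hconv.add_smul_sub_mem hx hy ht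
  have hd1 : ∀ t, γ t ∈ s → HasDerivAt (G ∘ γ) (fderiv ℝ G (γ t) (y - x)) t := fun t ht =>
    (((hG.contDiffAt (hs.mem_nhds ht)).differentiableAt two_ne_zero).hasFDerivAt).comp_hasDerivAt
      t (hγd t)
  have hd2 : ∀ t, γ t ∈ s →
      deriv (deriv (G ∘ γ)) t = fderiv ℝ (fderiv ℝ G) (γ t) (y - x) (y - x) := by
    intro t ht
    have hev : deriv (G ∘ γ) =ᶠ[𝓝 t] fun t => fderiv ℝ G (γ t) (y - x) := by
      filter_upwards [hγc.continuousAt.preimage_mem_nhds (hs.mem_nhds ht)] with t' ht'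
      exact (hd1 t' ht').deriv
    rw [hev.deriv_eq]
    have h1 : HasFDerivAt (fderiv ℝ G) (fderiv ℝ (fderiv ℝ G) (γ t)) (γ t) :=
      (((hG.contDiffAt (hs.mem_nhds ht)).fderiv_right (m := 1) (by norm_num)).differentiableAt
        one_ne_zero).hasFDerivAt
    exact ((h1.comp_hasDerivAt t (hγd t)).clm_apply (hasDerivAt_const t (y - x))).deriv.trans
      (by simp)
  have hsc : StrictConvexOn ℝ (Icc (0 : ℝ) 1) (G ∘ γ) := by
    refine strictConvexOn_of_deriv2_pos (convex_Icc 0 1)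
      (hG.continuousOn.comp hγc.continuousOn hmem) fun t ht => ?_
    have ht' := interior_subset ht
    simp only [Function.iterate_succ, Function.iterate_zero, Function.comp_apply, id_eq]
    have := hd2 t (hmem t ht')
    rw [this]
    exact hpos _ (hmem t ht') _ (sub_ne_zero.mpr hxy.symm)
  have h1 := hsc.2 (left_mem_Icc.mpr zero_le_one) (right_mem_Icc.mpr zero_le_one) zero_ne_one
    ha hb hab
  have h2 : a • x + b • y = x + b • (y - x) := by
    rw [show a = 1 - b by linarith]
    module
  simpa [hγ, h2] using h1

/-- `F` is a strictly convex defining function of `S` on the ball of radius `r` around `p`. -/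
structure IsStrictlyConvexDefining (S : Set V) (p : V) (r : ℝ) (F : V → ℝ) : Prop where
  pos : 0 < r
  strictConvexOn : StrictConvexOn ℝ (ball p r) F
  continuousOn : ContinuousOn F (ball p r)
  mem_iff : ∀ x ∈ ball p r, x ∈ S ↔ F x = 0
  exists_neg : ∃ x ∈ ball p r, F x < 0

-- The Hessian of F is known to be positive only on the tangent space at p. The function F + (K/2)
-- F² has the same zeros near p and Hessian D²F + K dF ⊗ dF at p, which is positive definite for
-- large K and stays so on a ball. Negative values exist because a nonzero differential excludes a
-- local minimum.
set_option synthInstance.maxHeartbeats 200000 in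
theorem IsClosedConvexHypersurface.exists_isStrictlyConvexDefining [FiniteDimensional ℝ V]
    {S : Set V} (hS : IsClosedConvexHypersurface S) {p : V} (hp : p ∈ S) :
    ∃ r F, IsStrictlyConvexDefining S p r F := by
  obtain ⟨U, F, hU, hpU, hF, hSU, hdF, hpos⟩ := hS.posDef p hp
  have hFp : F p = 0 := (hSU.subset ⟨hp, hpU⟩).2
  have hnorm : 0 < ‖fderiv ℝ F p‖ := norm_pos_iff.mpr hdF
  obtain ⟨K, hK⟩ := exists_posDef_add_mul_sq (B := fderiv ℝ (fderiv ℝ F) p) (l := fderiv ℝ F p)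
    fun v hv hv0 => by
      have := hpos v hv hv0
      rw [secondFundamentalForm, lt_div_iff₀ hnorm, zero_mul] at this
      exact this
  set G : V → ℝ := fun x => F x + K / 2 * F x ^ 2 with hG
  have hFd : ∀ x ∈ U, DifferentiableAt ℝ F x := fun x hx =>
    (hF.contDiffAt (hU.mem_nhds hx)).differentiableAt (by simp)
  have hGc : ContDiffOn ℝ ∞ G U := hF.add (contDiffOn_const.mul (hF.pow 2))
  have hGd : ∀ x ∈ U, HasFDerivAt G ((1 + K * F x) • fderiv ℝ F x) x := by
    intro x hx
    have h1 := (hFd x hx).hasFDerivAt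
    have h2 := h1.add ((h1.pow 2).const_mul (K / 2))
    refine h2.congr_fderiv ?_
    ext v
    simp
    ring
  have hGdd : fderiv ℝ (fderiv ℝ G) p =
      fderiv ℝ (fderiv ℝ F) p + (K • fderiv ℝ F p).smulRight (fderiv ℝ F p) := by
    have hev : fderiv ℝ G =ᶠ[𝓝 p] fun x => (1 + K * F x) • fderiv ℝ F x := by
      filter_upwards [hU.mem_nhds hpU] with x hx
      exact (hGd x hx).fderiv
    rw [hev.fderiv_eq]
    have h1 : HasFDerivAt (fderiv ℝ F) (fderiv ℝ (fderiv ℝ F) p) p :=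
      (((hF.contDiffAt (hU.mem_nhds hpU)).fderiv_right (m := 1)
        (by rw [one_add_one_eq_two]; exact two_le_smoothness_infty)).differentiableAt one_ne_zero).hasFDerivAt
    have h2 : HasFDerivAt (fun x => 1 + K * F x) (K • fderiv ℝ F p) p :=
      ((hFd p hpU).hasFDerivAt.const_mul K).const_add 1
    refine (h2.smul h1).fderiv.trans ?_
    simp [hFp]
  have hGpos : ∀ v, v ≠ 0 → 0 < fderiv ℝ (fderiv ℝ G) p v v := by
    intro v hv
    rw [hGdd]
    have := hK v hv
    simp only [add_apply, ContinuousLinearMap.smulRight_apply,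
      smul_apply, smul_eq_mul]
    nlinarith
  obtain ⟨c, hc, hcv⟩ := exists_pos_mul_sq_le_of_posDef hGpos
  have hcont : Filter.Tendsto (fderiv ℝ (fderiv ℝ G)) (𝓝 p) (𝓝 (fderiv ℝ (fderiv ℝ G) p)) :=
    (((hGc.contDiffAt (hU.mem_nhds hpU)).fderiv_right (m := 1)
        (by rw [one_add_one_eq_two]; exact two_le_smoothness_infty)).fderiv_right (m := 0) (by norm_num)).continuousAt.tendsto
  have hFcont : ContinuousAt F p := (hFd p hpU).continuousAt
  have hev1 : ∀ᶠ x in 𝓝 p, ‖fderiv ℝ (fderiv ℝ G) x - fderiv ℝ (fderiv ℝ G) p‖ < c :=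
    eventually_norm_sub_lt_of_tendsto (W := V →L[ℝ] V →L[ℝ] ℝ) hcont hc
  have hev2 : ∀ᶠ x in 𝓝 p, 0 < 1 + K / 2 * F x := by
    have : ContinuousAt (fun x => 1 + K / 2 * F x) p := by fun_prop
    refine this.eventually (lt_mem_nhds ?_)
    simp [hFp]
  obtain ⟨r, hr, hball⟩ := Metric.mem_nhds_iff.mp
    ((hU.mem_nhds hpU) |> fun h => Filter.inter_mem h (hev1.and hev2))
  have hsub : ball p r ⊆ U := fun x hx => (hball hx).1
  refine ⟨r, G, hr, ?_, hGc.continuousOn.mono hsub, ?_, ?_⟩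
  · refine strictConvexOn_of_fderiv_fderiv_pos isOpen_ball (convex_ball p r)
      ((hGc.of_le two_le_smoothness_infty).mono hsub) fun x hx v hv => ?_
    have h1 : ‖fderiv ℝ (fderiv ℝ G) x - fderiv ℝ (fderiv ℝ G) p‖ < c :=
      (hball hx).2.1
    have h2 := (fderiv ℝ (fderiv ℝ G) x - fderiv ℝ (fderiv ℝ G) p).le_opNorm₂ v v
    have h3 := neg_le_of_abs_le h2
    simp only [sub_apply] at h3
    have h4 := hcv v
    have hv' : 0 < ‖v‖ := norm_pos_iff.mpr hv
    have h5 : ‖fderiv ℝ (fderiv ℝ G) x - fderiv ℝ (fderiv ℝ G) p‖ * ‖v‖ * ‖v‖ < c * ‖v‖ ^ 2 := by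
      rw [pow_two, ← mul_assoc]
      gcongr
    linarith
  · intro x hx
    have hxU := hsub hx
    have h1 : x ∈ S ↔ F x = 0 :=
      ⟨fun h => (hSU.subset ⟨h, hxU⟩).2, fun h => (hSU.superset ⟨hxU, h⟩).1⟩
    have h2 := (hball hx).2.2
    rw [h1, hG]
    have h3 : F x + K / 2 * F x ^ 2 = F x * (1 + K / 2 * F x) := by ring
    simp only [h3, mul_eq_zero, h2.ne', or_false]
  · by_contra! hneg
    have hmin : IsLocalMin G p := by
      filter_upwards [ball_mem_nhds p hr] with x hx
      simpa [hG, hFp] using hneg x hx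
    have h1 := hmin.hasFDerivAt_eq_zero (hGd p hpU)
    simp only [hFp, mul_zero, add_zero, one_smul] at h1
    exact hdF h1

namespace IsStrictlyConvexDefining

variable {S : Set V} {p : V} {r : ℝ} {F : V → ℝ}

theorem mem_ball_self (h : IsStrictlyConvexDefining S p r F) : p ∈ ball p r :=
  Metric.mem_ball_self h.pos

theorem lt_of_mem_openSegment (h : IsStrictlyConvexDefining S p r F) {x y z : V}
    (hx : x ∈ ball p r) (hy : y ∈ ball p r) (hxy : x ≠ y) (hFx : F x ≤ 0) (hFy : F y ≤ 0)
    (hz : z ∈ openSegment ℝ x y) : F z < 0 := by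
  obtain ⟨a, b, ha, hb, hab, rfl⟩ := hz
  have := h.strictConvexOn.2 hx hy hxy ha hb hab
  simp only [smul_eq_mul] at this
  nlinarith

theorem restrict (h : IsStrictlyConvexDefining S p r F) {p' : V} {r' : ℝ} (hr' : 0 < r')
    (hp' : p' ∈ S) (hsub : ball p' r' ⊆ ball p r) : IsStrictlyConvexDefining S p' r' F where
  pos := hr'
  strictConvexOn := h.strictConvexOn.subset hsub (convex_ball p' r')
  continuousOn := h.continuousOn.mono hsub
  mem_iff x hx := h.mem_iff x (hsub hx)
  exists_neg := by
    obtain ⟨x, hx, hFx⟩ := h.exists_neg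
    have hp'b := hsub (Metric.mem_ball_self hr')
    have hFp' := (h.mem_iff p' hp'b).mp hp'
    have hne : p' ≠ x := by
      rintro rfl
      exact hFx.ne hFp'
    have ht : Filter.Tendsto (fun t : ℝ => AffineMap.lineMap p' x t) (𝓝[>] 0) (𝓝 p') := by
      have : Continuous (fun t : ℝ => (AffineMap.lineMap p' x t : V)) :=
        AffineMap.lineMap_continuous (R := ℝ)
      have h0 := (this.tendsto 0).mono_left (nhdsWithin_le_nhds (s := Ioi 0))
      simpa using h0
    obtain ⟨t, ht1, ht2⟩ := ((ht.eventually (ball_mem_nhds p' hr')).and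
      (Ioo_mem_nhdsGT zero_lt_one)).exists
    refine ⟨_, ht1, h.lt_of_mem_openSegment hp'b hx hne hFp'.le hFx.le ?_⟩
    rw [openSegment_eq_image_lineMap]
    exact mem_image_of_mem _ ht2

/-- Otherwise p would be the midpoint of two points with F ≤ 0, and strict convexity would give F p
< 0. -/
theorem reflect_pos (h : IsStrictlyConvexDefining S p r F) (hp : p ∈ S) {v : V}
    (hv : ‖v‖ < r) (hneg : F (p + v) ≤ 0) (hv0 : v ≠ 0) : 0 < F (p - v) := by
  by_contra! hle
  have h1 : F p < 0 := h.lt_of_mem_openSegment (x := p + v) (y := p - v) (by simpa using hv)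
    (by simpa [dist_eq_norm] using hv) ?_ hneg hle ?_
  · exact h1.ne ((h.mem_iff p h.mem_ball_self).mp hp)
  · intro heq
    apply hv0
    have h2 : (2 : ℝ) • v = 0 := by
      rw [two_smul]
      calc v + v = (p + v) - (p - v) := by abel
        _ = 0 := by rw [heq, sub_self]
    simpa using h2
  · refine ⟨1 / 2, 1 / 2, by norm_num, by norm_num, by norm_num, ?_⟩
    module

/-- Dimension at least two makes small spheres about p connected; on one of them F is negative at a
point and positive at its antipode. -/
theorem exists_ne_mem (h : IsStrictlyConvexDefining S p r F) (hp : p ∈ S)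
    (hrank : 1 < Module.rank ℝ V) : ∃ z ∈ ball p r, z ∈ S ∧ z ≠ p := by
  obtain ⟨x, hx, hFx⟩ := h.exists_neg
  have hne : x ≠ p := by
    rintro rfl
    exact hFx.ne ((h.mem_iff x hx).mp hp)
  set v := x - p with hv
  have hv0 : v ≠ 0 := sub_ne_zero.mpr hne
  have hvr : ‖v‖ < r := by simpa [dist_eq_norm] using hx
  have hxv : p + v = x := by simp [hv]
  have hpos := h.reflect_pos hp hvr (by rw [hxv]; exact hFx.le) hv0
  have hsub : sphere p ‖v‖ ⊆ ball p r := fun y hy => by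
    rw [mem_ball, mem_sphere.mp hy]
    exact hvr
  have hconn := (isConnected_sphere hrank p (norm_nonneg v)).isPreconnected
  obtain ⟨z, hz, hFz⟩ := hconn.intermediate_value (a := x) (b := p - v)
    (by simp [hv]) (by simp) (h.continuousOn.mono hsub)
    (show (0 : ℝ) ∈ Icc (F x) (F (p - v)) from ⟨hFx.le, hpos.le⟩)
  refine ⟨z, hsub hz, (h.mem_iff z (hsub hz)).mpr hFz, ?_⟩
  rintro rfl
  rw [mem_sphere, dist_self] at hz
  exact hv0 (norm_eq_zero.mp hz.symm)

theorem convex_neg (h : IsStrictlyConvexDefining S p r F) : Convex ℝ {x ∈ ball p r | F x < 0} :=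
  h.strictConvexOn.convexOn.convex_lt 0

/-- The negative side depends on S alone. The midpoint of p and a second point of S is negative for
both functions, and F' has no zero on the convex set where F < 0. -/
theorem neg_of_neg {F' : V → ℝ} (h : IsStrictlyConvexDefining S p r F)
    (h' : IsStrictlyConvexDefining S p r F') (hp : p ∈ S) (hrank : 1 < Module.rank ℝ V) {x : V}
    (hx : x ∈ ball p r) (hFx : F x < 0) : F' x < 0 := by
  obtain ⟨z, hz, hzS, hzp⟩ := h.exists_ne_mem hp hrank
  have hmid : ∀ {G : V → ℝ}, IsStrictlyConvexDefining S p r G → G (midpoint ℝ p z) < 0 :=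
    fun {G} hG => hG.lt_of_mem_openSegment hG.mem_ball_self hz hzp.symm
      ((hG.mem_iff p hG.mem_ball_self).mp hp).le ((hG.mem_iff z hz).mp hzS).le
      (midpoint_mem_openSegment p z)
  have hmb : midpoint ℝ p z ∈ ball p r :=
    (convex_ball p r).segment_subset h.mem_ball_self hz (midpoint_mem_segment p z)
  by_contra! hge
  have hconn := h.convex_neg.isPreconnected
  obtain ⟨y, hy, hFy⟩ := hconn.intermediate_value (a := midpoint ℝ p z) (b := x)
    ⟨hmb, hmid h⟩ ⟨hx, hFx⟩ (h'.continuousOn.mono fun y hy => hy.1)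
    (show (0 : ℝ) ∈ Icc _ _ from ⟨(hmid h').le, hge⟩)
  exact hy.2.ne ((h.mem_iff y hy.1).mp ((h'.mem_iff y hy.1).mpr hFy))

end IsStrictlyConvexDefining

end StrictlyConvexDefiningFunctions

/-! ### A global function with prescribed local signs -/

section Separation

open Metric

variable {V : Type*} [NormedAddCommGroup V] [NormedSpace ℝ V]

/-- Quartering the radii puts the quarter-ball belonging to the smaller radius inside the other full
ball, so both functions can be restricted to it and compared. -/
theorem IsStrictlyConvexDefining.neg_iff_neg_of_mem_balls {S : Set V} {p p' x : V} {r r' : ℝ}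
    {F F' : V → ℝ} (h : IsStrictlyConvexDefining S p r F)
    (h' : IsStrictlyConvexDefining S p' r' F') (hp : p ∈ S) (hp' : p' ∈ S)
    (hrank : 1 < Module.rank ℝ V) (hx : x ∈ ball p (r / 4)) (hx' : x ∈ ball p' (r' / 4)) :
    F x < 0 ↔ F' x < 0 := by
  wlog hr : r' ≤ r generalizing p p' r r' F F'
  · exact (this h' h hp' hp hx' hx (le_of_not_ge hr)).symm
  have hr' := h'.pos
  have hsub : ball p' (r' / 4) ⊆ ball p r := by
    intro y hy
    rw [mem_ball] at *
    have h1 := dist_triangle4 y p' x p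
    rw [dist_comm p' x] at h1
    linarith
  have h1 := h.restrict (by positivity) hp' hsub
  have h2 := h'.restrict (by positivity) hp' (ball_subset_ball (by linarith) : ball p' (r' / 4) ⊆ _)
  exact ⟨h1.neg_of_neg h2 hp' hrank hx', h2.neg_of_neg h1 hp' hrank hx'⟩

theorem AddCircle.coe_neg_half_eq_coe_half :
    ((-(1 / 2) : ℝ) : AddCircle (1 : ℝ)) = ((1 / 2 : ℝ) : AddCircle (1 : ℝ)) := by
  rw [← AddCircle.coe_add_period]
  norm_num

/-- A connected compact co-orientable hypersurface is the zero set of a continuous function whose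
sign is prescribed locally: the function is a lift of a map to the circle. -/
theorem exists_separating_function {S : Set V} (hS : IsCompact S) (hSc : IsConnected S)
    (hrank : 1 < Module.rank ℝ V) (hdef : ∀ p ∈ S, ∃ r F, IsStrictlyConvexDefining S p r F) :
    ∃ g : V → ℝ, Continuous g ∧ (∀ x, g x = 0 ↔ x ∈ S) ∧
      ∀ p ∈ S, ∃ r F, IsStrictlyConvexDefining S p r F ∧ ∀ x ∈ ball p r, g x < 0 ↔ F x < 0 := by
  classical
  choose! r F hF using hdef
  have hr : ∀ p ∈ S, 0 < r p := fun p hp => (hF p hp).pos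
  have hsub4 : ∀ p ∈ S, ball p (r p / 4) ⊆ ball p (r p) := fun p hp =>
    ball_subset_ball (by linarith [hr p hp])
  have hcF : ∀ p ∈ S, ContinuousOn (F p) (ball p (r p / 4)) := fun p hp =>
    (hF p hp).continuousOn.mono (hsub4 p hp)
  set N : Set V := ⋃ p ∈ S, ball p (r p / 4) with hN
  set Nm : Set V := ⋃ p ∈ S, ball p (r p / 4) ∩ F p ⁻¹' Iio 0 with hNm
  have hNo : IsOpen N := isOpen_biUnion fun p _ => isOpen_ball
  have hNmo : IsOpen Nm := isOpen_biUnion fun p hp =>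
    (hcF p hp).isOpen_inter_preimage isOpen_ball isOpen_Iio
  have hmemNm : ∀ p ∈ S, ∀ x ∈ ball p (r p / 4), x ∈ Nm ↔ F p x < 0 := by
    intro p hp x hx
    constructor
    · intro hxN
      simp only [hNm, mem_iUnion] at hxN
      obtain ⟨p', hp', hxp', hneg⟩ := hxN
      exact ((hF p hp).neg_iff_neg_of_mem_balls (hF p' hp') hp hp' hrank hx hxp').mpr hneg
    · intro hneg
      simp only [hNm, mem_iUnion]
      exact ⟨p, hp, hx, hneg⟩
  have hSN : S ⊆ N := fun p hp => mem_biUnion hp (mem_ball_self (by linarith [hr p hp]))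
  obtain ⟨δ, hδ, hthick⟩ := hS.exists_thickening_subset_open hNo hSN
  -- d vanishes exactly on S and equals 1/2 from distance δ on. Since 1/2 = -1/2 in the circle of
  -- length 1, the jump of sign at frontier points of `Nm` far from S is harmless; those near S lie
  -- on S, where d = 0.
  set d : V → ℝ := fun x => min (infDist x S / (2 * δ)) (1 / 2) with hd
  have hdc : Continuous d := by
    have := continuous_infDist_pt S
    fun_prop
  have hd0 : ∀ x, 0 ≤ d x := fun x => le_min (div_nonneg infDist_nonneg (by positivity)) (by norm_num)
  have hd1 : ∀ x, d x ≤ 1 / 2 := fun x => min_le_right _ _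
  have hdS : ∀ x, d x = 0 ↔ x ∈ S := by
    intro x
    rw [hS.isClosed.mem_iff_infDist_zero hSc.nonempty]
    constructor
    · intro h
      rcases min_choice (infDist x S / (2 * δ)) (1 / 2) with h1 | h1
      · rw [hd] at h
        simp only at h
        rw [h1] at h
        simpa [hδ.ne'] using h
      · rw [hd] at h
        simp only at h
        rw [h1] at h
        norm_num at h
    · intro h
      simp [hd, h]
  set h : V → AddCircle (1 : ℝ) := fun x => if x ∈ Nm then ((-(d x) : ℝ) : AddCircle (1 : ℝ))
    else ((d x : ℝ) : AddCircle (1 : ℝ)) with hh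
  have hcoe : Continuous ((↑) : ℝ → AddCircle (1 : ℝ)) := AddCircle.continuous_mk' 1
  have hhc : Continuous h := by
    refine Continuous.if ?_ (hcoe.comp hdc.neg) (hcoe.comp hdc)
    intro a ha
    change a ∈ frontier Nm at ha
    rw [hNmo.frontier_eq] at ha
    by_cases haδ : infDist a S < δ
    · have haN : a ∈ N := hthick (by rwa [mem_thickening_iff_infDist_lt hSc.nonempty])
      simp only [hN, mem_iUnion] at haN
      obtain ⟨p, hp, hap⟩ := haN
      have hnn : ¬ F p a < 0 := fun hneg => ha.2 ((hmemNm p hp a hap).mpr hneg)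
      have hnp : ¬ 0 < F p a := by
        intro hpos
        have hopen : IsOpen (ball p (r p / 4) ∩ F p ⁻¹' Ioi 0) :=
          (hcF p hp).isOpen_inter_preimage isOpen_ball isOpen_Ioi
        obtain ⟨y, hy, hyN⟩ := mem_closure_iff.mp ha.1 _ hopen ⟨hap, hpos⟩
        exact lt_asymm ((hmemNm p hp y hy.1).mp hyN) hy.2
      have haS : a ∈ S := ((hF p hp).mem_iff a (hsub4 p hp hap)).mpr
        (le_antisymm (not_lt.mp hnp) (not_lt.mp hnn))
      simp [(hdS a).mpr haS]
    · have : d a = 1 / 2 := by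
        simp only [hd]
        refine min_eq_right ?_
        rw [le_div_iff₀ (by positivity)]
        linarith [not_lt.mp haδ]
      simp only [this]
      exact AddCircle.coe_neg_half_eq_coe_half
  -- V is simply connected, so h lifts to ℝ. The lift is an integer exactly on S, because 0 < d ≤
  -- 1/2 elsewhere; hence it is constant on the connected set S, and this constant is subtracted.
  obtain ⟨e₀, he₀⟩ := QuotientAddGroup.mk_surjective (h 0)
  obtain ⟨g₀, ⟨-, hg₀⟩, -⟩ := (AddCircle.isCoveringMap_coe (1 : ℝ)).existsUnique_continuousMap_lifts
    (⟨h, hhc⟩ : C(V, AddCircle (1 : ℝ))) 0 e₀ he₀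
  have hlift : ∀ x, ((g₀ x : ℝ) : AddCircle (1 : ℝ)) = h x := fun x => congrFun hg₀ x
  have hcases : ∀ x, h x = ((d x : ℝ) : AddCircle (1 : ℝ)) ∨
      h x = ((-(d x) : ℝ) : AddCircle (1 : ℝ)) := by
    intro x
    by_cases hx : x ∈ Nm
    · right; simp [hh, hx]
    · left; simp [hh, hx]
  have hcoe_eq : ∀ a b : ℝ, (a : AddCircle (1 : ℝ)) = b → ∃ n : ℤ, a - b = n := by
    intro a b hab
    have h1 : ((a - b : ℝ) : AddCircle (1 : ℝ)) = 0 := by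
      rw [AddCircle.coe_sub, hab, sub_self]
    obtain ⟨n, hn⟩ := (AddCircle.coe_eq_zero_iff (1 : ℝ)).mp h1
    exact ⟨n, by simpa using hn.symm⟩
  have hint : ∀ x, (∃ n : ℤ, g₀ x = n) ↔ x ∈ S := by
    intro x
    constructor
    · rintro ⟨n, hn⟩
      by_contra hxS
      have hdpos : 0 < d x := lt_of_le_of_ne (hd0 x) fun h0 => hxS ((hdS x).mp h0.symm)
      have hl := hlift x
      have key : ∃ m : ℤ, d x = m := by
        rcases hcases x with hc | hc
        · obtain ⟨m, hm⟩ := hcoe_eq _ _ (hl.trans hc)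
          exact ⟨n - m, by push_cast; linarith⟩
        · obtain ⟨m, hm⟩ := hcoe_eq _ _ (hl.trans hc)
          exact ⟨m - n, by push_cast; linarith⟩
      obtain ⟨m, hm⟩ := key
      have h1 : (0 : ℝ) < m := hm ▸ hdpos
      have h2 : (m : ℝ) < 1 := by
        rw [← hm]
        linarith [hd1 x]
      have h3 : 0 < m := by exact_mod_cast h1
      have h4 : m < 1 := by exact_mod_cast h2
      omega
    · intro hxS
      have h0 := (hdS x).mpr hxS
      have : h x = ((0 : ℝ) : AddCircle (1 : ℝ)) := by
        rcases hcases x with hc | hc <;> simp [hc, h0]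
      obtain ⟨n, hn⟩ := hcoe_eq _ _ ((hlift x).trans this)
      exact ⟨n, by linarith⟩
  have hconst : ∀ x ∈ S, ∀ y ∈ S, g₀ x ≤ g₀ y := by
    intro x hx y hy
    by_contra! hlt
    obtain ⟨n, hn⟩ := (hint x).mpr hx
    obtain ⟨m, hm⟩ := (hint y).mpr hy
    have hmn : m + 1 ≤ n := by
      rw [hn, hm] at hlt
      exact_mod_cast hlt
    have hmn' : (m : ℝ) + 1 ≤ n := by exact_mod_cast hmn
    obtain ⟨z, hz, hgz⟩ := hSc.isPreconnected.intermediate_value hy hx g₀.continuous.continuousOn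
      (show (m : ℝ) + 1 / 2 ∈ Icc (g₀ y) (g₀ x) from ⟨by linarith, by linarith⟩)
    obtain ⟨k, hk⟩ := (hint z).mpr hz
    have hk' : (k : ℝ) = m + 1 / 2 := hk.symm.trans hgz
    have h1 : m < k := by
      have : (m : ℝ) < k := by linarith
      exact_mod_cast this
    have h2 : k < m + 1 := by
      have : (k : ℝ) < m + 1 := by linarith
      exact_mod_cast this
    omega
  obtain ⟨p₀, hp₀⟩ := hSc.nonempty
  obtain ⟨n₀, hn₀⟩ := (hint p₀).mpr hp₀
  have hgS : ∀ x, g₀ x - n₀ = 0 ↔ x ∈ S := by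
    intro x
    constructor
    · intro hx
      exact (hint x).mp ⟨n₀, by linarith⟩
    · intro hx
      have := le_antisymm (hconst x hx p₀ hp₀) (hconst p₀ hp₀ x hx)
      rw [this, hn₀, sub_self]
  have hgc : Continuous fun x => g₀ x - n₀ := g₀.continuous.sub continuous_const
  refine ⟨fun x => g₀ x - n₀, hgc, hgS, fun p hp => ?_⟩
  -- With both quantities below 1/4, the integer by which g₀ x - n₀ differs from ± d x has absolute
  -- value less than 1, so it is 0 and the sign is the one prescribed by `Nm`.
  have hev : ∀ᶠ x in 𝓝 p, x ∈ ball p (r p / 4) ∧ |g₀ x - n₀| < 1 / 4 ∧ d x < 1 / 4 := by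
    refine Filter.Eventually.and (ball_mem_nhds p (by linarith [hr p hp]))
      (Filter.Eventually.and ?_ ?_)
    · refine hgc.abs.continuousAt.eventually (gt_mem_nhds ?_)
      simp only [(hgS p).mpr hp]
      norm_num
    · refine hdc.continuousAt.eventually (gt_mem_nhds ?_)
      rw [(hdS p).mpr hp]
      norm_num
  obtain ⟨ρ, hρ, hball⟩ := Metric.mem_nhds_iff.mp hev
  refine ⟨ρ, F p, (hF p hp).restrict hρ hp fun x hx => hsub4 p hp (hball hx).1, fun x hx => ?_⟩
  obtain ⟨hx4, hgx, hdx⟩ := hball hx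
  have hgx' := abs_lt.mp hgx
  have hSF := (hF p hp).mem_iff x (hsub4 p hp hx4)
  have hl := hlift x
  have hzero : ∀ k : ℤ, |(k : ℝ)| < 1 → k = 0 := by
    intro k hk
    have : |k| < 1 := by exact_mod_cast hk
    exact Int.abs_lt_one_iff.mp this
  constructor
  · intro hneg
    by_contra hFx
    have hxN : x ∉ Nm := fun hx' => hFx ((hmemNm p hp x hx4).mp hx')
    have hc : h x = ((d x : ℝ) : AddCircle (1 : ℝ)) := by simp [hh, hxN]
    obtain ⟨m, hm⟩ := hcoe_eq _ _ (hl.trans hc)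
    have : m - n₀ = 0 := hzero _ (by
      push_cast
      rw [abs_lt]
      constructor <;> linarith [hd0 x])
    have hmn : (m : ℝ) = n₀ := by exact_mod_cast sub_eq_zero.mp this
    linarith [hd0 x]
  · intro hFx
    have hxN : x ∈ Nm := (hmemNm p hp x hx4).mpr hFx
    have hc : h x = ((-(d x) : ℝ) : AddCircle (1 : ℝ)) := by simp [hh, hxN]
    obtain ⟨m, hm⟩ := hcoe_eq _ _ (hl.trans hc)
    have : m - n₀ = 0 := hzero _ (by
      push_cast
      rw [abs_lt]
      constructor <;> linarith [hd0 x])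
    have hmn : (m : ℝ) = n₀ := by exact_mod_cast sub_eq_zero.mp this
    refine lt_of_le_of_ne (by linarith [hd0 x]) fun h0 => ?_
    exact hFx.ne (hSF.mp ((hgS x).mp h0))

end Separation

/-! ### Convex hulls of compact sets and exposed points -/

section ConvexHullOfHypersurface

open Metric

variable {V : Type*} [NormedAddCommGroup V] [NormedSpace ℝ V]

/-- In a finite-dimensional space, the convex hull of a compact set is compact. -/
theorem IsCompact.convexHull_of_finiteDimensional [FiniteDimensional ℝ V] {S : Set V}
    (hS : IsCompact S) : IsCompact (convexHull ℝ S) := by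
  rcases S.eq_empty_or_nonempty with rfl | ⟨s₀, hs₀⟩
  · simp
  -- Carathéodory's number of points; shorter combinations are padded with weight 0 at s₀.
  set N := Module.finrank ℝ V + 1 with hN
  set Φ : (Fin N → ℝ) × (Fin N → V) → V := fun a => ∑ i, a.1 i • a.2 i with hΦ
  have hΦc : Continuous Φ := by fun_prop
  have hK : IsCompact (stdSimplex ℝ (Fin N) ×ˢ (univ.pi fun _ : Fin N => S)) :=
    (isCompact_stdSimplex ℝ (Fin N)).prod (isCompact_univ_pi fun _ => hS)
  suffices h : convexHull ℝ S = Φ '' (stdSimplex ℝ (Fin N) ×ˢ (univ.pi fun _ : Fin N => S)) by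
    rw [h]
    exact hK.image hΦc
  apply Subset.antisymm
  · intro x hx
    obtain ⟨ι, _, z, w, hz, hind, hw, hw1, rfl⟩ := eq_pos_convex_span_of_mem_convexHull hx
    have hcard : Fintype.card ι ≤ Fintype.card (Fin N) := by
      rw [Fintype.card_fin]
      exact hind.card_le_finrank_succ.trans (Nat.succ_le_succ (Submodule.finrank_le _))
    obtain ⟨e⟩ := Function.Embedding.nonempty_of_card_le hcard
    have hwe : ∀ i, Function.extend e w 0 (e i) = w i := fun i => e.injective.extend_apply _ _ _
    have hze : ∀ i, Function.extend e z (fun _ => s₀) (e i) = z i :=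
      fun i => e.injective.extend_apply _ _ _
    have hw0 : ∀ j ∉ range e, Function.extend e w 0 j = 0 := fun j hj =>
      Function.extend_apply' _ _ _ hj
    refine ⟨(Function.extend e w 0, Function.extend e z fun _ => s₀), ⟨⟨fun j => ?_, ?_⟩,
      fun j _ => ?_⟩, ?_⟩
    · by_cases hj : j ∈ range e
      · obtain ⟨i, rfl⟩ := hj
        simp only [hwe]
        exact (hw i).le
      · exact (hw0 j hj).ge
    · rw [← hw1]
      exact (Fintype.sum_of_injective e e.injective _ _ hw0 fun i => (hwe i).symm).symm
    · by_cases hj : j ∈ range e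
      · obtain ⟨i, rfl⟩ := hj
        simp only [hze]
        exact hz (mem_range_self i)
      · simp only [Function.extend_apply' _ _ _ hj]
        exact hs₀
    · simp only [hΦ]
      refine (Fintype.sum_of_injective e e.injective _ _ (fun j hj => ?_) fun i => ?_).symm
      · rw [hw0 j hj, zero_smul]
      · rw [hwe, hze]
  · rintro _ ⟨⟨w, z⟩, ⟨hw, hz⟩, rfl⟩
    exact (convex_convexHull ℝ S).sum_mem (fun i _ => hw.1 i) hw.2
      fun i _ => subset_convexHull ℝ S (hz i (mem_univ i))

/-- `A` is the boundary of a strictly convex body. -/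
structure IsStrictlyConvexBoundary (A : Set V) : Prop where
  isCompact : IsCompact A
  interior_nonempty : (interior (convexHull ℝ A)).Nonempty
  frontier_eq : frontier (convexHull ℝ A) = A
  strictConvex : StrictConvex ℝ (convexHull ℝ A)

/-- If all points of `S` other than `m` are strictly below `m` with respect to `l`, the same holds
for the convex hull. -/
theorem lt_of_mem_convexHull {S : Set V} {m : V} {l : V →L[ℝ] ℝ}
    (h : ∀ y ∈ S, y ≠ m → l y < l m) : ∀ y ∈ convexHull ℝ S, y ≠ m → l y < l m := by
  have hconv : Convex ℝ (insert m {y | l y < l m}) := by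
    intro x hx y hy a b ha hb hab
    rcases hx with rfl | hx <;> rcases hy with rfl | hy
    · left; rw [← add_smul, hab, one_smul]
    · rcases hb.eq_or_lt with rfl | hb
      · left; simp [show a = 1 by linarith]
      · right
        simp only [mem_ofPred_eq, map_add, map_smul, smul_eq_mul] at hy ⊢
        rw [show a = 1 - b by linarith]
        linarith [mul_pos hb (sub_pos.mpr hy)]
    · rcases ha.eq_or_lt with rfl | ha
      · left; simp [show b = 1 by linarith]
      · right
        simp only [mem_ofPred_eq, map_add, map_smul, smul_eq_mul] at hx ⊢
        rw [show b = 1 - a by linarith]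
        linarith [mul_pos ha (sub_pos.mpr hx)]
    · right
      simp only [mem_ofPred_eq, map_add, map_smul, smul_eq_mul] at hx hy ⊢
      rcases ha.eq_or_lt with rfl | ha
      · rw [show b = 1 by linarith]; linarith
      · have h1 := mul_pos ha (sub_pos.mpr hx)
        have h2 := mul_nonneg hb (sub_pos.mpr hy).le
        have h3 : a * l m + b * l m = l m := by rw [← add_mul, hab, one_mul]
        linarith
  have hsub : S ⊆ insert m {y | l y < l m} := fun y hy => by
    by_cases hym : y = m
    · exact Or.inl hym
    · exact Or.inr (h y hy hym)
  intro y hy hym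
  exact (convexHull_min hsub hconv hy).resolve_left hym

/-- A compact set each of whose points is exposed, and on which no nonzero functional has two
maximisers, is the boundary of its convex hull, which is strictly convex. -/
theorem isStrictlyConvexBoundary_of_exposed [FiniteDimensional ℝ V] {S : Set V}
    (hS : IsCompact S) (hnt : S.Nontrivial)
    (hexp : ∀ p ∈ S, ∃ l : V →L[ℝ] ℝ, ∀ y ∈ S, y ≠ p → l y < l p)
    (huniq : ∀ l : V →L[ℝ] ℝ, l ≠ 0 → ∀ p ∈ S, ∀ q ∈ S, (∀ y ∈ S, l y ≤ l p) → l q = l p → q = p) :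
    IsStrictlyConvexBoundary S := by
  set C := convexHull ℝ S with hC
  have hCc : IsCompact C := hS.convexHull_of_finiteDimensional
  have hSC : S ⊆ C := subset_convexHull ℝ S
  have hCconv : Convex ℝ C := convex_convexHull ℝ S
  -- If S lay in a proper affine subspace, a nonzero functional would be constant on S and all
  -- points would maximise it.
  have hint : (interior C).Nonempty := by
    rw [interior_convexHull_nonempty_iff_affineSpan_eq_top,
      AffineSubspace.affineSpan_eq_top_iff_vectorSpan_eq_top_of_nonempty _ _ _ hnt.nonempty]
    by_contra hne
    obtain ⟨f, hf, hle⟩ := Submodule.exists_le_ker_of_lt_top _ (lt_top_iff_ne_top.mpr hne)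
    obtain ⟨p, hp, q, hq, hpq⟩ := hnt
    have hconst : ∀ y ∈ S, f y = f p := fun y hy => by
      have := hle (vsub_mem_vectorSpan ℝ hy hp)
      rw [LinearMap.mem_ker, vsub_eq_sub, map_sub, sub_eq_zero] at this
      exact this
    refine hpq (huniq (LinearMap.toContinuousLinearMap f) ?_ p hp q hq ?_ ?_).symm
    · intro h0
      apply hf
      ext v
      simpa using congrArg (fun l => l v) h0
    · intro y hy
      simpa using (hconst y hy).le
    · simpa using hconst q hq
  have hexpC : ∀ p ∈ S, ∃ l : V →L[ℝ] ℝ, ∀ y ∈ C, y ≠ p → l y < l p := fun p hp => by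
    obtain ⟨l, hl⟩ := hexp p hp
    exact ⟨l, lt_of_mem_convexHull hl⟩
  -- A supporting functional at a frontier point has only one maximiser on S, which must be that
  -- point; conversely an exposed point is not interior.
  have hfr : frontier C = S := by
    apply Subset.antisymm
    · intro x hx
      rw [hCc.isClosed.frontier_eq] at hx
      obtain ⟨l, hl⟩ := geometric_hahn_banach_open_point hCconv.interior isOpen_interior hx.2
      have hlC : ∀ a ∈ C, l a ≤ l x := by
        intro a ha
        have hcl : a ∈ closure (interior C) := by
          rw [hCconv.closure_interior_eq_closure_of_nonempty_interior hint]
          exact subset_closure ha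
        exact closure_minimal (fun y hy => (hl y hy).le)
          (isClosed_le l.continuous continuous_const) hcl
      have hl0 : l ≠ 0 := by
        rintro rfl
        obtain ⟨y, hy⟩ := hint
        simpa using hl y hy
      obtain ⟨m, hm, hmax⟩ := hS.exists_isMaxOn hnt.nonempty l.continuous.continuousOn
      by_cases hxm : x = m
      · rw [hxm]; exact hm
      · have := lt_of_mem_convexHull (m := m) (l := l) (fun y hy hym => lt_of_le_of_ne (hmax hy)
          fun heq => hym (huniq l hl0 m hm y hy hmax heq)) x hx.1 hxm
        exact absurd (hlC m (hSC hm)) (not_le.mpr this)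
    · intro p hp
      rw [hCc.isClosed.frontier_eq]
      refine ⟨hSC hp, fun hpi => ?_⟩
      obtain ⟨l, hl⟩ := hexpC p hp
      obtain ⟨y, hy, hyp⟩ := hnt.exists_ne p
      have ht : Filter.Tendsto (fun t : ℝ => p + t • (p - y)) (𝓝[>] 0) (𝓝 p) := by
        have : Continuous (fun t : ℝ => p + t • (p - y)) := by fun_prop
        have h0 := (this.tendsto 0).mono_left (nhdsWithin_le_nhds (s := Ioi 0))
        simpa using h0
      obtain ⟨t, ht1, ht2⟩ := ((ht.eventually (mem_interior_iff_mem_nhds.mp hpi)).and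
        (self_mem_nhdsWithin)).exists
      have ht0 : 0 < t := ht2
      have hlt := hl y (hSC hy) hyp
      have hne : p + t • (p - y) ≠ p := by
        intro h
        have h2 : t • (p - y) = 0 := by simpa using h
        rcases smul_eq_zero.mp h2 with h3 | h3
        · exact ht0.ne' h3
        · exact hyp (sub_eq_zero.mp h3).symm
      have := hl _ ht1 hne
      simp only [map_add, map_smul, map_sub, smul_eq_mul] at this
      nlinarith
  refine ⟨hS, hint, hfr, ?_⟩
  intro x hx y hy hxy a b ha hb hab
  have hz : a • x + b • y ∈ C := hCconv hx hy ha.le hb.le hab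
  by_contra hzi
  have hzS : a • x + b • y ∈ S := by
    rw [← hfr, hCc.isClosed.frontier_eq]
    exact ⟨hz, hzi⟩
  obtain ⟨l, hl⟩ := hexpC _ hzS
  have hx' : x ≠ a • x + b • y := by
    intro h
    apply hxy
    have h2 : b • (x - y) = 0 := by
      have h3 : x - (a • x + b • y) = b • (x - y) := by
        rw [show a = 1 - b by linarith]
        module
      rw [← h3, sub_eq_zero]
      exact h
    rcases smul_eq_zero.mp h2 with h3 | h3
    · exact absurd h3 hb.ne'
    · exact sub_eq_zero.mp h3
  have hy' : y ≠ a • x + b • y := by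
    intro h
    apply hxy
    have h2 : a • (y - x) = 0 := by
      have h3 : y - (a • x + b • y) = a • (y - x) := by
        rw [show b = 1 - a by linarith]
        module
      rw [← h3, sub_eq_zero]
      exact h
    rcases smul_eq_zero.mp h2 with h3 | h3
    · exact absurd h3 ha.ne'
    · exact (sub_eq_zero.mp h3).symm
  have h1 := hl x hx hx'
  have h2 := hl y hy hy'
  simp only [map_add, map_smul, smul_eq_mul] at h1 h2
  have hb' : b = 1 - a := by linarith
  subst hb'
  nlinarith

end ConvexHullOfHypersurface

/-! ### Hadamard's theorem: from local to global strict convexity -/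

section Hadamard

open Metric

variable {V : Type*} [NormedAddCommGroup V] [NormedSpace ℝ V]

/-- `g` is a global defining function of `S` whose negative side is locally strictly convex. -/
structure IsSeparatingFunction (S : Set V) (g : V → ℝ) : Prop where
  continuous : Continuous g
  eq_zero_iff : ∀ x, g x = 0 ↔ x ∈ S
  exists_local : ∀ p ∈ S, ∃ r F, IsStrictlyConvexDefining S p r F ∧
    ∀ x ∈ ball p r, g x < 0 ↔ F x < 0

namespace IsSeparatingFunction

variable {S : Set V} {g : V → ℝ}

theorem le_iff (hg : IsSeparatingFunction S g) {p : V} {r : ℝ} {F : V → ℝ}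
    (hF : IsStrictlyConvexDefining S p r F) (hgF : ∀ x ∈ ball p r, g x < 0 ↔ F x < 0) {x : V}
    (hx : x ∈ ball p r) : g x ≤ 0 ↔ F x ≤ 0 := by
  rw [le_iff_lt_or_eq, le_iff_lt_or_eq, hgF x hx, hg.eq_zero_iff, hF.mem_iff x hx]

theorem exists_pos_forall_abs_lt_lineMap_mem {O : Set V} (hO : IsOpen O) {x y : V} {t : ℝ}
    (ht : AffineMap.lineMap x y t ∈ O) :
    ∃ η > 0, ∀ s, |s - t| < η → AffineMap.lineMap x y s ∈ O := by
  have hc : Continuous (fun s : ℝ => (AffineMap.lineMap x y s : V)) :=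
    AffineMap.lineMap_continuous (R := ℝ)
  obtain ⟨η, hη, h⟩ := Metric.mem_nhds_iff.mp ((hO.preimage hc).mem_nhds ht)
  exact ⟨η, hη, fun s hs => h (by simpa [Real.dist_eq] using hs)⟩

theorem lineMap_mem_openSegment {x y : V} {a b c : ℝ} (hab : a < b) (hbc : b < c) :
    AffineMap.lineMap x y b ∈ openSegment ℝ (AffineMap.lineMap x y a : V)
      (AffineMap.lineMap x y c) := by
  refine ⟨(c - b) / (c - a), (b - a) / (c - a), div_pos (by linarith) (by linarith),
    div_pos (by linarith) (by linarith), ?_, ?_⟩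
  · rw [← add_div, div_eq_one_iff_eq] <;> linarith
  · have hca : c - a ≠ 0 := by linarith
    simp only [AffineMap.lineMap_apply_module]
    have h1 : (c - b) / (c - a) = 1 - (b - a) / (c - a) := by
      field_simp
      ring
    have h2 : b = a + (b - a) / (c - a) * (c - a) := by
      field_simp
      ring
    rw [h1]
    generalize (b - a) / (c - a) = u at h2 ⊢
    subst h2
    module

theorem lineMap_injective {x y : V} (hxy : x ≠ y) :
    Function.Injective (fun s : ℝ => (AffineMap.lineMap x y s : V)) :=
  AffineMap.lineMap_injective ℝ hxy

/-- A nondegenerate segment in the closed negative side has its interior in the open negative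
side. -/
theorem neg_of_chord (hg : IsSeparatingFunction S g) {x y : V} (hxy : x ≠ y)
    (h : ∀ t ∈ Icc (0 : ℝ) 1, g (AffineMap.lineMap x y t) ≤ 0) {t : ℝ} (ht : t ∈ Ioo (0 : ℝ) 1) :
    g (AffineMap.lineMap x y t) < 0 := by
  refine lt_of_le_of_ne (h t ⟨ht.1.le, ht.2.le⟩) fun h0 => ?_
  have hz := (hg.eq_zero_iff _).mp h0
  obtain ⟨r, F, hF, hgF⟩ := hg.exists_local _ hz
  obtain ⟨η, hη, hball⟩ := exists_pos_forall_abs_lt_lineMap_mem isOpen_ball hF.mem_ball_self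
  -- Small enough that t ± ε stay in [0, 1] and both points lie in the local ball, where strict
  -- convexity makes F negative at the supposed contact point.
  set ε := min (η / 2) (min (t / 2) ((1 - t) / 2)) with hε
  have hε0 : 0 < ε := by
    have := ht.1
    have := ht.2
    refine lt_min (by linarith) (lt_min (by linarith) (by linarith))
  have h1 : ε ≤ η / 2 := min_le_left _ _
  have h2 : ε ≤ t / 2 := (min_le_right _ _).trans (min_le_left _ _)
  have h3 : ε ≤ (1 - t) / 2 := (min_le_right _ _).trans (min_le_right _ _)
  have ha := hball (t - ε) (by rw [abs_lt]; constructor <;> linarith)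
  have hb := hball (t + ε) (by rw [abs_lt]; constructor <;> linarith)
  have hlt := hF.lt_of_mem_openSegment ha hb
    (fun he => by
      have := lineMap_injective hxy he
      linarith)
    ((hg.le_iff hF hgF ha).mp (h _ ⟨by linarith [ht.1], by linarith [ht.2]⟩))
    ((hg.le_iff hF hgF hb).mp (h _ ⟨by linarith [ht.1], by linarith [ht.2]⟩))
    (lineMap_mem_openSegment (by linarith) (by linarith))
  exact hlt.ne ((hF.mem_iff _ hF.mem_ball_self).mp hz)

theorem le_of_mem_ball (hg : IsSeparatingFunction S g) {p : V} {r : ℝ} {F : V → ℝ}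
    (hF : IsStrictlyConvexDefining S p r F) (hgF : ∀ x ∈ ball p r, g x < 0 ↔ F x < 0) {a b : V}
    (ha : a ∈ ball p r) (hb : b ∈ ball p r) (hga : g a ≤ 0) (hgb : g b ≤ 0) {s : ℝ}
    (hs : s ∈ Icc (0 : ℝ) 1) : g (AffineMap.lineMap a b s) ≤ 0 := by
  have hconv := hF.strictConvexOn.convexOn.convex_le 0
  have h1 : AffineMap.lineMap a b s ∈ {x ∈ ball p r | F x ≤ 0} := by
    refine hconv.lineMap_mem ⟨ha, (hg.le_iff hF hgF ha).mp hga⟩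
      ⟨hb, (hg.le_iff hF hgF hb).mp hgb⟩ hs
  exact (hg.le_iff hF hgF h1.1).mpr h1.2

theorem continuous_lineMap_prod :
    Continuous fun w : (V × V) × ℝ => (AffineMap.lineMap w.1.1 w.1.2 w.2 : V) := by
  simp only [AffineMap.lineMap_apply_module]
  fun_prop

/-- Near the initial point of a good chord, nearby chords are good. -/
theorem eventually_le_near_zero (hg : IsSeparatingFunction S g) {x y : V} (hxy : x ≠ y)
    (hx : x ∈ S) (h : ∀ t ∈ Icc (0 : ℝ) 1, g (AffineMap.lineMap x y t) ≤ 0) :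
    ∀ᶠ w : (V × V) × ℝ in 𝓝 ((x, y), 0), w.1.1 ∈ S → 0 ≤ w.2 →
      g (AffineMap.lineMap w.1.1 w.1.2 w.2) ≤ 0 := by
  obtain ⟨r, F, hF, hgF⟩ := hg.exists_local _ hx
  obtain ⟨η, hη, hball⟩ := exists_pos_forall_abs_lt_lineMap_mem (x := x) (y := y) (t := 0)
    (isOpen_ball (x := x) (ε := r)) (by simpa using hF.pos)
  -- The point at parameter t₁ is strictly negative and inside the local ball, and remains so for
  -- nearby chords. With the start on S, convexity in the ball covers all parameters up to t₁.
  set t₁ := min (η / 2) (1 / 2) with ht₁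
  have ht0 : 0 < t₁ := lt_min (by linarith) (by norm_num)
  have hta : t₁ ≤ η / 2 := min_le_left _ _
  have htb : t₁ ≤ 1 / 2 := min_le_right _ _
  have hneg := hg.neg_of_chord hxy h (t := t₁) ⟨ht0, by linarith⟩
  have hmem := hball t₁ (by rw [abs_lt]; constructor <;> linarith)
  have hc₁ : Continuous fun w : (V × V) × ℝ => (AffineMap.lineMap w.1.1 w.1.2 t₁ : V) := by
    simp only [AffineMap.lineMap_apply_module]
    fun_prop
  have e1 : ∀ᶠ w : (V × V) × ℝ in 𝓝 ((x, y), 0), AffineMap.lineMap w.1.1 w.1.2 t₁ ∈ ball x r :=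
    hc₁.continuousAt.eventually (isOpen_ball.mem_nhds hmem)
  have e2 : ∀ᶠ w : (V × V) × ℝ in 𝓝 ((x, y), 0), g (AffineMap.lineMap w.1.1 w.1.2 t₁) < 0 :=
    (hg.continuous.comp hc₁).continuousAt.eventually (gt_mem_nhds hneg)
  have e3 : ∀ᶠ w : (V × V) × ℝ in 𝓝 ((x, y), 0), w.1.1 ∈ ball x r :=
    (continuous_fst.comp continuous_fst).continuousAt.eventually
      (isOpen_ball.mem_nhds hF.mem_ball_self)
  have e4 : ∀ᶠ w : (V × V) × ℝ in 𝓝 ((x, y), 0), w.2 < t₁ :=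
    continuous_snd.continuousAt.eventually (gt_mem_nhds ht0)
  filter_upwards [e1, e2, e3, e4] with w h1 h2 h3 h4 hwS hw0
  have := hg.le_of_mem_ball hF hgF h3 h1 ((hg.eq_zero_iff _).mpr hwS).le h2.le (s := w.2 / t₁)
    ⟨by positivity, by rw [div_le_one ht0]; exact h4.le⟩
  convert this using 2
  simp only [AffineMap.lineMap_apply_module]
  have h5 : w.2 = w.2 / t₁ * t₁ := by field_simp
  generalize w.2 / t₁ = u at h5
  rw [h5]
  module

/-- All chords of `S` lie in the closed negative side. -/
theorem chord_le (hg : IsSeparatingFunction S g) (hSc : IsConnected S) {x y : V}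
    (hx : x ∈ S) (hy : y ∈ S) :
    ∀ t ∈ Icc (0 : ℝ) 1, g (AffineMap.lineMap x y t) ≤ 0 := by
  have hconn : ConnectedSpace S := isConnected_iff_connectedSpace.mp hSc
  -- K is open, closed and contains the diagonal, while S × S is connected. For openness, a
  -- degenerate chord stays in one local ball; for the others inner points are strictly negative,
  -- end points are handled by local convexity, and [0, 1] is compact.
  set K : Set (S × S) := {w | ∀ t ∈ Icc (0 : ℝ) 1,
    g (AffineMap.lineMap (w.1 : V) (w.2 : V) t) ≤ 0} with hK
  have hvc : Continuous fun w : S × S => ((w.1 : V), (w.2 : V)) := by fun_prop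
  have hcl : IsClosed K := by
    have : K = ⋂ t ∈ Icc (0 : ℝ) 1,
        {w : S × S | g (AffineMap.lineMap (w.1 : V) (w.2 : V) t) ≤ 0} := by
      ext w
      simp [hK]
    rw [this]
    refine isClosed_biInter fun t _ => isClosed_le (hg.continuous.comp ?_) continuous_const
    exact continuous_lineMap_prod.comp (hvc.prodMk continuous_const)
  have hop : IsOpen K := by
    rw [isOpen_iff_mem_nhds]
    rintro ⟨x, y⟩ hxy
    have hxyK : ∀ t ∈ Icc (0 : ℝ) 1, g (AffineMap.lineMap (x : V) (y : V) t) ≤ 0 := hxy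
    by_cases hne : (x : V) = y
    · obtain ⟨r, F, hF, hgF⟩ := hg.exists_local _ x.2
      have e : ∀ᶠ w : S × S in 𝓝 (x, y), (w.1 : V) ∈ ball (x : V) r ∧ (w.2 : V) ∈ ball (x : V) r := by
        refine Filter.Eventually.and ?_ ?_
        · have : Continuous fun w : S × S => (w.1 : V) := by fun_prop
          exact this.continuousAt.eventually (isOpen_ball.mem_nhds hF.mem_ball_self)
        · have : Continuous fun w : S × S => (w.2 : V) := by fun_prop
          refine this.continuousAt.eventually (isOpen_ball.mem_nhds ?_)
          simp only [← hne]
          exact hF.mem_ball_self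
      filter_upwards [e] with w hw t ht
      exact hg.le_of_mem_ball hF hgF hw.1 hw.2 ((hg.eq_zero_iff _).mpr w.1.2).le
        ((hg.eq_zero_iff _).mpr w.2.2).le ht
    · have hcomp : ∀ᶠ w : V × V in 𝓝 ((x : V), (y : V)), ∀ t ∈ Icc (0 : ℝ) 1,
          w.1 ∈ S → w.2 ∈ S → g (AffineMap.lineMap w.1 w.2 t) ≤ 0 := by
        have hall : ∀ t ∈ Icc (0 : ℝ) 1, ∀ᶠ z : (V × V) × ℝ in 𝓝 (((x : V), (y : V)), t),
            z.2 ∈ Icc (0 : ℝ) 1 → z.1.1 ∈ S → z.1.2 ∈ S →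
              g (AffineMap.lineMap z.1.1 z.1.2 z.2) ≤ 0 := by
          intro t ht
          rcases ht.1.eq_or_lt with rfl | ht0
          · filter_upwards [hg.eventually_le_near_zero hne x.2 hxyK] with z hz hz1 hz2 _
            exact hz hz2 hz1.1
          rcases ht.2.eq_or_lt with rfl | ht1
          · have hsymm : ∀ s ∈ Icc (0 : ℝ) 1, g (AffineMap.lineMap (y : V) (x : V) s) ≤ 0 := by
              intro s hs
              rw [← AffineMap.lineMap_apply_one_sub]
              exact hxyK _ ⟨by linarith [hs.2], by linarith [hs.1]⟩
            have hev := hg.eventually_le_near_zero (Ne.symm hne) y.2 hsymm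
            have hsw : Continuous fun z : (V × V) × ℝ => ((z.1.2, z.1.1), 1 - z.2) := by fun_prop
            have hev' := (hsw.tendsto (((x : V), (y : V)), 1)).eventually
              (p := fun w : (V × V) × ℝ => w.1.1 ∈ S → 0 ≤ w.2 →
                g (AffineMap.lineMap w.1.1 w.1.2 w.2) ≤ 0) (by simpa using hev)
            filter_upwards [hev'] with z hz hz1 _ hz3
            have := hz hz3 (by linarith [hz1.2])
            rwa [AffineMap.lineMap_apply_one_sub] at this
          · have hneg := hg.neg_of_chord hne hxyK ⟨ht0, ht1⟩
            have := (hg.continuous.comp continuous_lineMap_prod).continuousAt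
              (x := (((x : V), (y : V)), t)) |>.eventually (gt_mem_nhds hneg)
            filter_upwards [this] with z hz _ _ _
            exact le_of_lt hz
        have := isCompact_Icc.eventually_forall_of_forall_eventually
          (P := fun (w : V × V) t => t ∈ Icc (0 : ℝ) 1 → w.1 ∈ S → w.2 ∈ S →
              g (AffineMap.lineMap w.1 w.2 t) ≤ 0) hall
        filter_upwards [this] with w hw t ht
        exact hw t ht ht
      have := (hvc.tendsto (x, y)).eventually hcomp
      filter_upwards [this] with w hw t ht
      exact hw t ht w.1.2 w.2.2
  have hne : K.Nonempty := ⟨(⟨x, hx⟩, ⟨x, hx⟩), fun t _ => by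
    simp [(hg.eq_zero_iff x).mpr hx]⟩
  have huniv := IsClopen.eq_univ ⟨hcl, hop⟩ hne
  have : ((⟨x, hx⟩, ⟨y, hy⟩) : S × S) ∈ K := huniv ▸ mem_univ _
  exact this

theorem exists_near_neg (hg : IsSeparatingFunction S g) (hSc : IsConnected S) {p y : V}
    (hp : p ∈ S) (hy : y ∈ S) (hyp : y ≠ p) {r : ℝ} (hr : 0 < r) :
    ∃ t ∈ Ioo (0 : ℝ) 1, AffineMap.lineMap p y t ∈ ball p r ∧ g (AffineMap.lineMap p y t) < 0 := by
  obtain ⟨η, hη, hball⟩ := exists_pos_forall_abs_lt_lineMap_mem (x := p) (y := y) (t := 0)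
    (isOpen_ball (x := p) (ε := r)) (by simpa using hr)
  have ht0 : 0 < min (η / 2) (1 / 2) := lt_min (by linarith) (by norm_num)
  have hta : min (η / 2) (1 / 2) ≤ η / 2 := min_le_left _ _
  have htb : min (η / 2) (1 / 2) ≤ 1 / 2 := min_le_right _ _
  have hmem : min (η / 2) (1 / 2) ∈ Ioo (0 : ℝ) 1 := ⟨ht0, by linarith⟩
  exact ⟨_, hmem, hball _ (by rw [abs_lt]; constructor <;> linarith),
    hg.neg_of_chord hyp.symm (hg.chord_le hSc hp hy) hmem⟩

/-- A functional separating p from the local negative side, which is open and convex, works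
globally: each chord from p enters that side at once. -/
theorem exists_exposing (hg : IsSeparatingFunction S g) (hSc : IsConnected S) {p : V}
    (hp : p ∈ S) : ∃ l : V →L[ℝ] ℝ, ∀ y ∈ S, y ≠ p → l y < l p := by
  obtain ⟨r, F, hF, hgF⟩ := hg.exists_local _ hp
  have hopen : IsOpen {x ∈ ball p r | F x < 0} :=
    hF.continuousOn.isOpen_inter_preimage isOpen_ball isOpen_Iio
  obtain ⟨l, hl⟩ := geometric_hahn_banach_open_point hF.convex_neg hopen (x := p)
    (fun h => h.2.ne ((hF.mem_iff p h.1).mp hp))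
  refine ⟨l, fun y hy hyp => ?_⟩
  obtain ⟨t, ht, hb, hn⟩ := hg.exists_near_neg hSc hp hy hyp hF.pos
  have := hl _ ⟨hb, (hgF _ hb).mp hn⟩
  rw [AffineMap.lineMap_apply_module'] at this
  simp only [map_add, map_smul, map_sub, smul_eq_mul] at this
  nlinarith [ht.1]

/-- If p and q both maximise l, some point of their chord near p is negative and at the maximal
level. Pushing it up gives a negative point above that level; pushing it down and reflecting through
p gives a positive one. Between these two lies a point of S above the maximum. -/
theorem eq_of_maximizers (hg : IsSeparatingFunction S g) (hSc : IsConnected S)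
    {l : V →L[ℝ] ℝ} (hl : l ≠ 0) {p q : V} (hp : p ∈ S) (hq : q ∈ S)
    (hmax : ∀ y ∈ S, l y ≤ l p) (hlq : l q = l p) : q = p := by
  by_contra hqp
  obtain ⟨r, F, hF, hgF⟩ := hg.exists_local _ hp
  obtain ⟨t, ht, hb, hn⟩ := hg.exists_near_neg hSc hp hq hqp hF.pos
  set a := AffineMap.lineMap p q t with ha
  have hla : l a = l p := by
    rw [ha, AffineMap.lineMap_apply_module']
    simp [hlq]
  obtain ⟨u, hu⟩ : ∃ u, 0 < l u := by
    by_contra! hle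
    apply hl
    ext v
    have h1 := hle v
    have h2 := hle (-v)
    simp only [map_neg] at h2
    simp only [zero_apply]
    linarith
  have hopen : IsOpen {x ∈ ball p r | F x < 0} :=
    hF.continuousOn.isOpen_inter_preimage isOpen_ball isOpen_Iio
  have haA : a ∈ {x ∈ ball p r | F x < 0} := ⟨hb, (hgF _ hb).mp hn⟩
  have hc1 : Continuous fun s : ℝ => a + s • u := by fun_prop
  have hc2 : Continuous fun s : ℝ => a - s • u := by fun_prop
  have e1 : ∀ᶠ s : ℝ in 𝓝 0, a + s • u ∈ {x ∈ ball p r | F x < 0} :=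
    hc1.continuousAt.eventually (hopen.mem_nhds (by simpa using haA))
  have e2 : ∀ᶠ s : ℝ in 𝓝 0, a - s • u ∈ {x ∈ ball p r | F x < 0} :=
    hc2.continuousAt.eventually (hopen.mem_nhds (by simpa using haA))
  obtain ⟨s, ⟨hs1, hs2⟩, hs0⟩ := (((e1.and e2).filter_mono
    (nhdsWithin_le_nhds (s := Ioi (0 : ℝ)))).and self_mem_nhdsWithin).exists
  have hs0' : 0 < s := hs0
  set v := (a - s • u) - p with hv
  have hpv : p + v = a - s • u := by rw [hv]; abel
  have hlv : l v < 0 := by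
    rw [hv]
    simp only [map_sub, map_smul, smul_eq_mul, hla]
    nlinarith
  have hv0 : v ≠ 0 := by
    intro h
    rw [h, map_zero] at hlv
    exact lt_irrefl _ hlv
  have hvr : ‖v‖ < r := by
    rw [hv, ← dist_eq_norm]
    exact hs2.1
  have hpos := hF.reflect_pos hp hvr (by rw [hpv]; exact hs2.2.le) hv0
  have hH : Convex ℝ (ball p r ∩ {x | l p < l x}) :=
    (convex_ball p r).inter (convex_halfSpace_gt l.toLinearMap.isLinear _)
  have hm1 : a + s • u ∈ ball p r ∩ {x | l p < l x} := by
    refine ⟨hs1.1, ?_⟩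
    simp only [mem_ofPred_eq, map_add, map_smul, smul_eq_mul, hla]
    nlinarith
  have hm2 : p - v ∈ ball p r ∩ {x | l p < l x} := by
    refine ⟨by simpa [dist_eq_norm] using hvr, ?_⟩
    simp only [mem_ofPred_eq, map_sub]
    linarith
  obtain ⟨z, hz, hFz⟩ := hH.isPreconnected.intermediate_value hm1 hm2
    (hF.continuousOn.mono inter_subset_left)
    (show (0 : ℝ) ∈ Icc _ _ from ⟨hs1.2.le, hpos.le⟩)
  exact absurd (hmax z ((hF.mem_iff z hz.1).mpr hFz)) (not_le.mpr hz.2)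

end IsSeparatingFunction

/-- **Hadamard's theorem**: a closed hypersurface with positive definite second fundamental form
bounds a strictly convex body. -/
theorem IsClosedConvexHypersurface.isStrictlyConvexBoundary [FiniteDimensional ℝ V] {S : Set V}
    (hS : IsClosedConvexHypersurface S) (hrank : 1 < Module.rank ℝ V) :
    IsStrictlyConvexBoundary S := by
  have hdef := fun p (hp : p ∈ S) => hS.exists_isStrictlyConvexDefining hp
  obtain ⟨g, hgc, hg0, hgl⟩ := exists_separating_function hS.isCompact hS.isConnected hrank hdef
  have hg : IsSeparatingFunction S g := ⟨hgc, hg0, hgl⟩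
  refine isStrictlyConvexBoundary_of_exposed hS.isCompact ?_
    (fun p hp => hg.exists_exposing hS.isConnected hp)
    (fun l hl p hp q hq hmax hlq => hg.eq_of_maximizers hS.isConnected hl hp hq hmax hlq)
  obtain ⟨p, hp⟩ := hS.isConnected.nonempty
  obtain ⟨r, F, hF⟩ := hdef p hp
  obtain ⟨z, -, hz, hzp⟩ := hF.exists_ne_mem hp hrank
  exact ⟨z, hz, p, hp, hzp⟩

end Hadamard

/-! ### Boundaries of strictly convex bodies, and exclusion of one-sided zeros on a fibre -/

section StrictlyConvexBoundary

open Metric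

variable {V : Type*} [NormedAddCommGroup V] [NormedSpace ℝ V]

theorem exists_smul_add_eq_zero {f : V → ℝ} {B : Set V} (hB : Convex ℝ B) (hf : ContinuousOn f B)
    {a v : V} (ha : a ∈ B) (hb : a + v ∈ B) (hfa : f a < 0) (hfb : 0 < f (a + v)) :
    ∃ s ∈ Ioo (0 : ℝ) 1, a + s • v ∈ B ∧ f (a + s • v) = 0 := by
  have hmaps : MapsTo (fun s : ℝ => a + s • v) (Icc 0 1) B := fun s hs =>
    hB.add_smul_mem ha hb hs
  have hcont : ContinuousOn (fun s : ℝ => f (a + s • v)) (Icc 0 1) :=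
    hf.comp (by fun_prop) hmaps
  obtain ⟨s, hs, hfs⟩ := intermediate_value_Icc zero_le_one hcont
    (show (0 : ℝ) ∈ Icc (f (a + (0 : ℝ) • v)) (f (a + (1 : ℝ) • v)) by
      simpa using ⟨hfa.le, hfb.le⟩)
  simp only at hfs
  refine ⟨s, ⟨lt_of_le_of_ne hs.1 ?_, lt_of_le_of_ne hs.2 ?_⟩, hmaps hs, hfs⟩
  · rintro rfl
    rw [zero_smul, add_zero] at hfs
    exact hfa.ne hfs
  · rintro rfl
    rw [one_smul] at hfs
    exact hfb.ne' hfs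

namespace IsStrictlyConvexBoundary

variable {A : Set V}

theorem isClosed_convexHull (h : IsStrictlyConvexBoundary A) [FiniteDimensional ℝ V] :
    IsClosed (convexHull ℝ A) :=
  h.isCompact.convexHull_of_finiteDimensional.isClosed

theorem notMem_of_mem_interior (h : IsStrictlyConvexBoundary A) {x : V}
    (hx : x ∈ interior (convexHull ℝ A)) : x ∉ A := fun hxA => by
  rw [← h.frontier_eq] at hxA
  exact hxA.2 hx

theorem mem_interior (h : IsStrictlyConvexBoundary A) {x : V}
    (hx : x ∈ convexHull ℝ A) (hxA : x ∉ A) : x ∈ interior (convexHull ℝ A) := by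
  by_contra hxi
  apply hxA
  rw [← h.frontier_eq]
  exact ⟨subset_closure hx, hxi⟩

theorem subset_interior_of_isPreconnected [FiniteDimensional ℝ V] (h : IsStrictlyConvexBoundary A)
    {P : Set V} (hP : IsPreconnected P) (hPA : Disjoint P A)
    (hne : (P ∩ convexHull ℝ A).Nonempty) : P ⊆ interior (convexHull ℝ A) := by
  refine hP.subset_left_of_subset_union isOpen_interior h.isClosed_convexHull.isOpen_compl
    (disjoint_compl_right.mono_left interior_subset) (fun x hx => ?_) ?_
  · by_cases hxC : x ∈ convexHull ℝ A
    · exact Or.inl (h.mem_interior hxC (disjoint_left.mp hPA hx))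
    · exact Or.inr hxC
  · obtain ⟨x, hx, hxC⟩ := hne
    exact ⟨x, hx, h.mem_interior hxC (disjoint_left.mp hPA hx)⟩

/-- Otherwise v would lie strictly between two distinct points of the hull and hence be interior. -/
theorem add_smul_sub_notMem (h : IsStrictlyConvexBoundary A) {c v : V}
    (hc : c ∈ interior (convexHull ℝ A)) (hv : v ∈ A) {t : ℝ} (ht : 0 < t) :
    v + t • (v - c) ∉ convexHull ℝ A := by
  intro hmem
  have hcv : c ≠ v := by
    rintro rfl
    exact h.notMem_of_mem_interior hc hv
  have hne : c ≠ v + t • (v - c) := by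
    intro heq
    have h1 : (1 + t) • (v - c) = 0 := by
      have : (1 + t) • (v - c) = (v + t • (v - c)) - c := by module
      rw [this, ← heq, sub_self]
    rcases smul_eq_zero.mp h1 with h2 | h2
    · linarith
    · exact hcv (sub_eq_zero.mp h2).symm
  refine h.notMem_of_mem_interior (h.strictConvex (interior_subset hc) hmem hne
    (a := t / (1 + t)) (b := 1 / (1 + t)) (by positivity) (by positivity) (by field_simp; ring)) ?_
  convert hv using 1
  have h3 : (1 + t) ≠ 0 := by positivity
  have h4 : t / (1 + t) = 1 - 1 / (1 + t) := by field_simp; ring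
  have h5 : t = (1 + t) - 1 := by ring
  rw [h4]
  have h6 : (1 / (1 + t)) • (v + t • (v - c)) = (1 / (1 + t) * (1 + t)) • v +
      (-(1 / (1 + t) * (1 + t)) + 1 / (1 + t)) • c := by
    generalize 1 / (1 + t) = w
    module
  rw [h6, one_div_mul_cancel h3]
  module

/-- A small sphere about v is connected, contains a hull point towards c and a point outside the
hull away from c, and therefore meets A. -/
theorem exists_ne_mem_of_mem_nhds [FiniteDimensional ℝ V] (h : IsStrictlyConvexBoundary A)
    (hrank : 1 < Module.rank ℝ V) {v : V} (hv : v ∈ A) {O : Set V} (hO : O ∈ 𝓝 v) :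
    ∃ z ∈ A ∩ O, z ≠ v := by
  obtain ⟨c, hc⟩ := h.interior_nonempty
  have hcv : c ≠ v := by
    rintro rfl
    exact h.notMem_of_mem_interior hc hv
  have hvC : v ∈ convexHull ℝ A := subset_convexHull ℝ A hv
  obtain ⟨r, hr, hball⟩ := Metric.mem_nhds_iff.mp hO
  have hd : 0 < ‖c - v‖ := norm_pos_iff.mpr (sub_ne_zero.mpr hcv)
  set t := min (1 / 2) (r / (2 * ‖c - v‖)) with ht
  have ht0 : 0 < t := lt_min (by norm_num) (by positivity)
  have ht1 : t < 1 := (min_le_left _ _).trans_lt (by norm_num)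
  have htr : t * ‖c - v‖ < r := by
    have : t ≤ r / (2 * ‖c - v‖) := min_le_right _ _
    rw [le_div_iff₀ (by positivity)] at this
    nlinarith
  have hsph : IsPreconnected (sphere v (t * ‖c - v‖)) :=
    (isConnected_sphere hrank v (by positivity)).isPreconnected
  have ha : v + t • (c - v) ∈ sphere v (t * ‖c - v‖) := by
    simp [norm_smul, abs_of_pos ht0]
  have hb : v + t • (v - c) ∈ sphere v (t * ‖c - v‖) := by
    simp [norm_smul, abs_of_pos ht0, norm_sub_rev]
  have haC : v + t • (c - v) ∈ convexHull ℝ A :=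
    (convex_convexHull ℝ A).add_smul_sub_mem hvC (interior_subset hc) ⟨ht0.le, ht1.le⟩
  by_contra! hcon
  have hdisj : Disjoint (sphere v (t * ‖c - v‖)) A := by
    rw [disjoint_left]
    intro z hz hzA
    have hzv : z = v := hcon z ⟨hzA, hball (by
      rw [mem_ball, mem_sphere.mp hz]
      exact htr)⟩
    rw [hzv, mem_sphere, dist_self] at hz
    exact (by positivity : t * ‖c - v‖ ≠ 0) hz.symm
  have := h.subset_interior_of_isPreconnected hsph hdisj ⟨_, ha, haC⟩ hb
  exact h.add_smul_sub_notMem hc hv ht0 (interior_subset this)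

theorem image (h : IsStrictlyConvexBoundary A) {W : Type*} [NormedAddCommGroup W] [NormedSpace ℝ W]
    (L : V ≃L[ℝ] W) : IsStrictlyConvexBoundary (L '' A) := by
  have hconv : convexHull ℝ (L '' A) = L '' convexHull ℝ A :=
    ((L : V →L[ℝ] W).toLinearMap.image_convexHull A).symm
  have hi : interior (L '' convexHull ℝ A) = L '' interior (convexHull ℝ A) :=
    (L.toHomeomorph.image_interior _).symm
  refine ⟨h.isCompact.image L.continuous, ?_, ?_, ?_⟩
  · rw [hconv, hi]
    exact h.interior_nonempty.image _
  · rw [hconv]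
    conv_rhs => rw [← h.frontier_eq]
    exact (L.toHomeomorph.image_frontier _).symm
  · rw [hconv]
    exact h.strictConvex.linear_image (L : V →L[ℝ] W).toLinearMap L.toHomeomorph.isOpenMap

end IsStrictlyConvexBoundary

/-- If the slices of the regular zero set of `F` are boundaries of strictly convex bodies, then
`F` cannot be nonnegative on a fibre near a zero. -/
theorem false_of_nonneg_on_fibre [FiniteDimensional ℝ V] (hrank : 1 < Module.rank ℝ V)
    {E : Type*} [NormedAddCommGroup E] [NormedSpace ℝ E] {F : E × V → ℝ} {N : Set E} {e₀ : E}
    {v₀ : V} {r : ℝ} (hN : IsOpen N) (he₀ : e₀ ∈ N) (hr : 0 < r)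
    (hF : ContDiffOn ℝ 1 F (N ×ˢ ball v₀ r)) (hdF : fderiv ℝ F (e₀, v₀) ≠ 0) {A : E → Set V}
    (hA : ∀ e ∈ N, IsStrictlyConvexBoundary (A e))
    (hAF : ∀ e ∈ N, ∀ v ∈ ball v₀ r, v ∈ A e ↔ F (e, v) = 0) (hv₀ : v₀ ∈ A e₀)
    (hnn : ∀ v ∈ ball v₀ r, 0 ≤ F (e₀, v)) : False := by
  have hopen : IsOpen (N ×ˢ ball v₀ r) := hN.prod isOpen_ball
  have hv₀r : v₀ ∈ ball v₀ r := mem_ball_self hr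
  have hcd : ∀ v ∈ ball v₀ r, ContDiffAt ℝ 1 F (e₀, v) := fun v hv =>
    hF.contDiffAt (hopen.mem_nhds ⟨he₀, hv⟩)
  have hder : ∀ v ∈ ball v₀ r, HasFDerivAt F (fderiv ℝ F (e₀, v)) (e₀, v) := fun v hv =>
    ((hcd v hv).differentiableAt one_ne_zero).hasFDerivAt
  have hF0 : F (e₀, v₀) = 0 := (hAF e₀ he₀ v₀ hv₀r).mp hv₀
  -- v₀ minimises F on the fibre, so dF vanishes vertically and is negative in some base direction
  -- t₀. Moving e₀ along t₀ makes F negative at points of the old slice while it stays positive at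
  -- chosen points beside them. The new slice then has two sheets, which strict convexity forbids.
  have hfib : ∀ v, fderiv ℝ F (e₀, v₀) (0, v) = 0 := by
    have h1 : HasFDerivAt (fun v => F (e₀, v)) _ v₀ :=
      (hder v₀ hv₀r).comp v₀ (hasFDerivAt_prodMk_right e₀ v₀)
    have hmin : IsLocalMin (fun v => F (e₀, v)) v₀ := by
      filter_upwards [ball_mem_nhds v₀ hr] with v hv
      rw [hF0]
      exact hnn v hv
    have h2 := hmin.hasFDerivAt_eq_zero h1
    intro v
    simpa using congrArg (fun l => l v) h2
  obtain ⟨t₀, ht₀⟩ : ∃ t₀ : E, fderiv ℝ F (e₀, v₀) (t₀, 0) < 0 := by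
    by_contra! hge
    apply hdF
    refine ContinuousLinearMap.ext ?_
    rintro ⟨t, v⟩
    have h1 : ((t, v) : E × V) = (t, 0) + (0, v) := by simp
    have h2 := hge t
    have h3 := hge (-t)
    have h4 : ((-t, 0) : E × V) = -(t, 0) := by simp
    rw [h4, map_neg] at h3
    rw [h1, map_add, hfib v, add_zero]
    simp only [zero_apply]
    linarith
  have hev : ∀ᶠ v in 𝓝 v₀, fderiv ℝ F (e₀, v) (t₀, 0) < 0 := by
    have h1 : ContinuousAt (fderiv ℝ F) (e₀, v₀) :=
      ((hcd v₀ hv₀r).fderiv_right (m := 0) (by norm_num)).continuousAt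
    have h2 : ContinuousAt (fun v : V => (e₀, v)) v₀ := by fun_prop
    have h3 : ContinuousAt (fun v => fderiv ℝ F (e₀, v)) v₀ :=
      ContinuousAt.comp (f := fun v : V => (e₀, v)) h1 h2
    exact (h3.clm_apply continuousAt_const).eventually (gt_mem_nhds ht₀)
  obtain ⟨r₁, hr₁, hball⟩ := Metric.mem_nhds_iff.mp (Filter.inter_mem (ball_mem_nhds v₀ hr) hev)
  have hA₀ := hA e₀ he₀
  obtain ⟨c, hc⟩ := hA₀.interior_nonempty
  set u := v₀ - c with hu
  have hu0 : u ≠ 0 := by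
    intro h
    have : v₀ = c := sub_eq_zero.mp h
    exact hA₀.notMem_of_mem_interior hc (this ▸ hv₀)
  have hun : 0 < ‖u‖ := norm_pos_iff.mpr hu0
  -- Three points of the slice over e₀ are used: v₀, a nearby z, and a point m + τ u above their
  -- midpoint m. The displacement τ₀ u has length r₁ / 8, so all of them stay well inside the ball
  -- of radius r₁.
  set τ₀ := r₁ / (8 * ‖u‖) with hτ₀
  have hτ₀pos : 0 < τ₀ := by positivity
  have hτ₀u : τ₀ * ‖u‖ = r₁ / 8 := by
    rw [hτ₀]
    field_simp
  have hexit : v₀ + τ₀ • u ∉ convexHull ℝ (A e₀) := hA₀.add_smul_sub_notMem hc hv₀ hτ₀pos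
  obtain ⟨ρ, hρ, hρball⟩ := Metric.mem_nhds_iff.mp
    (hA₀.isClosed_convexHull.isOpen_compl.mem_nhds hexit)
  obtain ⟨z, ⟨hzA, hz⟩, hzne⟩ := hA₀.exists_ne_mem_of_mem_nhds hrank hv₀
    (ball_mem_nhds v₀ (lt_min hρ (by positivity : 0 < r₁ / 4)))
  have hzρ : dist z v₀ < ρ := (mem_ball.mp hz).trans_le (min_le_left _ _)
  have hzr : dist z v₀ < r₁ / 4 := (mem_ball.mp hz).trans_le (min_le_right _ _)
  have hsubC := subset_convexHull ℝ (A e₀)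
  set m := midpoint ℝ v₀ z with hm
  have hmi : m ∈ interior (convexHull ℝ (A e₀)) :=
    hA₀.strictConvex.openSegment_subset (hsubC hv₀) (hsubC hzA) hzne.symm
      (midpoint_mem_openSegment v₀ z)
  have hmd : dist m v₀ ≤ dist z v₀ := by
    rw [hm, dist_midpoint_left, dist_comm v₀ z]
    norm_num
    linarith [dist_nonneg (x := z) (y := v₀)]
  have hmexit : m + τ₀ • u ∉ convexHull ℝ (A e₀) := by
    refine hρball ?_
    rw [mem_ball, dist_add_right]
    exact hmd.trans_lt hzρ
  obtain ⟨τ, hτ, hp₂⟩ : ∃ τ ∈ Icc (0 : ℝ) τ₀, m + τ • u ∈ A e₀ := by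
    by_contra! hcon
    have hpre : IsPreconnected ((fun τ : ℝ => m + τ • u) '' Icc 0 τ₀) :=
      isPreconnected_Icc.image _ (by fun_prop)
    have hdis : Disjoint ((fun τ : ℝ => m + τ • u) '' Icc 0 τ₀) (A e₀) := by
      rw [disjoint_left]
      rintro _ ⟨τ, hτ, rfl⟩ hmem
      exact hcon τ hτ hmem
    have := hA₀.subset_interior_of_isPreconnected hpre hdis
      ⟨m, ⟨0, ⟨le_rfl, hτ₀pos.le⟩, by simp⟩, interior_subset hmi⟩ ⟨τ₀, ⟨hτ₀pos.le, le_rfl⟩, rfl⟩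
    exact hmexit (interior_subset this)
  have hτ0 : 0 < τ := by
    refine lt_of_le_of_ne hτ.1 ?_
    rintro rfl
    exact hA₀.notMem_of_mem_interior hmi (by simpa using hp₂)
  have hmu : ∀ {σ₁ σ₂ : ℝ}, σ₁ < σ₂ → m + σ₁ • u ≠ m + σ₂ • u := by
    intro σ₁ σ₂ h heq
    exact h.ne (smul_left_injective ℝ hu0 (add_left_cancel heq))
  have hmseg : ∀ {σ₁ σ₂ σ₃ : ℝ}, σ₁ < σ₂ → σ₂ < σ₃ →
      m + σ₂ • u ∈ openSegment ℝ (m + σ₁ • u) (m + σ₃ • u) := by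
    intro σ₁ σ₂ σ₃ h1 h2
    have := IsSeparatingFunction.lineMap_mem_openSegment (x := m) (y := m + u) h1 h2
    simpa [AffineMap.lineMap_apply_module', add_comm] using this
  -- The bound τ / 4 keeps the new points near v₀ and z lower, in the direction u, than those near m
  -- + τ u; the bound τ₀ keeps all shifted points in the ball.
  set δ := min (τ / 4) τ₀ with hδ
  have hδ0 : 0 < δ := lt_min (by positivity) hτ₀pos
  have hδτ : δ ≤ τ / 4 := min_le_left _ _
  have hδu : δ * ‖u‖ ≤ r₁ / 8 := by
    rw [← hτ₀u]
    exact mul_le_mul_of_nonneg_right (min_le_right _ _) hun.le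
  have hnear : ∀ p : V, dist p v₀ < r₁ / 2 → ∀ κ : ℝ, |κ| ≤ δ → p + κ • u ∈ ball v₀ r₁ := by
    intro p hp κ hκ
    rw [mem_ball]
    have h1 : dist (p + κ • u) v₀ ≤ dist (p + κ • u) p + dist p v₀ := dist_triangle _ _ _
    have h2 : dist (p + κ • u) p = |κ| * ‖u‖ := by
      rw [dist_eq_norm, add_sub_cancel_left, norm_smul, Real.norm_eq_abs]
    have h3 : |κ| * ‖u‖ ≤ δ * ‖u‖ := mul_le_mul_of_nonneg_right hκ hun.le
    linarith
  have hp₁r : dist v₀ v₀ < r₁ / 2 := by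
    rw [dist_self]
    positivity
  have hp₃r : dist z v₀ < r₁ / 2 := by linarith
  have hp₂r : dist (m + τ • u) v₀ < r₁ / 2 := by
    have h1 : dist (m + τ • u) v₀ ≤ dist (m + τ • u) m + dist m v₀ := dist_triangle _ _ _
    have h2 : dist (m + τ • u) m = τ * ‖u‖ := by
      rw [dist_eq_norm, add_sub_cancel_left, norm_smul, Real.norm_of_nonneg hτ.1]
    have h3 : τ * ‖u‖ ≤ τ₀ * ‖u‖ := mul_le_mul_of_nonneg_right hτ.2 hun.le
    linarith
  have hδabs : |δ| ≤ δ := (abs_of_pos hδ0).le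
  have hδabs' : |-δ| ≤ δ := by rw [abs_neg]; exact hδabs
  have hFpos : ∀ p : V, dist p v₀ < r₁ / 2 → ∀ κ : ℝ, |κ| ≤ δ → p + κ • u ∉ A e₀ →
      0 < F (e₀, p + κ • u) := by
    intro p hp κ hκ hnot
    have hb := (hball (hnear p hp κ hκ)).1
    exact lt_of_le_of_ne (hnn _ hb) fun h => hnot ((hAF e₀ he₀ _ hb).mpr h.symm)
  have hq₁ : v₀ + δ • u ∉ A e₀ := fun h =>
    hA₀.add_smul_sub_notMem hc hv₀ hδ0 (hsubC h)
  -- The line through z in direction u may meet the slice again at z + δ u; half the shift then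
  -- lands in the interior.
  obtain ⟨δ₃, hδ₃, hδ₃', hq₃⟩ : ∃ δ₃, 0 < δ₃ ∧ δ₃ ≤ δ ∧ z + δ₃ • u ∉ A e₀ := by
    by_cases h : z + δ • u ∈ A e₀
    · refine ⟨δ / 2, by positivity, by linarith, ?_⟩
      refine hA₀.notMem_of_mem_interior (hA₀.strictConvex.openSegment_subset (hsubC hzA) (hsubC h)
        (fun heq => ?_) ⟨1 / 2, 1 / 2, by norm_num, by norm_num, by norm_num, by module⟩)
      have : δ • u = 0 := by simpa using heq.symm
      rcases smul_eq_zero.mp this with h1 | h1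
      · exact hδ0.ne' h1
      · exact hu0 h1
    · exact ⟨δ, hδ0, le_rfl, h⟩
  have hq₂ : m + τ • u + δ • u ∉ A e₀ := by
    intro h
    rw [add_assoc, ← add_smul] at h
    have hmi' : m + (0 : ℝ) • u ∈ convexHull ℝ (A e₀) := by
      rw [zero_smul, add_zero]
      exact interior_subset hmi
    exact hA₀.notMem_of_mem_interior (hA₀.strictConvex.openSegment_subset hmi'
      (hsubC h) (hmu (by linarith)) (hmseg hτ0 (by linarith))) hp₂
  have hq₂' : m + τ • u + (-δ) • u ∉ A e₀ := by
    rw [add_assoc, ← add_smul]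
    have hmi' : m + (0 : ℝ) • u ∈ convexHull ℝ (A e₀) := by
      rw [zero_smul, add_zero]
      exact interior_subset hmi
    exact hA₀.notMem_of_mem_interior (hA₀.strictConvex.openSegment_subset hmi'
      (hsubC hp₂) (hmu hτ0) (hmseg (by linarith) (by linarith)))
  have hcγ : ∀ v : V, Continuous fun ε : ℝ => ((e₀ + ε • t₀, v) : E × V) := fun v => by fun_prop
  have hdecr : ∀ p ∈ A e₀, dist p v₀ < r₁ / 2 → ∀ᶠ ε in 𝓝[>] (0 : ℝ), F (e₀ + ε • t₀, p) < 0 := by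
    intro p hpA hp
    have hpb := hball (show p ∈ ball v₀ r₁ by rw [mem_ball]; linarith)
    have h1 : HasDerivAt (fun ε : ℝ => ((e₀ + ε • t₀, p) : E × V)) (t₀, 0) 0 := by
      have h2 : HasDerivAt (fun ε : ℝ => e₀ + ε • t₀) t₀ 0 := by
        have h := ((hasDerivAt_id (0 : ℝ)).smul_const t₀).const_add e₀
        rw [one_smul] at h
        exact h
      exact h2.prodMk (hasDerivAt_const _ _)
    have h3 : HasFDerivAt F (fderiv ℝ F (e₀, p)) (e₀ + (0 : ℝ) • t₀, p) := by
      simpa using hder p hpb.1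
    have h4 := h3.comp_hasDerivAt (0 : ℝ) h1
    filter_upwards [h4.tendsto_slope_zero_right.eventually (gt_mem_nhds hpb.2),
      self_mem_nhdsWithin] with ε hε hε0
    have hFp : F (e₀, p) = 0 := (hAF e₀ he₀ p hpb.1).mp hpA
    simp only [Function.comp_apply, zero_add, zero_smul, add_zero, hFp, sub_zero,
      smul_eq_mul] at hε
    exact (pos_iff_neg_of_mul_neg hε).mp (inv_pos.mpr hε0)
  have hstay : ∀ q : V, q ∈ ball v₀ r → 0 < F (e₀, q) →
      ∀ᶠ ε in 𝓝[>] (0 : ℝ), 0 < F (e₀ + ε • t₀, q) := by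
    intro q hq hFq
    have h1 : ContinuousAt F (e₀ + (0 : ℝ) • t₀, q) := by
      simpa using (hcd q hq).continuousAt
    have h2 : ContinuousAt (fun ε : ℝ => F (e₀ + ε • t₀, q)) 0 :=
      ContinuousAt.comp (f := fun ε : ℝ => ((e₀ + ε • t₀, q) : E × V)) h1 (hcγ q).continuousAt
    exact (h2.eventually (lt_mem_nhds (by simpa using hFq))).filter_mono nhdsWithin_le_nhds
  have hstay' : ∀ p : V, dist p v₀ < r₁ / 2 → ∀ κ : ℝ, |κ| ≤ δ → p + κ • u ∉ A e₀ →
      ∀ᶠ ε in 𝓝[>] (0 : ℝ), 0 < F (e₀ + ε • t₀, p + κ • u) := fun p hp κ hκ hnot =>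
    hstay _ (hball (hnear p hp κ hκ)).1 (hFpos p hp κ hκ hnot)
  have hNev : ∀ᶠ ε in 𝓝[>] (0 : ℝ), e₀ + ε • t₀ ∈ N := by
    have : Continuous fun ε : ℝ => e₀ + ε • t₀ := by fun_prop
    exact (this.continuousAt.eventually (hN.mem_nhds (by simpa using he₀))).filter_mono
      nhdsWithin_le_nhds
  have hδ₃abs : |δ₃| ≤ δ := by rwa [abs_of_pos hδ₃]
  obtain ⟨ε, hεN, hε1, hε2, hε3, hε1', hε2', hε2'', hε3'⟩ :=
    (hNev.and ((hdecr v₀ hv₀ hp₁r).and ((hdecr _ hp₂ hp₂r).and ((hdecr z hzA hp₃r).and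
      ((hstay' v₀ hp₁r δ hδabs hq₁).and ((hstay' _ hp₂r δ hδabs hq₂).and
        ((hstay' _ hp₂r (-δ) hδabs' hq₂').and (hstay' z hp₃r δ₃ hδ₃abs hq₃)))))))).exists
  set e := e₀ + ε • t₀ with he
  have hAe := hA e hεN
  have hFc : ContinuousOn (fun v => F (e, v)) (ball v₀ r) :=
    hF.continuousOn.comp (by fun_prop) fun v hv => ⟨hεN, hv⟩
  have hFc₁ : ContinuousOn (fun v => F (e, v)) (ball v₀ r₁) :=
    hFc.mono fun v hv => (hball hv).1
  have hzero : ∀ p : V, dist p v₀ < r₁ / 2 → ∀ κ : ℝ, |κ| ≤ δ → F (e, p) < 0 →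
      0 < F (e, p + κ • u) → ∃ s ∈ Ioo (0 : ℝ) 1, p + (s * κ) • u ∈ A e := by
    intro p hp κ hκ h1 h2
    obtain ⟨s, hs, hsb, hFs⟩ := exists_smul_add_eq_zero (convex_ball v₀ r₁) hFc₁
      (show p ∈ ball v₀ r₁ by rw [mem_ball]; linarith) (hnear p hp κ hκ) h1 h2
    rw [smul_smul] at hsb hFs
    exact ⟨s, hs, (hAF e hεN _ (hball hsb).1).mpr hFs⟩
  obtain ⟨s₁, hs₁, hy₁⟩ := hzero v₀ hp₁r δ hδabs hε1 hε1'
  obtain ⟨s₃, hs₃, hy₃⟩ := hzero z hp₃r δ₃ hδ₃abs hε3 hε3'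
  obtain ⟨s₂, hs₂, hy₂⟩ := hzero _ hp₂r δ hδabs hε2 hε2'
  obtain ⟨s₄, hs₄, hy₄⟩ := hzero _ hp₂r (-δ) hδabs' hε2 hε2''
  have hsubCe := subset_convexHull ℝ (A e)
  -- On the line m + ℝ u the new hull has a point at the average height of the first two new points,
  -- and the new slice has points just below and just above height τ. The lower of these lies
  -- strictly between two hull points, so it is interior.
  have hmid : m + ((s₁ * δ + s₃ * δ₃) / 2) • u ∈ convexHull ℝ (A e) := by
    have h1 := (convex_convexHull ℝ (A e)).midpoint_mem (hsubCe hy₁) (hsubCe hy₃)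
    convert h1 using 1
    rw [hm, midpoint_eq_smul_add, midpoint_eq_smul_add, invOf_eq_inv]
    module
  rw [add_assoc, ← add_smul] at hy₂ hy₄
  have hb1 : s₁ * δ ≤ δ := mul_le_of_le_one_left hδ0.le hs₁.2.le
  have hb3 : s₃ * δ₃ ≤ δ := (mul_le_of_le_one_left hδ₃.le hs₃.2.le).trans hδ₃'
  have hb4 : s₄ * δ ≤ δ := mul_le_of_le_one_left hδ0.le hs₄.2.le
  have hb2 : 0 < s₂ * δ := mul_pos hs₂.1 hδ0
  have hb5 : 0 < s₄ * δ := mul_pos hs₄.1 hδ0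
  have hlt1 : (s₁ * δ + s₃ * δ₃) / 2 < τ + s₄ * -δ := by linarith
  have hlt2 : τ + s₄ * -δ < τ + s₂ * δ := by linarith
  exact hAe.notMem_of_mem_interior (hAe.strictConvex.openSegment_subset hmid (hsubCe hy₂)
    (hmu (hlt1.trans hlt2)) (hmseg hlt1 hlt2)) hy₄

end StrictlyConvexBoundary

/-! ### Semicontinuous families of strictly convex bodies -/

section Families

open Metric

variable {V : Type*} [NormedAddCommGroup V] [NormedSpace ℝ V]

/-- The slices of a regular zero set depend lower semicontinuously on the base point, provided that
they bound strictly convex bodies. -/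
theorem eventually_slice_inter_nonempty [FiniteDimensional ℝ V] (hrank : 1 < Module.rank ℝ V)
    {E : Type*} [NormedAddCommGroup E] [NormedSpace ℝ E] {F : E × V → ℝ} {W : Set (E × V)} {e₀ : E}
    {v₀ : V} (hW : IsOpen W) (hmem : (e₀, v₀) ∈ W)
    (hF : ContDiffOn ℝ 1 F W) (hdF : fderiv ℝ F (e₀, v₀) ≠ 0) {A : E → Set V}
    (hA : ∀ᶠ e in 𝓝 e₀, IsStrictlyConvexBoundary (A e))
    (hAF : ∀ e v, (e, v) ∈ W → (v ∈ A e ↔ F (e, v) = 0)) (hv₀ : v₀ ∈ A e₀)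
    {O : Set V} (hO : O ∈ 𝓝 v₀) : ∀ᶠ e in 𝓝 e₀, (A e ∩ O).Nonempty := by
  obtain ⟨N₁, hN₁, B₁, hB₁, hNB⟩ := mem_nhds_prod_iff.mp (hW.mem_nhds hmem)
  obtain ⟨N, hNsub, hN, he₀N⟩ := _root_.mem_nhds_iff.mp (Filter.inter_mem hN₁ hA)
  obtain ⟨r, hr, hball⟩ := Metric.mem_nhds_iff.mp (Filter.inter_mem hB₁ hO)
  have hsub : N ×ˢ ball v₀ r ⊆ W := fun z hz => hNB ⟨(hNsub hz.1).1, (hball hz.2).1⟩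
  have hFN : ContDiffOn ℝ 1 F (N ×ˢ ball v₀ r) := hF.mono hsub
  have hAN : ∀ e ∈ N, IsStrictlyConvexBoundary (A e) := fun e he => (hNsub he).2
  have hAFN : ∀ e ∈ N, ∀ v ∈ ball v₀ r, v ∈ A e ↔ F (e, v) = 0 := fun e he v hv =>
    hAF e v (hsub ⟨he, hv⟩)
  -- F takes both signs on the fibre near v₀, by the previous result for F and -F. The signs persist
  -- over nearby base points, and the intermediate value theorem gives points of the slices.
  obtain ⟨b, hb, hFb⟩ : ∃ b ∈ ball v₀ r, F (e₀, b) < 0 := by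
    by_contra! hnn
    exact false_of_nonneg_on_fibre hrank hN he₀N hr hFN hdF hAN hAFN hv₀ hnn
  obtain ⟨a, ha, hFa⟩ : ∃ a ∈ ball v₀ r, 0 < F (e₀, a) := by
    by_contra! hnp
    refine false_of_nonneg_on_fibre hrank hN he₀N hr hFN.neg (F := fun z => -F z) ?_ hAN
      (fun e he v hv => by rw [hAFN e he v hv, neg_eq_zero]) hv₀
      (fun v hv => neg_nonneg.mpr (hnp v hv))
    rw [fderiv_fun_neg]
    exact neg_ne_zero.mpr hdF
  have hcont : ∀ v ∈ ball v₀ r, ContinuousAt (fun e => F (e, v)) e₀ := fun v hv =>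
    ContinuousAt.comp (f := fun e : E => (e, v))
      (hFN.continuousOn.continuousAt ((hN.prod isOpen_ball).mem_nhds ⟨he₀N, hv⟩)) (by fun_prop)
  filter_upwards [(hcont b hb).eventually (gt_mem_nhds hFb),
    (hcont a ha).eventually (lt_mem_nhds hFa), hN.mem_nhds he₀N] with e h1 h2 heN
  obtain ⟨z, hz, hFz⟩ := (convex_ball v₀ r).isPreconnected.intermediate_value hb ha
    (f := fun v => F (e, v)) (hFN.continuousOn.comp (by fun_prop) fun v hv => ⟨heN, hv⟩)
    (show (0 : ℝ) ∈ Icc _ _ from ⟨h1.le, h2.le⟩)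
  exact ⟨z, (hAFN e heN z hz).mpr hFz, (hball hz).2⟩

variable {B : Type*} [TopologicalSpace B] {A : B → Set V} {b₀ : B}

/-- Join v to the midpoint m of two points of A b₀. A thickening of this segment misses the nearby
slices by upper semicontinuity and contains a point of their hulls near m by lower semicontinuity,
so connectedness puts it in the interiors. -/
theorem eventually_mem_interior_convexHull [FiniteDimensional ℝ V]
    (hA : ∀ᶠ b in 𝓝 b₀, IsStrictlyConvexBoundary (A b))
    (hlsc : ∀ v ∈ A b₀, ∀ O ∈ 𝓝 v, ∀ᶠ b in 𝓝 b₀, (A b ∩ O).Nonempty)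
    (husc : ∀ K : Set V, IsClosed K → Disjoint K (A b₀) → ∀ᶠ b in 𝓝 b₀, Disjoint K (A b))
    {v : V} (hv : v ∈ interior (convexHull ℝ (A b₀))) :
    ∀ᶠ z : B × V in 𝓝 (b₀, v), z.2 ∈ interior (convexHull ℝ (A z.1)) := by
  have hA₀ := hA.self_of_nhds
  have hnt : (A b₀).Nontrivial := by
    by_contra hnt
    rw [not_nontrivial_iff] at hnt
    have hfr := hA₀.notMem_of_mem_interior hv
    rcases hnt.eq_empty_or_singleton with h | ⟨x, h⟩
    · rw [h] at hv
      simp at hv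
    · rw [h] at hv hfr
      have := interior_subset hv
      rw [convexHull_singleton] at this
      exact hfr this
  obtain ⟨a, ha, b, hb, hab⟩ := hnt
  set m := midpoint ℝ a b with hm
  have hmi : m ∈ interior (convexHull ℝ (A b₀)) :=
    hA₀.strictConvex.openSegment_subset (subset_convexHull ℝ _ ha) (subset_convexHull ℝ _ hb) hab
      (midpoint_mem_openSegment a b)
  have hseg : segment ℝ m v ⊆ interior (convexHull ℝ (A b₀)) :=
    (convex_convexHull ℝ (A b₀)).interior.segment_subset hmi hv
  have hcomp : IsCompact (segment ℝ m v) := by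
    rw [segment_eq_image_lineMap]
    exact isCompact_Icc.image AffineMap.lineMap_continuous
  obtain ⟨δ, hδ, hZ⟩ := hcomp.exists_cthickening_subset_open isOpen_interior hseg
  set Z := cthickening δ (segment ℝ m v) with hZdef
  have hZconv : Convex ℝ Z := (convex_segment m v).cthickening δ
  have hmball : ball m δ ⊆ Z :=
    (ball_subset_thickening (left_mem_segment ℝ m v) δ).trans (thickening_subset_cthickening _ _)
  have hvball : ball v δ ⊆ Z :=
    (ball_subset_thickening (right_mem_segment ℝ m v) δ).trans (thickening_subset_cthickening _ _)
  have hdisj : Disjoint Z (A b₀) := disjoint_left.mpr fun x hx =>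
    hA₀.notMem_of_mem_interior (hZ hx)
  have hev : ∀ᶠ b' in 𝓝 b₀, Z ⊆ interior (convexHull ℝ (A b')) := by
    filter_upwards [hA, husc Z isClosed_cthickening hdisj, hlsc a ha _ (ball_mem_nhds a hδ),
      hlsc b hb _ (ball_mem_nhds b hδ)] with b' h1 h2 h3 h4
    obtain ⟨a', ha', had⟩ := h3
    obtain ⟨c', hc', hcd⟩ := h4
    refine h1.subset_interior_of_isPreconnected hZconv.isPreconnected h2
      ⟨midpoint ℝ a' c', hmball ?_, (convex_convexHull ℝ _).midpoint_mem
        (subset_convexHull ℝ _ ha') (subset_convexHull ℝ _ hc')⟩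
    rw [mem_ball] at *
    have := dist_midpoint_midpoint_le a' c' a b
    linarith
  rw [nhds_prod_eq]
  filter_upwards [hev.prod_mk (ball_mem_nhds v hδ)] with z hz
  exact hz.1 (hvball hz.2)

/-- A closed half-space with v in its interior misses A b₀, hence also the nearby slices, whose
hulls stay in the complementary half-space. -/
theorem eventually_notMem_convexHull [FiniteDimensional ℝ V]
    (hA : ∀ᶠ b in 𝓝 b₀, IsStrictlyConvexBoundary (A b))
    (husc : ∀ K : Set V, IsClosed K → Disjoint K (A b₀) → ∀ᶠ b in 𝓝 b₀, Disjoint K (A b))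
    {v : V} (hv : v ∉ convexHull ℝ (A b₀)) :
    ∀ᶠ z : B × V in 𝓝 (b₀, v), z.2 ∉ convexHull ℝ (A z.1) := by
  have hA₀ := hA.self_of_nhds
  obtain ⟨l, c, hlc, hlv⟩ := geometric_hahn_banach_closed_point (convex_convexHull ℝ (A b₀))
    hA₀.isClosed_convexHull hv
  have hK : IsClosed {x | c ≤ l x} := isClosed_le continuous_const l.continuous
  have hdisj : Disjoint {x | c ≤ l x} (A b₀) := disjoint_left.mpr fun x hx hxA =>
    absurd (hlc x (subset_convexHull ℝ _ hxA)) (not_lt.mpr hx)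
  rw [nhds_prod_eq]
  filter_upwards [(husc _ hK hdisj).prod_mk
    ((isOpen_lt continuous_const l.continuous).mem_nhds hlv)] with z hz hmem
  have hsub : convexHull ℝ (A z.1) ⊆ {x | l x < c} := by
    refine convexHull_min (fun x hx => ?_) (convex_halfSpace_lt l.toLinearMap.isLinear c)
    by_contra h
    have h' : c ≤ l x := not_lt.mp h
    exact disjoint_left.mp hz.1 h' hx
  exact lt_asymm (hsub hmem) hz.2

theorem exists_eventually_convexHull_subset_closedBall
    (hA : IsStrictlyConvexBoundary (A b₀))
    (husc : ∀ K : Set V, IsClosed K → Disjoint K (A b₀) → ∀ᶠ b in 𝓝 b₀, Disjoint K (A b)) :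
    ∃ R : ℝ, ∀ᶠ b in 𝓝 b₀, convexHull ℝ (A b) ⊆ closedBall 0 R := by
  obtain ⟨R, hR⟩ := hA.isCompact.isBounded.subset_ball 0
  refine ⟨R, ?_⟩
  have hdisj : Disjoint (ball (0 : V) R)ᶜ (A b₀) := disjoint_left.mpr fun x hx hxA => hx (hR hxA)
  filter_upwards [husc _ isOpen_ball.isClosed_compl hdisj] with b hb
  refine convexHull_min (fun x hx => ?_) (convex_closedBall 0 R)
  by_contra hxR
  exact disjoint_left.mp hb (fun h => hxR (ball_subset_closedBall h)) hx

end Families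

/-! ### Fibrewise hulls in the cotangent bundle -/

section CotangentSlices

variable {n : ℕ} {M : Type*} [TopologicalSpace M]
  [ChartedSpace (EuclideanSpace ℝ (Fin n)) M] [IsManifold (𝓡 n) ∞ M]

/-- The preferred trivialization of `T*M` near `q`. -/
noncomputable abbrev cotangentTriv (n : ℕ) {M : Type*} [TopologicalSpace M]
    [ChartedSpace (EuclideanSpace ℝ (Fin n)) M] [IsManifold (𝓡 n) ∞ M] (q : M) :
    Trivialization (ModelCovector n)
      (TotalSpace.proj : CotangentBundle n M → M) :=
  trivializationAt (ModelCovector n) (fun q : M => CotangentSpace n q) q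

/-- The identification of a nearby fibre of `T*M` with the model fibre. -/
noncomputable def cotangentTrivEquiv (q : M) {b : M} (hb : b ∈ (cotangentTriv n q).baseSet) :
    ModelCovector n ≃L[ℝ] ModelCovector n :=
  (cotangentTriv n q).continuousLinearEquivAt ℝ b hb

theorem cotangentTriv_apply (q : M) {b : M} (hb : b ∈ (cotangentTriv n q).baseSet)
    (p : ModelCovector n) :
    cotangentTriv n q (⟨b, p⟩ : CotangentBundle n M) = (b, cotangentTrivEquiv q hb p) :=
  (cotangentTriv n q).apply_eq_prod_continuousLinearEquivAt ℝ b hb p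

/-- The slices of `S` read in the trivialization near `q`. -/
def trivSlice (S : Set (CotangentBundle n M)) (q b : M) : Set (ModelCovector n) :=
  (fun p : ModelCovector n => (cotangentTriv n q (⟨b, p⟩ : CotangentBundle n M)).2) ''
    fibreSlice S b

theorem trivSlice_eq_image (S : Set (CotangentBundle n M)) (q : M) {b : M}
    (hb : b ∈ (cotangentTriv n q).baseSet) :
    trivSlice S q b = cotangentTrivEquiv q hb '' fibreSlice S b :=
  image_congr fun p _ => by rw [cotangentTriv_apply q hb]

theorem mem_trivSlice_iff (S : Set (CotangentBundle n M)) (q : M) {x : CotangentBundle n M}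
    (hx : x.proj ∈ (cotangentTriv n q).baseSet) :
    (cotangentTriv n q x).2 ∈ trivSlice S q x.proj ↔ x ∈ S := by
  obtain ⟨b, p⟩ := x
  rw [trivSlice_eq_image S q hx,
    show cotangentTriv n q (⟨b, p⟩ : CotangentBundle n M) = (b, cotangentTrivEquiv q hx p) from
      cotangentTriv_apply q hx p]
  exact (cotangentTrivEquiv q hx).injective.mem_set_image

/-- The union of the fibrewise convex hulls of `S`. -/
def fibrewiseHull (S : Set (CotangentBundle n M)) : Set (CotangentBundle n M) :=
  {x | (x.snd : ModelCovector n) ∈ convexHull ℝ (fibreSlice S x.proj)}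

/-- The union of the interiors of the fibrewise convex hulls of `S`. -/
def fibrewiseInterior (S : Set (CotangentBundle n M)) : Set (CotangentBundle n M) :=
  {x | (x.snd : ModelCovector n) ∈ interior (convexHull ℝ (fibreSlice S x.proj))}

theorem mem_fibrewiseHull_iff (S : Set (CotangentBundle n M)) (q : M) {x : CotangentBundle n M}
    (hx : x.proj ∈ (cotangentTriv n q).baseSet) :
    x ∈ fibrewiseHull S ↔ (cotangentTriv n q x).2 ∈ convexHull ℝ (trivSlice S q x.proj) := by
  obtain ⟨b, p⟩ := x
  rw [trivSlice_eq_image S q hx,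
    show cotangentTriv n q (⟨b, p⟩ : CotangentBundle n M) = (b, cotangentTrivEquiv q hx p) from
      cotangentTriv_apply q hx p]
  have h : convexHull ℝ (cotangentTrivEquiv q hx '' fibreSlice S b) =
      cotangentTrivEquiv q hx '' convexHull ℝ (fibreSlice S b) :=
    ((cotangentTrivEquiv q hx : ModelCovector n →L[ℝ] ModelCovector n).toLinearMap.image_convexHull
      (fibreSlice S b)).symm
  change _ ↔ cotangentTrivEquiv q hx p ∈ convexHull ℝ (cotangentTrivEquiv q hx '' fibreSlice S b)
  rw [h]
  exact (cotangentTrivEquiv q hx).injective.mem_set_image.symm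

theorem mem_fibrewiseInterior_iff (S : Set (CotangentBundle n M)) (q : M)
    {x : CotangentBundle n M} (hx : x.proj ∈ (cotangentTriv n q).baseSet) :
    x ∈ fibrewiseInterior S ↔
      (cotangentTriv n q x).2 ∈ interior (convexHull ℝ (trivSlice S q x.proj)) := by
  obtain ⟨b, p⟩ := x
  rw [trivSlice_eq_image S q hx,
    show cotangentTriv n q (⟨b, p⟩ : CotangentBundle n M) = (b, cotangentTrivEquiv q hx p) from
      cotangentTriv_apply q hx p]
  have h : convexHull ℝ (cotangentTrivEquiv q hx '' fibreSlice S b) =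
      cotangentTrivEquiv q hx '' convexHull ℝ (fibreSlice S b) :=
    ((cotangentTrivEquiv q hx : ModelCovector n →L[ℝ] ModelCovector n).toLinearMap.image_convexHull
      (fibreSlice S b)).symm
  have h2 : interior (cotangentTrivEquiv q hx '' convexHull ℝ (fibreSlice S b)) =
      cotangentTrivEquiv q hx '' interior (convexHull ℝ (fibreSlice S b)) :=
    ((cotangentTrivEquiv q hx).toHomeomorph.image_interior _).symm
  change _ ↔ cotangentTrivEquiv q hx p ∈
    interior (convexHull ℝ (cotangentTrivEquiv q hx '' fibreSlice S b))
  rw [h, h2]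
  exact (cotangentTrivEquiv q hx).injective.mem_set_image.symm

theorem one_lt_rank_modelCovector (hn : 2 ≤ n) : 1 < Module.rank ℝ (ModelCovector n) := by
  rw [← Module.finrank_eq_rank]
  have : Module.finrank ℝ (ModelCovector n) = n := by
    rw [(LinearMap.toContinuousLinearMap (𝕜 := ℝ) (E := EuclideanSpace ℝ (Fin n))
      (F' := ℝ)).symm.finrank_eq]
    exact Subspace.dual_finrank_eq.trans finrank_euclideanSpace_fin
  rw [this]
  exact_mod_cast hn

variable {S : Set (CotangentBundle n M)}

theorem IsConvexHypersurface.isStrictlyConvexBoundary_trivSlice (hn : 2 ≤ n)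
    (hS : IsConvexHypersurface S) (q : M) {b : M} (hb : b ∈ (cotangentTriv n q).baseSet) :
    IsStrictlyConvexBoundary (trivSlice S q b) := by
  rw [trivSlice_eq_image S q hb]
  exact ((hS.convex b).isStrictlyConvexBoundary (one_lt_rank_modelCovector hn)).image _

theorem cotangentTriv_baseSet_mem_nhds (q : M) : (cotangentTriv n q).baseSet ∈ 𝓝 q :=
  (cotangentTriv n q).open_baseSet.mem_nhds (FiberBundle.mem_baseSet_trivializationAt' q)

theorem IsConvexHypersurface.eventually_isStrictlyConvexBoundary (hn : 2 ≤ n)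
    (hS : IsConvexHypersurface S) (q : M) :
    ∀ᶠ b in 𝓝 q, IsStrictlyConvexBoundary (trivSlice S q b) := by
  filter_upwards [cotangentTriv_baseSet_mem_nhds (n := n) q] with b hb
  exact hS.isStrictlyConvexBoundary_trivSlice hn q hb

/-- The points of S over a closed neighbourhood of q with fibre coordinate in K form a compact set;
its projection is closed and misses q. -/
theorem IsConvexHypersurface.eventually_disjoint_trivSlice [T2Space M] [CompactSpace M]
    (hS : IsConvexHypersurface S) (q : M) (K : Set (ModelCovector n)) (hK : IsClosed K)
    (hdisj : Disjoint K (trivSlice S q q)) : ∀ᶠ b in 𝓝 q, Disjoint K (trivSlice S q b) := by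
  have hbase := cotangentTriv_baseSet_mem_nhds (n := n) q
  obtain ⟨K', ⟨hK'n, hK'c⟩, hK'sub⟩ := (closed_nhds_basis q).mem_iff.mp hbase
  have hcl : IsClosed {x : CotangentBundle n M | x.proj ∈ K' ∧ (cotangentTriv n q x).2 ∈ K} := by
    have hcont : ContinuousOn (fun x => (cotangentTriv n q x).2)
        (TotalSpace.proj ⁻¹' K' : Set (CotangentBundle n M)) := by
      refine continuous_snd.comp_continuousOn ((cotangentTriv n q).continuousOn.mono ?_)
      intro x hx
      rw [(cotangentTriv n q).source_eq]
      exact hK'sub hx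
    exact hcont.preimage_isClosed_of_isClosed
      (hK'c.preimage (FiberBundle.continuous_proj (ModelCovector n) _)) hK
  have hR := (hS.isCompact.inter_right hcl).image
    (FiberBundle.continuous_proj (ModelCovector n) (fun q : M => CotangentSpace n q))
  have hq : q ∉ TotalSpace.proj ''
      (S ∩ {x : CotangentBundle n M | x.proj ∈ K' ∧ (cotangentTriv n q x).2 ∈ K}) := by
    rintro ⟨x, ⟨hxS, hxK', hxK⟩, hxq⟩
    have h1 := (mem_trivSlice_iff S q (hK'sub hxK')).mpr hxS
    rw [hxq] at h1
    exact disjoint_left.mp hdisj hxK h1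
  filter_upwards [hR.isClosed.isOpen_compl.mem_nhds hq, hK'n] with b hb hbK'
  rw [disjoint_left]
  rintro v hvK ⟨p, hp, rfl⟩
  exact hb ⟨⟨b, p⟩, ⟨hp, hbK', hvK⟩, rfl⟩

/-- This is `eventually_slice_inter_nonempty` read in the bundle chart, which is the trivialization
followed by the base chart. Only regularity of S in T*M is used, not transversality to the fibres.
-/
theorem IsConvexHypersurface.eventually_trivSlice_inter_nonempty (hn : 2 ≤ n)
    (hS : IsConvexHypersurface S) (q : M) (v : ModelCovector n) (hv : v ∈ trivSlice S q q)
    (O : Set (ModelCovector n)) (hO : O ∈ 𝓝 v) : ∀ᶠ b in 𝓝 q, (trivSlice S q b ∩ O).Nonempty := by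
  obtain ⟨p, hp, hpv⟩ := hv
  set x₀ : CotangentBundle n M := ⟨q, p⟩ with hx₀
  obtain ⟨U, F, hU, hxU, hF, hSU, hdF⟩ := hS.smooth x₀ hp
  set Φ := extChartAt (cotangentModel n) x₀ with hΦ
  have hΦeq : Φ = (cotangentTriv n q).toPartialEquiv ≫
      (extChartAt (𝓡 n) q).prod (PartialEquiv.refl (ModelCovector n)) :=
    FiberBundle.extChartAt x₀
  set e₀ := extChartAt (𝓡 n) q q with he₀
  have hxs : x₀ ∈ (cotangentTriv n q).source := by
    rw [(cotangentTriv n q).source_eq]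
    have hqb : q ∈ (cotangentTriv n q).baseSet :=
      mem_of_mem_nhds (cotangentTriv_baseSet_mem_nhds q)
    exact hqb
  have hΦx₀ : Φ x₀ = (e₀, v) := by
    rw [hΦeq, ← hpv]
    exact Prod.ext (congrArg (extChartAt (𝓡 n) q) ((cotangentTriv n q).coe_fst hxs)) rfl
  set W := Φ.target ∩ Φ.symm ⁻¹' U with hWdef
  have hWo : IsOpen W :=
    (continuousOn_extChartAt_symm x₀).isOpen_inter_preimage (isOpen_extChartAt_target x₀) hU
  have hxW : (e₀, v) ∈ W := by
    rw [← hΦx₀]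
    refine ⟨mem_extChartAt_target x₀, ?_⟩
    rw [mem_preimage, extChartAt_to_inv]
    exact hxU
  have hFs : ContDiffOn ℝ 1 (F ∘ Φ.symm) W := by
    have h1 : ContMDiffOn (𝓘(ℝ, EuclideanSpace ℝ (Fin n) × ModelCovector n)) (cotangentModel n) ∞
        Φ.symm W := (contMDiffOn_extChartAt_symm x₀).mono inter_subset_left
    have h2 := hF.comp h1 inter_subset_right
    exact (contMDiffOn_iff_contDiffOn.mp h2).of_le (by exact_mod_cast le_top)
  have hdFs : fderiv ℝ (F ∘ Φ.symm) (e₀, v) ≠ 0 := by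
    intro h0
    apply hdF
    have hmd : MDifferentiableAt (cotangentModel n) 𝓘(ℝ, ℝ) F x₀ :=
      (hF.contMDiffAt (hU.mem_nhds hxU)).mdifferentiableAt (by simp)
    refine hmd.mfderiv.trans ?_
    rw [ModelWithCorners.range_eq_univ, fderivWithin_univ, ← hΦ, hΦx₀]
    exact h0
  have hev := eventually_slice_inter_nonempty (one_lt_rank_modelCovector hn) hWo hxW hFs hdFs
    (A := fun e => trivSlice S q ((extChartAt (𝓡 n) q).symm e)) ?_ ?_ ?_ hO
  · have hc : Filter.Tendsto (extChartAt (𝓡 n) q) (𝓝 q) (𝓝 e₀) := continuousAt_extChartAt q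
    filter_upwards [hc.eventually hev, extChartAt_source_mem_nhds (I := 𝓡 n) q] with b hb hbs
    rwa [(extChartAt (𝓡 n) q).left_inv hbs] at hb
  · have hc : Filter.Tendsto (extChartAt (𝓡 n) q).symm (𝓝 e₀) (𝓝 q) := by
      have := continuousAt_extChartAt_symm (I := 𝓡 n) q
      rwa [ContinuousAt, extChartAt_to_inv] at this
    exact hc.eventually (hS.eventually_isStrictlyConvexBoundary hn q)
  · intro e w hew
    have hys : Φ.symm (e, w) ∈ Φ.source := Φ.map_target hew.1
    have hΦy : Φ (Φ.symm (e, w)) = (e, w) := Φ.right_inv hew.1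
    have hyU : Φ.symm (e, w) ∈ U := hew.2
    rw [Function.comp_apply]
    generalize Φ.symm (e, w) = y at hys hΦy hyU
    rw [hΦeq] at hys hΦy
    have hyT : y ∈ (cotangentTriv n q).source := hys.1
    have hyb : y.proj ∈ (cotangentTriv n q).baseSet := by
      rwa [(cotangentTriv n q).source_eq] at hyT
    have hy1 : extChartAt (𝓡 n) q (cotangentTriv n q y).1 = e := congrArg Prod.fst hΦy
    have hy2 : (cotangentTriv n q y).2 = w := congrArg Prod.snd hΦy
    have hyc : (cotangentTriv n q y).1 ∈ (extChartAt (𝓡 n) q).source := hys.2.1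
    rw [(cotangentTriv n q).coe_fst hyT] at hy1 hyc
    rw [← hy1, (extChartAt (𝓡 n) q).left_inv hyc, ← hy2, mem_trivSlice_iff S q hyb]
    have := Set.ext_iff.mp hSU y
    constructor
    · intro h
      exact (this.mp ⟨h, hyU⟩).2
    · intro h
      exact (this.mpr ⟨hyU, h⟩).1
  · rw [he₀, extChartAt_to_inv]
    exact ⟨p, hp, hpv⟩

theorem IsConvexHypersurface.isOpen_fibrewiseInterior [T2Space M] [CompactSpace M] (hn : 2 ≤ n)
    (hS : IsConvexHypersurface S) : IsOpen (fibrewiseInterior S) := by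
  rw [isOpen_iff_mem_nhds]
  intro x hx
  have hxb : x.proj ∈ (cotangentTriv n x.proj).baseSet :=
    mem_of_mem_nhds (cotangentTriv_baseSet_mem_nhds x.proj)
  have hxs : x ∈ (cotangentTriv n x.proj).source := by
    rw [(cotangentTriv n x.proj).source_eq]
    exact hxb
  have h1 := (mem_fibrewiseInterior_iff S x.proj hxb).mp hx
  have hev := eventually_mem_interior_convexHull (hS.eventually_isStrictlyConvexBoundary hn x.proj)
    (hS.eventually_trivSlice_inter_nonempty hn x.proj) (hS.eventually_disjoint_trivSlice x.proj) h1
  have hTx : cotangentTriv n x.proj x = (x.proj, (cotangentTriv n x.proj x).2) :=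
    Prod.ext ((cotangentTriv n x.proj).coe_fst hxs) rfl
  have hc : Filter.Tendsto (cotangentTriv n x.proj) (𝓝 x)
      (𝓝 (x.proj, (cotangentTriv n x.proj x).2)) := by
    rw [← hTx]
    exact (cotangentTriv n x.proj).continuousAt hxs
  filter_upwards [hc.eventually hev, (cotangentTriv n x.proj).open_source.mem_nhds hxs]
    with y hy hys
  have hyb : y.proj ∈ (cotangentTriv n x.proj).baseSet := by
    rwa [(cotangentTriv n x.proj).source_eq] at hys
  rw [mem_fibrewiseInterior_iff S x.proj hyb]
  rwa [(cotangentTriv n x.proj).coe_fst hys] at hy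

theorem IsConvexHypersurface.isClosed_fibrewiseHull [T2Space M] [CompactSpace M] (hn : 2 ≤ n)
    (hS : IsConvexHypersurface S) : IsClosed (fibrewiseHull S) := by
  rw [← isOpen_compl_iff, isOpen_iff_mem_nhds]
  intro x hx
  have hxb : x.proj ∈ (cotangentTriv n x.proj).baseSet :=
    mem_of_mem_nhds (cotangentTriv_baseSet_mem_nhds x.proj)
  have hxs : x ∈ (cotangentTriv n x.proj).source := by
    rw [(cotangentTriv n x.proj).source_eq]
    exact hxb
  have h1 : (cotangentTriv n x.proj x).2 ∉ convexHull ℝ (trivSlice S x.proj x.proj) := fun h =>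
    hx ((mem_fibrewiseHull_iff S x.proj hxb).mpr h)
  have hev := eventually_notMem_convexHull (hS.eventually_isStrictlyConvexBoundary hn x.proj)
    (hS.eventually_disjoint_trivSlice x.proj) h1
  have hTx : cotangentTriv n x.proj x = (x.proj, (cotangentTriv n x.proj x).2) :=
    Prod.ext ((cotangentTriv n x.proj).coe_fst hxs) rfl
  have hc : Filter.Tendsto (cotangentTriv n x.proj) (𝓝 x)
      (𝓝 (x.proj, (cotangentTriv n x.proj x).2)) := by
    rw [← hTx]
    exact (cotangentTriv n x.proj).continuousAt hxs
  filter_upwards [hc.eventually hev, (cotangentTriv n x.proj).open_source.mem_nhds hxs]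
    with y hy hys
  have hyb : y.proj ∈ (cotangentTriv n x.proj).baseSet := by
    rwa [(cotangentTriv n x.proj).source_eq] at hys
  rw [mem_compl_iff, mem_fibrewiseHull_iff S x.proj hyb]
  rwa [(cotangentTriv n x.proj).coe_fst hys] at hy

/-- Over a small closed neighbourhood the hulls stay in a fixed ball of the trivialization, so the
closed set `fibrewiseHull S` is covered by finitely many compact sets. -/
theorem IsConvexHypersurface.isCompact_fibrewiseHull [T2Space M] [CompactSpace M] (hn : 2 ≤ n)
    (hS : IsConvexHypersurface S) : IsCompact (fibrewiseHull S) := by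
  have hloc : ∀ q : M, ∃ N ∈ 𝓝 q, ∃ K : Set (CotangentBundle n M), IsCompact K ∧
      ∀ x ∈ fibrewiseHull S, x.proj ∈ N → x ∈ K := by
    intro q
    have hbase := cotangentTriv_baseSet_mem_nhds (n := n) q
    obtain ⟨R, hR⟩ := exists_eventually_convexHull_subset_closedBall
      (hS.eventually_isStrictlyConvexBoundary hn q).self_of_nhds
      (hS.eventually_disjoint_trivSlice q)
    obtain ⟨K', ⟨hK'n, hK'c⟩, hK'sub⟩ := (closed_nhds_basis q).mem_iff.mp
      (Filter.inter_mem hbase hR)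
    refine ⟨K', hK'n, (cotangentTriv n q).toOpenPartialHomeomorph.symm ''
      (K' ×ˢ Metric.closedBall 0 R), ?_, ?_⟩
    · refine (hK'c.isCompact.prod (isCompact_closedBall 0 R)).image_of_continuousOn ?_
      refine (cotangentTriv n q).toOpenPartialHomeomorph.continuousOn_symm.mono ?_
      intro z hz
      exact (cotangentTriv n q).mem_target.mpr (hK'sub hz.1).1
    · intro x hx hxK
      have hxs : x ∈ (cotangentTriv n q).source := by
        rw [(cotangentTriv n q).source_eq]
        exact (hK'sub hxK).1
      refine ⟨cotangentTriv n q x, ⟨?_, ?_⟩, (cotangentTriv n q).left_inv hxs⟩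
      · rw [(cotangentTriv n q).coe_fst hxs]
        exact hxK
      · exact (hK'sub hxK).2 ((mem_fibrewiseHull_iff S q (hK'sub hxK).1).mp hx)
  choose N hN K hK hNK using hloc
  obtain ⟨t, ht⟩ := isCompact_univ.elim_nhds_subcover N (fun q _ => hN q)
  refine (t.isCompact_biUnion fun q _ => hK q).of_isClosed_subset (hS.isClosed_fibrewiseHull hn) ?_
  intro x hx
  obtain ⟨q, hq, hxq⟩ := mem_iUnion₂.mp (ht.2 (mem_univ x.proj))
  exact mem_iUnion₂.mpr ⟨q, hq, hNK q x hx hxq⟩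

theorem IsConvexHypersurface.fibrewiseHull_diff (hn : 2 ≤ n) (hS : IsConvexHypersurface S)
    {x : CotangentBundle n M} (hx : x ∈ fibrewiseHull S) (hxS : x ∉ S) :
    x ∈ fibrewiseInterior S :=
  ((hS.convex x.proj).isStrictlyConvexBoundary (one_lt_rank_modelCovector hn)).mem_interior hx hxS

end CotangentSlices

/-! ### A section inside the hypersurface -/

section InteriorSection

variable {n : ℕ} {M : Type*} [TopologicalSpace M] [T2Space M] [CompactSpace M]
  [ChartedSpace (EuclideanSpace ℝ (Fin n)) M] [IsManifold (𝓡 n) ∞ M]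
  {S : Set (CotangentBundle n M)}

/-- A closed convex hypersurface encloses a section of the cotangent bundle. -/
theorem IsConvexHypersurface.exists_section_mem_fibrewiseInterior (hn : 2 ≤ n)
    (hS : IsConvexHypersurface S) :
    ∃ s : M → CotangentBundle n M, Continuous s ∧ (∀ x, (s x).proj = x) ∧
      ∀ x, s x ∈ fibrewiseInterior S := by
  -- A section constant in the trivialization stays near q in the open set of interiors; convexity
  -- of its fibres lets a partition of unity patch such sections.
  have hloc : ∀ q : M, ∃ N ∈ 𝓝 q, ∃ σ : ∀ y : M, CotangentSpace n y,
      ContMDiffOn (𝓡 n) (cotangentModel n) ∞ (fun y => (⟨y, σ y⟩ : CotangentBundle n M)) N ∧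
      ∀ y ∈ N, σ y ∈ {p : ModelCovector n | p ∈ interior (convexHull ℝ (fibreSlice S y))} := by
    intro q
    have hqb : q ∈ (cotangentTriv n q).baseSet :=
      mem_of_mem_nhds (cotangentTriv_baseSet_mem_nhds (n := n) q)
    obtain ⟨p, hp⟩ := ((hS.convex q).isStrictlyConvexBoundary
      (one_lt_rank_modelCovector hn)).interior_nonempty
    set v := (cotangentTriv n q (⟨q, p⟩ : CotangentBundle n M)).2
    have hc : ContMDiffOn (𝓡 n) (cotangentModel n) ∞
        (fun y => (cotangentTriv n q).toOpenPartialHomeomorph.symm (y, v))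
        (cotangentTriv n q).baseSet :=
      (cotangentTriv n q).contMDiffOn_symm.comp
        (contMDiffOn_id.prodMk contMDiffOn_const)
        (fun y hy => (cotangentTriv n q).mem_target.mpr hy)
    have hsec : ∀ y ∈ (cotangentTriv n q).baseSet,
        (⟨y, (cotangentTriv n q).symm y v⟩ : CotangentBundle n M) =
          (cotangentTriv n q).toOpenPartialHomeomorph.symm (y, v) :=
      fun y hy => (cotangentTriv n q).mk_symm hy v
    have hq : (cotangentTriv n q).toOpenPartialHomeomorph.symm (q, v) =
        (⟨q, p⟩ : CotangentBundle n M) := by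
      have hqs : (⟨q, p⟩ : CotangentBundle n M) ∈ (cotangentTriv n q).source :=
        (cotangentTriv n q).mem_source.mpr hqb
      have hqv : cotangentTriv n q (⟨q, p⟩ : CotangentBundle n M) = (q, v) :=
        Prod.ext ((cotangentTriv n q).coe_fst hqs) rfl
      rw [← hqv]
      exact (cotangentTriv n q).left_inv hqs
    have hnear : ∀ᶠ y in 𝓝 q,
        (cotangentTriv n q).toOpenPartialHomeomorph.symm (y, v) ∈ fibrewiseInterior S := by
      refine (hc.continuousOn.continuousAt (cotangentTriv_baseSet_mem_nhds q)).eventually_mem ?_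
      rw [hq]
      exact (hS.isOpen_fibrewiseInterior hn).mem_nhds hp
    refine ⟨_, Filter.inter_mem (cotangentTriv_baseSet_mem_nhds (n := n) q) hnear,
      fun y => (cotangentTriv n q).symm y v, ?_, ?_⟩
    · exact (hc.mono inter_subset_left).congr fun y hy => hsec y hy.1
    · intro y hy
      have h := hy.2
      rw [mem_ofPred_eq, ← hsec y hy.1] at h
      exact h
  obtain ⟨s, hs⟩ := exists_contMDiffSection_forall_mem_convex_of_local (𝓡 n) (n := ⊤)
    (F_fiber := ModelCovector n) (fun q : M => CotangentSpace n q)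
    (fun q => {p : ModelCovector n | p ∈ interior (convexHull ℝ (fibreSlice S q))})
    (fun q => (convex_convexHull ℝ (fibreSlice S q)).interior) hloc
  exact ⟨fun x => ⟨x, s x⟩, s.contMDiff.continuous, fun _ => rfl, hs⟩

end InteriorSection

/-! ### Homotopies of idempotents -/

section Intertwining

variable {R : Type*} [NormedRing R]

/-- The intertwiner equals Q P + (1 - Q)(1 - P); both products are Q P. The form used shows that it
is close to 1 when P is close to Q. -/
theorem intertwine_idempotents {P Q : R} (hP : P * P = P) (hQ : Q * Q = Q) :
    (1 - (P - Q) * (2 * P - 1)) * P = Q * (1 - (P - Q) * (2 * P - 1)) := by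
  have h1 : (1 - (P - Q) * (2 * P - 1)) * P = P - (P - Q) * (2 * (P * P) - P) := by noncomm_ring
  have h2 : Q * (1 - (P - Q) * (2 * P - 1)) =
      Q - (2 * (Q * (P * 1)) * P - Q * P - 2 * ((Q * Q) * P) + Q * Q) := by noncomm_ring
  have h3 : (P - Q) * (2 * P - P) = P * P - Q * P := by noncomm_ring
  have h4 : 2 * (Q * (P * 1)) * P = 2 * (Q * (P * P)) := by noncomm_ring
  rw [h1, h2, hP, h3, hP, hQ, h4, hP]
  noncomm_ring

/-- A homotopy of families of idempotents is induced by a family of invertible elements. -/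
theorem exists_isUnit_intertwining [CompleteSpace R] {X : Type*} [TopologicalSpace X]
    [CompactSpace X] {P : unitInterval × X → R} (hP : Continuous P) (hidem : ∀ z, P z * P z = P z) :
    ∃ U : unitInterval × X → R, Continuous U ∧ (∀ x, U (0, x) = 1) ∧ (∀ z, IsUnit (U z)) ∧
      ∀ t x, U (t, x) * P (0, x) = P (t, x) * U (t, x) := by
  obtain ⟨B, hB⟩ := isCompact_univ.exists_bound_of_continuousOn
    (f := fun z => 2 * P z - 1) (by fun_prop)
  set C : C(unitInterval, C(X, R)) := ContinuousMap.curry ⟨P, hP⟩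
  have hCP : ∀ t x, C t x = P (t, x) := fun _ _ => rfl
  -- Time steps below δ change P by less than 1 / (|B| + 1), while ‖2P - 1‖ < |B| + 1; each
  -- elementary intertwiner is then 1 minus an element of norm less than 1.
  obtain ⟨δ, hδ, hδP⟩ := Metric.uniformContinuous_iff.mp
    (CompactSpace.uniformContinuous_of_continuous C.continuous) (1 / (|B| + 1)) (by positivity)
  obtain ⟨N, hN⟩ := exists_nat_one_div_lt hδ
  set c : ℕ → unitInterval := fun k => projIcc 0 1 zero_le_one ((k : ℝ) / (N + 1)) with hc
  have hstep : ∀ (k : ℕ) (t : unitInterval), dist (t ⊓ c k) (t ⊓ c (k + 1)) < δ := by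
    intro k t
    have h1 : dist (c k) (c (k + 1)) ≤ 1 / (N + 1) := by
      have h := (LipschitzWith.projIcc (zero_le_one (α := ℝ))).dist_le_mul
        ((k : ℝ) / (N + 1)) (((k + 1 : ℕ) : ℝ) / (N + 1))
      refine h.trans (le_of_eq ?_)
      rw [NNReal.coe_one, one_mul, Real.dist_eq, ← sub_div]
      push_cast
      rw [show (k : ℝ) - (k + 1) = -1 by ring, abs_div, abs_neg, abs_one,
        abs_of_pos (by positivity : (0 : ℝ) < N + 1)]
    refine lt_of_le_of_lt (le_trans ?_ h1) hN
    rw [Subtype.dist_eq, Subtype.dist_eq, Real.dist_eq, Real.dist_eq]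
    change |min (t : ℝ) (c k) - min (t : ℝ) (c (k + 1))| ≤ _
    rw [min_comm, min_comm (t : ℝ)]
    exact abs_inf_sub_inf_le_abs _ _ _
  -- The homotopy is stopped at time c k. Passing to c (k + 1) multiplies by one elementary
  -- intertwiner, which is 1 at t = 0.
  have main : ∀ k : ℕ, ∃ U : unitInterval × X → R, Continuous U ∧ (∀ x, U (0, x) = 1) ∧
      (∀ z, IsUnit (U z)) ∧ ∀ t x, U (t, x) * P (0, x) = P (t ⊓ c k, x) * U (t, x) := by
    intro k
    induction k with
    | zero =>
      refine ⟨fun _ => 1, continuous_const, fun _ => rfl, fun _ => isUnit_one, fun t x => ?_⟩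
      have : t ⊓ c 0 = 0 := by
        have h0 : c 0 = 0 := by
          rw [hc]
          simp only [Nat.cast_zero, zero_div]
          exact projIcc_left _
        rw [h0]
        exact inf_eq_right.mpr unitInterval.nonneg'
      rw [this, one_mul, mul_one]
    | succ k ih =>
      obtain ⟨U, hU, hU0, hUu, hUP⟩ := ih
      set W : unitInterval × X → R := fun z =>
        1 - (P (z.1 ⊓ c k, z.2) - P (z.1 ⊓ c (k + 1), z.2)) * (2 * P (z.1 ⊓ c k, z.2) - 1) with hW
      have hPk : ∀ j, Continuous (fun z : unitInterval × X => P (z.1 ⊓ c j, z.2)) := fun j =>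
        hP.comp ((continuous_fst.inf continuous_const).prodMk continuous_snd)
      refine ⟨fun z => W z * U z, ?_, ?_, ?_, ?_⟩
      · exact (continuous_const.sub (((hPk k).sub (hPk (k + 1))).mul
          ((continuous_const.mul (hPk k)).sub continuous_const))).mul hU
      · intro x
        simp [hW, hU0]
      · intro z
        refine IsUnit.mul ?_ (hUu z)
        refine isUnit_one_sub_of_norm_lt_one ?_
        have h1 : ‖P (z.1 ⊓ c k, z.2) - P (z.1 ⊓ c (k + 1), z.2)‖ < 1 / (|B| + 1) := by
          rw [← dist_eq_norm, ← hCP, ← hCP]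
          exact lt_of_le_of_lt (ContinuousMap.dist_apply_le_dist z.2) (hδP (hstep k z.1))
        have h2 : ‖2 * P (z.1 ⊓ c k, z.2) - 1‖ < |B| + 1 :=
          lt_of_le_of_lt ((hB (z.1 ⊓ c k, z.2) (mem_univ _)).trans (le_abs_self B))
            (lt_add_one _)
        calc _ ≤ ‖P (z.1 ⊓ c k, z.2) - P (z.1 ⊓ c (k + 1), z.2)‖ *
              ‖2 * P (z.1 ⊓ c k, z.2) - 1‖ := norm_mul_le _ _
          _ < 1 / (|B| + 1) * (|B| + 1) := mul_lt_mul'' h1 h2 (norm_nonneg _) (norm_nonneg _)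
          _ = 1 := by field_simp
      · intro t x
        have h := intertwine_idempotents (hidem (t ⊓ c k, x)) (hidem (t ⊓ c (k + 1), x))
        change W (t, x) * P (t ⊓ c k, x) = P (t ⊓ c (k + 1), x) * W (t, x) at h
        change W (t, x) * U (t, x) * P (0, x) = P (t ⊓ c (k + 1), x) * (W (t, x) * U (t, x))
        rw [mul_assoc, hUP, ← mul_assoc, h, mul_assoc]
  obtain ⟨U, hU, hU0, hUu, hUP⟩ := main (N + 1)
  refine ⟨U, hU, hU0, hUu, fun t x => ?_⟩
  have h1 : c (N + 1) = 1 := by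
    rw [hc]
    simp only [Nat.cast_add, Nat.cast_one]
    rw [div_self (by positivity : (N : ℝ) + 1 ≠ 0)]
    exact projIcc_right _
  rw [hUP, h1, inf_eq_left.mpr unitInterval.le_one']

end Intertwining

/-! ### Continuity of orthogonal projections -/

section Projections

variable {E V : Type*} [NormedAddCommGroup E] [InnerProductSpace ℝ E] [FiniteDimensional ℝ E]
  [NormedAddCommGroup V] [InnerProductSpace ℝ V] [FiniteDimensional ℝ V]

theorem isUnit_adjoint_comp_self {A : E →L[ℝ] V} (hA : Function.Injective A) :
    IsUnit (A.adjoint ∘L A) := by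
  rw [ContinuousLinearMap.isUnit_iff_bijective]
  have hinj : Function.Injective (A.adjoint ∘L A) := by
    rw [injective_iff_map_eq_zero]
    intro x hx
    have h : inner ℝ (A x) (A x) = 0 := by
      rw [← ContinuousLinearMap.adjoint_inner_left]
      have hx' : A.adjoint (A x) = 0 := hx
      rw [hx', inner_zero_left]
    exact (injective_iff_map_eq_zero A).mp hA x (inner_self_eq_zero.mp h)
  exact ⟨hinj, (LinearMap.injective_iff_surjective
    (f := ((A.adjoint ∘L A : E →L[ℝ] E) : E →ₗ[ℝ] E))).mp hinj⟩

/-- These are the normal equations of least squares; the formula makes the continuous dependence on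
A visible. -/
theorem starProjection_range_eq {A : E →L[ℝ] V} (hA : IsUnit (A.adjoint ∘L A)) :
    (LinearMap.range (A : E →ₗ[ℝ] V)).starProjection =
      A ∘L (Ring.inverse (A.adjoint ∘L A)) ∘L A.adjoint := by
  ext v
  refine Submodule.eq_starProjection_of_mem_of_inner_eq_zero ⟨_, rfl⟩ ?_
  rintro _ ⟨w, rfl⟩
  have h : (A.adjoint ∘L A) (Ring.inverse (A.adjoint ∘L A) (A.adjoint v)) = A.adjoint v :=
    congrArg (fun T : E →L[ℝ] E => T (A.adjoint v)) (Ring.mul_inverse_cancel _ hA)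
  have h' : A.adjoint (A (Ring.inverse (A.adjoint ∘L A) (A.adjoint v))) = A.adjoint v := h
  change inner ℝ (v - A (Ring.inverse (A.adjoint ∘L A) (A.adjoint v))) (A w) = 0
  rw [← ContinuousLinearMap.adjoint_inner_left, map_sub, h', sub_self, inner_zero_left]

theorem continuousAt_starProjection_orthogonal_range {X : Type*} [TopologicalSpace X] {x₀ : X}
    {A : X → E →L[ℝ] V} (hA : ContinuousAt A x₀) (hinj : Function.Injective (A x₀)) :
    ContinuousAt (fun x => (LinearMap.range (A x : E →ₗ[ℝ] V))ᗮ.starProjection) x₀ := by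
  have hadj : ContinuousAt (fun x => (A x).adjoint) x₀ :=
    (ContinuousLinearMap.adjoint (𝕜 := ℝ) (E := E) (F := V)).continuous.continuousAt.comp hA
  have hG : ContinuousAt (fun x => (A x).adjoint ∘L A x) x₀ := hadj.clm_comp hA
  have hu := isUnit_adjoint_comp_self hinj
  have hinv : ContinuousAt (fun x => Ring.inverse ((A x).adjoint ∘L A x)) x₀ := by
    refine ContinuousAt.comp (g := Ring.inverse) ?_ hG
    obtain ⟨u, hu⟩ := hu
    rw [← hu]
    exact NormedRing.inverse_continuousAt u
  have hev : ∀ᶠ x in 𝓝 x₀, IsUnit ((A x).adjoint ∘L A x) :=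
    hG.eventually_mem (Units.isOpen.mem_nhds hu)
  refine (continuousAt_const.sub (hA.clm_comp (hinv.clm_comp hadj))).congr
    (f := fun x => ContinuousLinearMap.id ℝ V - A x ∘L (Ring.inverse ((A x).adjoint ∘L A x) ∘L
      (A x).adjoint)) ?_
  filter_upwards [hev] with x hx
  rw [Submodule.starProjection_orthogonal, starProjection_range_eq hx]

end Projections

/-! ### Normal components of chords -/

section LocalParametrizations

open Metric

variable {E V M : Type*} [NormedAddCommGroup E] [InnerProductSpace ℝ E]
  [NormedAddCommGroup V] [InnerProductSpace ℝ V] [TopologicalSpace M]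

/-- Near `y₀`, the map `e` is given by an immersion `f` read in the coordinates `a`, and the
subspaces `T y` are the tangent spaces of its image. -/
def HasLocalParametrization (E : Type*) {V M : Type*} [NormedAddCommGroup E] [NormedSpace ℝ E]
    [NormedAddCommGroup V] [NormedSpace ℝ V] [TopologicalSpace M] (e : M → V)
    (T : M → Submodule ℝ V) (y₀ : M) : Prop :=
  ∃ (a : M → E) (f : E → V), ContinuousAt a y₀ ∧ ContDiffAt ℝ 2 f (a y₀) ∧
    Function.Injective (fderiv ℝ f (a y₀)) ∧
    (∀ᶠ y in 𝓝 y₀, f (a y) = e y ∧ T y = LinearMap.range (fderiv ℝ f (a y) : E →ₗ[ℝ] V)) ∧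
    ∀ b, f b ∈ range e

variable {e : M → V} {T : M → Submodule ℝ V} {y₀ : M}

/-- The segment from a nearest point is normal. -/
theorem HasLocalParametrization.sub_mem_orthogonal (h : HasLocalParametrization E e T y₀) {z : V}
    (hz : ∀ y, ‖z - e y₀‖ ≤ ‖z - e y‖) : z - e y₀ ∈ (T y₀)ᗮ := by
  obtain ⟨a, f, -, hf, -, hT, hfe⟩ := h
  obtain ⟨h1, h2⟩ := hT.self_of_nhds
  -- All values of f lie in the range of e, so a y₀ minimises the squared distance over the whole of
  -- E.
  have hmin : IsLocalMin (fun b => ‖z - f b‖ ^ 2) (a y₀) := by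
    refine Filter.Eventually.of_forall fun b => ?_
    obtain ⟨y, hy⟩ := hfe b
    simp only [h1, ← hy]
    gcongr
    exact hz y
  have hd : HasFDerivAt f (fderiv ℝ f (a y₀)) (a y₀) :=
    (hf.differentiableAt (by simp)).hasFDerivAt
  have hd2 := (hd.const_sub z).norm_sq
  have h0 := hmin.hasFDerivAt_eq_zero hd2
  rw [h2, Submodule.mem_orthogonal]
  rintro _ ⟨v, rfl⟩
  have hv := congrArg (fun l : E →L[ℝ] ℝ => l v) h0
  rw [real_inner_comm, ← h1, inner_sub_left]
  have hv' : inner ℝ (f (a y₀)) (fderiv ℝ f (a y₀) v) - inner ℝ z (fderiv ℝ f (a y₀) v) = 0 := by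
    simpa using hv
  exact sub_eq_zero.mpr (sub_eq_zero.mp hv').symm

variable [FiniteDimensional ℝ E] [FiniteDimensional ℝ V]

theorem HasLocalParametrization.continuousAt_starProjection
    (h : HasLocalParametrization E e T y₀) :
    ContinuousAt (fun y => (T y)ᗮ.starProjection) y₀ := by
  obtain ⟨a, f, ha, hf, hinj, hT, -⟩ := h
  have hA : ContinuousAt (fun y => fderiv ℝ f (a y)) y₀ :=
    ContinuousAt.comp (g := fderiv ℝ f)
      ((hf.fderiv_right (m := 1) (by norm_num)).continuousAt) ha
  refine (continuousAt_starProjection_orthogonal_range hA hinj).congr ?_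
  filter_upwards [hT] with y hy
  rw [hy.2]

/-- The normal component of a chord is quadratically small. -/
theorem HasLocalParametrization.exists_norm_starProjection_le
    (h : HasLocalParametrization E e T y₀) :
    ∃ C : ℝ, ∀ᶠ z : M × M in 𝓝 (y₀, y₀),
      ‖(T z.1)ᗮ.starProjection (e z.2 - e z.1)‖ ≤ C * ‖e z.2 - e z.1‖ ^ 2 := by
  obtain ⟨a, f, ha, hf, hinj, hT, -⟩ := h
  have hf' : ContDiffAt ℝ 1 (fderiv ℝ f) (a y₀) := hf.fderiv_right (m := 1) (by norm_num)
  obtain ⟨L, t, ht, hL⟩ := hf'.exists_lipschitzOnWith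
  obtain ⟨κ, hκ, hanti⟩ := (fderiv ℝ f (a y₀) : E →ₗ[ℝ] V).exists_antilipschitzWith
    (LinearMap.ker_eq_bot.mpr hinj)
  have hdiff : ∀ᶠ b in 𝓝 (a y₀), DifferentiableAt ℝ f b :=
    (hf.eventually (by simp)).mono fun b hb => hb.differentiableAt (by simp)
  have hstrict : HasStrictFDerivAt f (fderiv ℝ f (a y₀)) (a y₀) :=
    hf.hasStrictFDerivAt (by simp)
  obtain ⟨s, hs, hsa⟩ := hstrict.approximates_deriv_on_nhds (c := (2 * κ)⁻¹)
    (Or.inr (by positivity))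
  obtain ⟨r, hr, hball⟩ := Metric.mem_nhds_iff.mp
    (Filter.inter_mem (Filter.inter_mem ht hdiff) hs)
  refine ⟨L * (2 * κ) ^ 2, ?_⟩
  have hev : ∀ᶠ y in 𝓝 y₀, a y ∈ ball (a y₀) r ∧ f (a y) = e y ∧
      T y = LinearMap.range (fderiv ℝ f (a y) : E →ₗ[ℝ] V) :=
    (ha.eventually_mem (ball_mem_nhds _ hr)).and hT
  rw [nhds_prod_eq]
  filter_upwards [hev.prod_mk hev] with z hz
  obtain ⟨⟨h1, h1e, h1T⟩, h2, h2e, -⟩ := hz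
  rw [← h1e, ← h2e]
  generalize a z.1 = u at *
  generalize a z.2 = w at *
  -- The derivative at a y₀ expands lengths by at least 1/κ, and the approximation error uses up at
  -- most half of this.
  have hlow : ‖w - u‖ ≤ 2 * κ * ‖f w - f u‖ := by
    have e1 := hsa w (hball h2).2 u (hball h1).2
    have e2 := hanti.le_mul_dist w u
    rw [dist_eq_norm, dist_eq_norm, ← map_sub] at e2
    have e3 : ‖fderiv ℝ f (a y₀) (w - u)‖ ≤
        ‖f w - f u - fderiv ℝ f (a y₀) (w - u)‖ + ‖f w - f u‖ := by
      rw [norm_sub_rev]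
      exact norm_le_norm_sub_add _ _
    have hκ' : (0 : ℝ) < κ := hκ
    have e4 : ‖w - u‖ ≤ κ * ((2 * κ : ℝ)⁻¹ * ‖w - u‖ + ‖f w - f u‖) := by
      refine e2.trans ?_
      gcongr
      refine e3.trans ?_
      gcongr
      simpa using e1
    have e5 : (κ : ℝ) * ((2 * κ : ℝ)⁻¹ * ‖w - u‖ + ‖f w - f u‖) =
        ‖w - u‖ / 2 + κ * ‖f w - f u‖ := by field_simp
    linarith
  -- The normal projection kills the first-order term, leaving the Taylor remainder, which is
  -- quadratic because the derivative is Lipschitz.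
  have htaylor : ‖f w - f u - fderiv ℝ f u (w - u)‖ ≤ L * ‖w - u‖ * ‖w - u‖ := by
    have hseg : segment ℝ u w ⊆ ball (a y₀) r := (convex_ball _ _).segment_subset h1 h2
    refine (convex_segment u w).norm_image_sub_le_of_norm_hasFDerivWithin_le'
      (f' := fderiv ℝ f) (fun x hx => ?_) (fun x hx => ?_) (left_mem_segment ℝ u w)
      (right_mem_segment ℝ u w)
    · exact (hball (hseg hx)).1.2.hasFDerivAt.hasFDerivWithinAt
    · rw [← dist_eq_norm]
      refine (hL.dist_le_mul x (hball (hseg hx)).1.1 u (hball h1).1.1).trans ?_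
      gcongr
      rw [dist_eq_norm]
      exact norm_sub_le_of_mem_segment hx
  have hproj : (T z.1)ᗮ.starProjection (fderiv ℝ f u (w - u)) = 0 := by
    refine Submodule.starProjection_orthogonal_apply_eq_zero ?_
    rw [h1T]
    exact ⟨_, rfl⟩
  calc ‖(T z.1)ᗮ.starProjection (f w - f u)‖
      = ‖(T z.1)ᗮ.starProjection (f w - f u - fderiv ℝ f u (w - u))‖ := by
        rw [map_sub _ (f w - f u), hproj, sub_zero]
    _ ≤ ‖f w - f u - fderiv ℝ f u (w - u)‖ := by
        refine ((T z.1)ᗮ.starProjection.le_opNorm _).trans ?_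
        exact mul_le_of_le_one_left (norm_nonneg _) (Submodule.starProjection_norm_le _)
    _ ≤ L * ‖w - u‖ * ‖w - u‖ := htaylor
    _ ≤ L * (2 * κ * ‖f w - f u‖) * (2 * κ * ‖f w - f u‖) := by gcongr
    _ = L * (2 * κ) ^ 2 * ‖f w - f u‖ ^ 2 := by ring

end LocalParametrizations

/-! ### Continuity of nearest points -/

section NearestPoints

open Metric

variable {V M : Type*} [PseudoMetricSpace V] [TopologicalSpace M] [CompactSpace M] {e : M → V}

theorem exists_dist_eq_infDist_range [Nonempty M] (he : Continuous e) (z : V) :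
    ∃ y, dist z (e y) = infDist z (range e) := by
  obtain ⟨_, ⟨y, rfl⟩, hy⟩ := (isCompact_range he).exists_infDist_eq_dist (range_nonempty e) z
  exact ⟨y, hy.symm⟩

/-- Nearest points depend continuously on the point wherever they are unique. -/
theorem continuousOn_of_unique_nearest (he : Continuous e) {ρ : V → M}
    {D : Set V} (huniq : ∀ z ∈ D, ∀ y, dist z (e y) = infDist z (range e) → y = ρ z)
    (hρ : ∀ z, dist z (e (ρ z)) = infDist z (range e)) : ContinuousOn ρ D := by
  intro z hz
  -- By compactness ρ converges along each ultrafilter; the limit is a nearest point to z, so it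
  -- equals ρ z.
  rw [ContinuousWithinAt, Filter.tendsto_iff_ultrafilter]
  intro g hg
  obtain ⟨y, -, hy⟩ := isCompact_univ.ultrafilter_le_nhds (g.map ρ) (by simp)
  have hgz : Filter.Tendsto id (g : Filter V) (𝓝 z) := hg.trans nhdsWithin_le_nhds
  have hgy : Filter.Tendsto ρ (g : Filter V) (𝓝 y) := hy
  have h1 : Filter.Tendsto (fun z => dist z (e (ρ z))) (g : Filter V) (𝓝 (dist z (e y))) :=
    hgz.dist ((he.tendsto y).comp hgy)
  have h2 : Filter.Tendsto (fun z => infDist z (range e)) (g : Filter V)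
      (𝓝 (infDist z (range e))) := (continuous_infDist_pt (range e)).continuousAt.tendsto.comp hgz
  simp_rw [hρ] at h1
  rw [← huniq z hz y (tendsto_nhds_unique h1 h2)]
  exact hgy

end NearestPoints

/-! ### Tubular neighbourhoods and extension of the homotopy -/

section TubularNeighbourhood

open Metric

variable {E V M : Type*} [NormedAddCommGroup E] [InnerProductSpace ℝ E] [FiniteDimensional ℝ E]
  [NormedAddCommGroup V] [InnerProductSpace ℝ V] [FiniteDimensional ℝ V] [TopologicalSpace M]
  [CompactSpace M] {e : M → V} {T : M → Submodule ℝ V}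

/-- By compactness of M × M it suffices to argue locally: at the diagonal the quadratic bound
applies, and near other pairs chord lengths are bounded below. -/
theorem exists_norm_starProjection_chord_le (he : Continuous e) (hinj : Function.Injective e)
    (hT : ∀ y, HasLocalParametrization E e T y) :
    ∃ C : ℝ, ∀ y y', ‖(T y)ᗮ.starProjection (e y' - e y)‖ ≤ C * ‖e y' - e y‖ ^ 2 := by
  suffices h : ∃ C : ℝ, ∀ z ∈ (univ : Set (M × M)),
      ‖(T z.1)ᗮ.starProjection (e z.2 - e z.1)‖ ≤ C * ‖e z.2 - e z.1‖ ^ 2 by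
    obtain ⟨C, hC⟩ := h
    exact ⟨C, fun y y' => hC (y, y') (mem_univ _)⟩
  refine (isCompact_univ (X := M × M)).induction_on (p := fun s => ∃ C : ℝ, ∀ z ∈ s,
    ‖(T z.1)ᗮ.starProjection (e z.2 - e z.1)‖ ≤ C * ‖e z.2 - e z.1‖ ^ 2) ?_ ?_ ?_ ?_
  · exact ⟨0, fun z hz => hz.elim⟩
  · rintro s t hst ⟨C, hC⟩
    exact ⟨C, fun z hz => hC z (hst hz)⟩
  · rintro s t ⟨C, hC⟩ ⟨D, hD⟩
    refine ⟨max C D, fun z hz => ?_⟩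
    rcases hz with hz | hz
    · exact (hC z hz).trans (by gcongr; exact le_max_left _ _)
    · exact (hD z hz).trans (by gcongr; exact le_max_right _ _)
  · rintro ⟨y, y'⟩ -
    rw [nhdsWithin_univ]
    rcases eq_or_ne y y' with rfl | hne
    · obtain ⟨C, hC⟩ := (hT y).exists_norm_starProjection_le
      exact ⟨_, hC, C, fun z hz => hz⟩
    · have hpos : 0 < ‖e y' - e y‖ := norm_pos_iff.mpr (sub_ne_zero.mpr (hinj.ne hne.symm))
      have hc : Continuous (fun z : M × M => ‖e z.2 - e z.1‖) :=
        ((he.comp continuous_snd).sub (he.comp continuous_fst)).norm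
      refine ⟨_, hc.continuousAt.eventually_mem (Ioi_mem_nhds (half_lt_self hpos)),
        (‖e y' - e y‖ / 2)⁻¹, fun z hz => ?_⟩
      have hz' : ‖e y' - e y‖ / 2 < ‖e z.2 - e z.1‖ := hz
      have h1 : ‖(T z.1)ᗮ.starProjection (e z.2 - e z.1)‖ ≤ ‖e z.2 - e z.1‖ :=
        ((T z.1)ᗮ.starProjection.le_opNorm _).trans
          (mul_le_of_le_one_left (norm_nonneg _) (Submodule.starProjection_norm_le _))
      refine h1.trans ?_
      rw [inv_mul_eq_div, le_div_iff₀ (by positivity), pow_two]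
      gcongr

/-- Short normal vectors of an embedded compact manifold do not meet. -/
theorem exists_pos_eq_of_add_normal_eq (he : Continuous e) (hinj : Function.Injective e)
    (hT : ∀ y, HasLocalParametrization E e T y) :
    ∃ ε : ℝ, 0 < ε ∧ ∀ y y' : M, ∀ ν ∈ (T y)ᗮ, ∀ ν' ∈ (T y')ᗮ, ‖ν‖ ≤ ε → ‖ν'‖ ≤ ε →
      e y + ν = e y' + ν' → y = y' := by
  obtain ⟨C, hC⟩ := exists_norm_starProjection_chord_le he hinj hT
  have hchord : ∀ y y' : M, ∀ ν ∈ (T y)ᗮ,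
      inner ℝ ν (e y' - e y) ≤ ‖ν‖ * (|C| * ‖e y' - e y‖ ^ 2) := by
    intro y y' ν hν
    have h1 : inner ℝ ν (e y' - e y) = inner ℝ ν ((T y)ᗮ.starProjection (e y' - e y)) := by
      rw [← Submodule.inner_starProjection_left_eq_right,
        Submodule.starProjection_eq_self_iff.mpr hν]
    rw [h1]
    refine (real_inner_le_norm _ _).trans ?_
    gcongr
    exact (hC y y').trans (by gcongr; exact le_abs_self C)
  -- If normals of length at most ε met, d² would be a sum of two pairings of a normal with a chord,
  -- each at most ε |C| d² < d² / 2.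
  refine ⟨(2 * (|C| + 1))⁻¹, by positivity, fun y y' ν hν ν' hν' hn hn' heq => ?_⟩
  by_contra hne
  set d := ‖e y' - e y‖ with hd
  have hpos : 0 < d := norm_pos_iff.mpr (sub_ne_zero.mpr (hinj.ne (Ne.symm hne)))
  have hsub : e y' - e y = ν - ν' := by
    rw [sub_eq_sub_iff_add_eq_add, ← heq, add_comm]
  have h0 : d ^ 2 = inner ℝ ν (e y' - e y) + inner ℝ ν' (e y - e y') := by
    rw [← neg_sub (e y') (e y), inner_neg_right, ← sub_eq_add_neg, ← inner_sub_left, ← hsub,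
      real_inner_self_eq_norm_sq]
  have h1 := hchord y y' ν hν
  have h2 := hchord y' y ν' hν'
  rw [norm_sub_rev (e y) (e y')] at h2
  rw [← hd] at h1 h2
  have h3 : d ^ 2 ≤ 2 * ((2 * (|C| + 1))⁻¹ * (|C| * d ^ 2)) := by
    have h4 : ‖ν‖ * (|C| * d ^ 2) ≤ (2 * (|C| + 1))⁻¹ * (|C| * d ^ 2) := by gcongr
    have h5 : ‖ν'‖ * (|C| * d ^ 2) ≤ (2 * (|C| + 1))⁻¹ * (|C| * d ^ 2) := by gcongr
    linarith
  have h4 : 2 * ((2 * (|C| + 1))⁻¹ * (|C| * d ^ 2)) = d ^ 2 * (|C| / (|C| + 1)) := by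
    field_simp
  rw [h4] at h3
  have h5 : |C| / (|C| + 1) < 1 := by
    rw [div_lt_one (by positivity)]
    exact lt_add_one _
  nlinarith [pow_pos hpos 2]

/-- A map of a compact embedded manifold which is homotopic to the identity is surjective. -/
theorem surjective_of_homotopic_id_of_hasLocalParametrization (he : Continuous e)
    (hinj : Function.Injective e) (hT : ∀ y, HasLocalParametrization E e T y)
    {H : unitInterval × M → M} (hH : Continuous H) (hH0 : ∀ x, H (0, x) = x) :
    Function.Surjective (fun x => H (1, x)) := by
  intro q
  by_contra hq
  have : Nonempty M := ⟨q⟩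
  have hTc : Continuous (fun y => (T y)ᗮ.starProjection) :=
    continuous_iff_continuousAt.mpr fun y => (hT y).continuousAt_starProjection
  -- U (t, x) carries normal vectors at x to normal vectors at H (t, x), starting from the identity.
  obtain ⟨U, hU, hU0, hUu, hUP⟩ := exists_isUnit_intertwining
    (P := fun z => (T (H z))ᗮ.starProjection) (hTc.comp hH)
    (fun z => (Submodule.isIdempotentElem_starProjection _))
  obtain ⟨K, hK⟩ := isCompact_univ.exists_bound_of_continuousOn hU.continuousOn
  obtain ⟨ε, hε, huniq⟩ := exists_pos_eq_of_add_normal_eq he hinj hT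
  choose ρ hρ using exists_dist_eq_infDist_range he
  have hnear : ∀ z y, dist z (e y) = infDist z (range e) → z - e y ∈ (T y)ᗮ := by
    intro z y hy
    refine (hT y).sub_mem_orthogonal fun y' => ?_
    rw [← dist_eq_norm, ← dist_eq_norm, hy]
    exact infDist_le_dist_of_mem ⟨y', rfl⟩
  -- Transport stretches lengths by at most |K|, so normals of length at most δ go to normals of
  -- length at most ε, where foot points are unique.
  set δ := ε / (|K| + 1) with hδ
  have hδpos : 0 < δ := by positivity
  have hδε : δ ≤ ε := div_le_self hε.le (by linarith [abs_nonneg K])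
  have hρc : ContinuousOn ρ {z | infDist z (range e) ≤ δ} := by
    refine continuousOn_of_unique_nearest he (fun z hz y hy => ?_) hρ
    have hz' : infDist z (range e) ≤ ε := le_trans hz hδε
    refine huniq y (ρ z) (z - e y) (hnear z y hy) (z - e (ρ z)) (hnear z _ (hρ z)) ?_ ?_ ?_
    · rwa [← dist_eq_norm, hy]
    · rwa [← dist_eq_norm, hρ]
    · rw [add_sub_cancel, add_sub_cancel]
  set τ : V → unitInterval := fun z =>
    projIcc 0 1 zero_le_one (1 - infDist z (range e) / δ) with hτ
  have hτc : Continuous τ := continuous_projIcc.comp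
    (continuous_const.sub ((continuous_infDist_pt _).div_const δ))
  -- G moves the normal disc at a foot point along the homotopy up to time τ, which is 1 on the
  -- manifold and 0 on the boundary of the tube. There G is the identity, so it extends by the
  -- identity.
  set G : V → V := fun z => e (H (τ z, ρ z)) + U (τ z, ρ z) (z - e (ρ z)) with hG
  have hpair : ContinuousOn (fun z => (τ z, ρ z)) {z | infDist z (range e) ≤ δ} :=
    hτc.continuousOn.prodMk hρc
  have hGc : ContinuousOn G {z | infDist z (range e) ≤ δ} :=
    ((he.comp hH).comp_continuousOn hpair).add ((hU.comp_continuousOn hpair).clm_apply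
      (continuousOn_id.sub (he.comp_continuousOn hρc)))
  have hgc : Continuous (fun z => if infDist z (range e) ≤ δ then G z else z) := by
    refine continuous_if_le (continuous_infDist_pt _) continuous_const hGc
      continuousOn_id fun z hz => ?_
    have hτ0 : τ z = 0 := by
      rw [hτ]
      simp only [hz, div_self hδpos.ne', sub_self]
      exact projIcc_left _
    rw [hG]
    simp only [hτ0, hH0, hU0, one_apply_eq_self, add_sub_cancel]
  obtain ⟨R, hR⟩ := (isCompact_range he).isBounded.subset_ball 0
  have hfar : ∀ z : V, R + δ ≤ ‖z‖ → (if infDist z (range e) ≤ δ then G z else z) = z := by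
    intro z hz
    rw [if_neg]
    rw [not_le, ← hρ z]
    have h1 : ‖e (ρ z)‖ < R := by simpa using hR ⟨ρ z, rfl⟩
    have h2 : ‖z‖ ≤ ‖z - e (ρ z)‖ + ‖e (ρ z)‖ := norm_le_norm_sub_add _ _
    rw [dist_eq_norm]
    linarith
  -- In the tube, z is sent to a point of the manifold plus a short normal there. Uniqueness makes
  -- that point q and the normal 0; invertibility of U puts z on the manifold, where τ = 1.
  obtain ⟨z, hz⟩ := surjective_of_continuous_of_eq_id_outside_ball hgc hfar (e q)
  have hd0 : infDist (e q) (range e) = 0 := infDist_zero_of_mem ⟨q, rfl⟩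
  by_cases hzd : infDist z (range e) ≤ δ
  · simp only [if_pos hzd] at hz
    set ν := z - e (ρ z) with hν
    have hνT : (T (ρ z))ᗮ.starProjection ν = ν :=
      Submodule.starProjection_eq_self_iff.mpr (hnear z _ (hρ z))
    have hUν : U (τ z, ρ z) ν ∈ (T (H (τ z, ρ z)))ᗮ := by
      have h := congrArg (fun L : V →L[ℝ] V => L ν) (hUP (τ z) (ρ z))
      simp only [mul_apply_eq_comp, hH0, hνT] at h
      exact Submodule.starProjection_eq_self_iff.mp h.symm
    have hνn : ‖ν‖ ≤ δ := by
      rw [hν, ← dist_eq_norm, hρ]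
      exact hzd
    have hUn : ‖U (τ z, ρ z) ν‖ ≤ ε := by
      calc ‖U (τ z, ρ z) ν‖ ≤ ‖U (τ z, ρ z)‖ * ‖ν‖ := ContinuousLinearMap.le_opNorm _ _
        _ ≤ (|K| + 1) * δ := by
          gcongr
          exact (hK _ (mem_univ _)).trans ((le_abs_self K).trans (by linarith))
        _ = ε := by rw [hδ]; field_simp
    have hHq : H (τ z, ρ z) = q :=
      huniq _ q _ hUν 0 (Submodule.zero_mem _) hUn (by simpa using hε.le) (by rw [add_zero]; exact hz)
    have hUν0 : U (τ z, ρ z) ν = 0 := by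
      have hz' : e (H (τ z, ρ z)) + U (τ z, ρ z) ν = e q := hz
      rw [hHq] at hz'
      exact add_eq_left.mp hz'
    have hν0 : ν = 0 := by
      obtain ⟨W, hW⟩ := hUu (τ z, ρ z)
      have h := congrArg (fun L : V →L[ℝ] V => L ν) W.inv_mul
      rw [hW] at h
      simp only [mul_apply_eq_comp, one_apply_eq_self, hUν0, map_zero] at h
      exact h.symm
    have hdz : infDist z (range e) = 0 := by
      rw [← hρ z, dist_eq_norm, ← hν, hν0, norm_zero]
    have hτ1 : τ z = 1 := by
      rw [hτ]
      simp only [hdz, zero_div, sub_zero]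
      exact projIcc_right _
    exact hq ⟨ρ z, by rw [← hτ1]; exact hHq⟩
  · simp only [if_neg hzd] at hz
    rw [hz, hd0] at hzd
    exact hzd hδpos.le

end TubularNeighbourhood

/-! ### Embedding a closed manifold in Euclidean space -/

section Embedding

variable {n : ℕ} {M : Type*} [TopologicalSpace M] [ChartedSpace (EuclideanSpace ℝ (Fin n)) M]
  [IsManifold (𝓡 n) ∞ M]

/-- The derivative of a map from a manifold to a vector space, as a map of the model space. -/
noncomputable def modelDerivative (n : ℕ) {M : Type*} [TopologicalSpace M]
    [ChartedSpace (EuclideanSpace ℝ (Fin n)) M] {V : Type*} [NormedAddCommGroup V]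
    [NormedSpace ℝ V] (e : M → V) (y : M) : EuclideanSpace ℝ (Fin n) →L[ℝ] V :=
  mfderiv (𝓡 n) 𝓘(ℝ, V) e y

/-- The derivative of e at y is that of its expression in the chart at y₀, composed with the
bijective derivative of the chart, so the ranges agree. -/
theorem hasLocalParametrization_of_immersion {V : Type*} [NormedAddCommGroup V] [NormedSpace ℝ V]
    {e : M → V} (he : ContMDiff (𝓡 n) 𝓘(ℝ, V) ∞ e)
    (hinj : ∀ x, Function.Injective (mfderiv (𝓡 n) 𝓘(ℝ, V) e x)) (y₀ : M) :
    HasLocalParametrization (EuclideanSpace ℝ (Fin n)) e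
      (fun y => LinearMap.range
        (modelDerivative n e y : EuclideanSpace ℝ (Fin n) →ₗ[ℝ] V)) y₀ := by
  set a := extChartAt (𝓡 n) y₀ with ha
  have hf : ContDiffOn ℝ ∞ (e ∘ a.symm) a.target :=
    contMDiffOn_iff_contDiffOn.mp (he.comp_contMDiffOn (contMDiffOn_extChartAt_symm y₀))
  have ht : ∀ y ∈ a.source, a.target ∈ 𝓝 (a y) := fun y hy =>
    (isOpen_extChartAt_target y₀).mem_nhds (a.map_source hy)
  have hchain : ∀ y ∈ a.source, ∃ A : EuclideanSpace ℝ (Fin n) →L[ℝ] EuclideanSpace ℝ (Fin n),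
      Function.Bijective A ∧
      ∀ v, modelDerivative n e y v =
        fderiv ℝ (e ∘ a.symm) (a y) (A v) := by
    intro y hy
    obtain ⟨A, hA⟩ := isInvertible_mfderiv_extChartAt (I := 𝓡 n) (x := y₀) (y := y) hy
    refine ⟨mfderiv (𝓡 n) 𝓘(ℝ, EuclideanSpace ℝ (Fin n)) a y, ?_, fun v => ?_⟩
    · rw [← ha] at hA
      rw [← hA]
      exact A.bijective
    · have h1 : e =ᶠ[𝓝 y] (e ∘ a.symm) ∘ a := by
        filter_upwards [(isOpen_extChartAt_source y₀).mem_nhds hy] with x hx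
        rw [Function.comp_apply, Function.comp_apply, a.left_inv hx]
      have h2 : MDifferentiableAt 𝓘(ℝ, EuclideanSpace ℝ (Fin n)) 𝓘(ℝ, V) (e ∘ a.symm) (a y) :=
        ((hf.contDiffAt (ht y hy)).differentiableAt (by simp)).mdifferentiableAt
      have h3 : MDifferentiableAt (𝓡 n) 𝓘(ℝ, EuclideanSpace ℝ (Fin n)) a y :=
        mdifferentiableAt_extChartAt (by rwa [← extChartAt_source (𝓡 n)])
      have h4 := mfderiv_comp y h2 h3
      rw [← h1.mfderiv_eq, mfderiv_eq_fderiv] at h4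
      exact congrArg (fun L : EuclideanSpace ℝ (Fin n) →L[ℝ] V => L v) h4
  refine ⟨a, e ∘ a.symm, continuousAt_extChartAt y₀,
    (hf.contDiffAt (ht y₀ (mem_extChartAt_source y₀))).of_le two_le_smoothness_infty, ?_, ?_,
    fun b => ⟨_, rfl⟩⟩
  · obtain ⟨A, hA, hAv⟩ := hchain y₀ (mem_extChartAt_source y₀)
    intro v w hvw
    obtain ⟨v, rfl⟩ := hA.surjective v
    obtain ⟨w, rfl⟩ := hA.surjective w
    have hvw' : modelDerivative n e y₀ v = modelDerivative n e y₀ w := by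
      rw [hAv, hAv]
      exact hvw
    rw [hinj y₀ hvw']
  · filter_upwards [extChartAt_source_mem_nhds (I := 𝓡 n) y₀] with y hy
    refine ⟨congrArg e (a.left_inv hy), ?_⟩
    obtain ⟨A, hA, hAv⟩ := hchain y hy
    ext v
    constructor
    · rintro ⟨w, rfl⟩
      exact ⟨A w, (hAv w).symm⟩
    · rintro ⟨w, rfl⟩
      obtain ⟨w, rfl⟩ := hA.surjective w
      exact ⟨w, hAv w⟩

/-- A self-map of a closed manifold which is homotopic to the identity is surjective. -/
theorem surjective_of_homotopic_id (n : ℕ) {M : Type*} [TopologicalSpace M] [T2Space M]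
    [CompactSpace M] [ChartedSpace (EuclideanSpace ℝ (Fin n)) M] [IsManifold (𝓡 n) ∞ M]
    {H : unitInterval × M → M}
    (hH : Continuous H) (hH0 : ∀ x, H (0, x) = x) : Function.Surjective (fun x => H (1, x)) := by
  obtain ⟨N, e, he, hemb, hinj⟩ := exists_embedding_euclidean_of_compact (I := 𝓡 n) (M := M)
  exact surjective_of_homotopic_id_of_hasLocalParametrization he.continuous hemb.injective
    (hasLocalParametrization_of_immersion he hinj) hH hH0

end Embedding

/-! ### Topology of the cotangent fibres -/

section CotangentFibres

variable {n : ℕ} {M : Type*} [TopologicalSpace M] [ChartedSpace (EuclideanSpace ℝ (Fin n)) M]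
  [IsManifold (𝓡 n) ∞ M]

theorem fibrewiseInterior_subset (S : Set (CotangentBundle n M)) :
    fibrewiseInterior S ⊆ fibrewiseHull S := fun _ hx =>
  interior_subset (X := ModelCovector n) hx

theorem cotangentFibre_eq_range (q : M) :
    cotangentFibre n q = range (fun p : ModelCovector n => (⟨q, p⟩ : CotangentBundle n M)) := by
  ext ⟨b, p⟩
  constructor
  · rintro rfl
    exact ⟨p, rfl⟩
  · rintro ⟨p, hp⟩
    exact (congrArg TotalSpace.proj hp).symm

theorem isInducing_cotangentFibre_inclusion (q : M) :
    Topology.IsInducing (fun p : ModelCovector n => (⟨q, p⟩ : CotangentBundle n M)) :=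
  FiberBundle.totalSpaceMk_isInducing (ModelCovector n) (fun q : M => CotangentSpace n q) q

theorem not_isCompact_cotangentFibre (hn : 2 ≤ n) (q : M) : ¬ IsCompact (cotangentFibre n q) := by
  intro h
  rw [cotangentFibre_eq_range, ← image_univ,
    ← (isInducing_cotangentFibre_inclusion q).isCompact_iff] at h
  have : CompactSpace (ModelCovector n) := ⟨h⟩
  have hnt : Nontrivial (ModelCovector n) := by
    rw [← rank_pos_iff_nontrivial (R := ℝ)]
    exact zero_lt_one.trans (one_lt_rank_modelCovector hn)
  exact not_compactSpace_iff.mpr (NormedSpace.noncompactSpace ℝ (ModelCovector n)) this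

theorem isClosed_cotangentFibre [T1Space M] (q : M) : IsClosed (cotangentFibre n q) :=
  isClosed_singleton.preimage (FiberBundle.continuous_proj (ModelCovector n)
    (fun q : M => CotangentSpace n q))

theorem isPreconnected_cotangentFibre (q : M) : IsPreconnected (cotangentFibre n q) := by
  rw [cotangentFibre_eq_range]
  exact isPreconnected_range (isInducing_cotangentFibre_inclusion q).continuous

end CotangentFibres

/-! ### Intersection with every fibre -/

theorem mainTheorem7 (n : ℕ) (hn : 2 ≤ n) (M : Type*) [TopologicalSpace M] [T2Space M]
    [CompactSpace M] [ConnectedSpace M] [ChartedSpace (EuclideanSpace ℝ (Fin n)) M]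
    [IsManifold (𝓡 n) ∞ M] (S : Set (CotangentBundle n M)) (hS : IsConvexHypersurface S)
    (ψ : Diffeomorph (cotangentModel n) (cotangentModel n)
      (CotangentBundle n M) (CotangentBundle n M) ∞)
    (hψ : IsIsotopicToId ψ) (q : M) :
    ((ψ '' S) ∩ cotangentFibre n q).Nonempty := by
  by_contra hempty
  have hS' : ∀ x ∈ S, (ψ x).proj ≠ q := fun x hx hxq => hempty ⟨ψ x, ⟨x, hx, rfl⟩, hxq⟩
  obtain ⟨φ, hφ, hφ0, hφ1⟩ := hψ
  obtain ⟨s, hs, hsproj, hsint⟩ := hS.exists_section_mem_fibrewiseInterior hn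
  set A := ψ.symm '' cotangentFibre n q with hA
  have hAψ : ∀ x, (ψ x).proj = q → x ∈ A := fun x hx => ⟨ψ x, hx, ψ.symm_apply_apply x⟩
  have hψA : ∀ x ∈ A, (ψ x).proj = q := by
    rintro _ ⟨y, hy, rfl⟩
    rw [ψ.apply_symm_apply]
    exact hy
  have hApre : IsPreconnected A :=
    (isPreconnected_cotangentFibre q).image _ ψ.symm.continuous.continuousOn
  have hAclosed : IsClosed A := ψ.symm.toHomeomorph.isClosedMap _ (isClosed_cotangentFibre q)
  -- A is connected and avoids S, so meeting the interior would confine it to the compact hull; then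
  -- A, and with it the fibre over q, would be compact.
  have hdisj : Disjoint A (fibrewiseInterior S) := by
    rw [disjoint_left]
    intro x hxA hxint
    have hsub : A ⊆ fibrewiseInterior S ∪ (fibrewiseHull S)ᶜ := by
      intro y hy
      by_cases hyH : y ∈ fibrewiseHull S
      · exact Or.inl (hS.fibrewiseHull_diff hn hyH fun hyS => hS' y hyS (hψA y hy))
      · exact Or.inr hyH
    have hAint : A ⊆ fibrewiseInterior S :=
      hApre.subset_left_of_subset_union (hS.isOpen_fibrewiseInterior hn)
        (hS.isClosed_fibrewiseHull hn).isOpen_compl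
        (disjoint_left.mpr fun y hy hy' => hy' (fibrewiseInterior_subset S hy)) hsub ⟨x, hxA, hxint⟩
    have hAc : IsCompact A := (hS.isCompact_fibrewiseHull hn).of_isClosed_subset hAclosed
      fun y hy => fibrewiseInterior_subset S (hAint hy)
    refine not_isCompact_cotangentFibre hn q ?_
    have himg : ψ '' A = cotangentFibre n q := by
      rw [hA, image_image]
      simp
    rw [← himg]
    exact hAc.image ψ.continuous
  -- The base points of the section, followed along the isotopy; at time 0 this is the identity of
  -- M.
  have hH : Continuous (fun z : unitInterval × M => (φ z.1 (s z.2)).proj) :=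
    (FiberBundle.continuous_proj (ModelCovector n) (fun q : M => CotangentSpace n q)).comp
      (hφ.continuous.comp (continuous_fst.prodMk (hs.comp continuous_snd)))
  obtain ⟨x, hx⟩ := surjective_of_homotopic_id n hH
    (fun x => by rw [hφ0, hsproj]) q
  refine disjoint_left.mp hdisj (hAψ (s x) ?_) (hsint x)
  rw [← hφ1]
  exact hx
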